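/- **Setting.** Let $\mathbb K$ be a field of characteristic $0$. Let $\mathsf{DY}^1$ be the colored PROP (a $\mathbb K$-linear strict symmetric monoidal category whose objects are the finite words in the two colors $[1],[V_1]$, with concatenation as tensor product, $[n]=[1]^{\otimes n}$) generated by morphisms $\mu:[2]\to[1]$, $\delta:[1]\to[2]$, $\pi:[1]\otimes[V_1]\to[V_1]$, $\pi^*:[V_1]\to[1]\otimes[V_1]$, subject to the following relations, in which $fg$ means "first $f$, then $g$", $s$ is the exchange of two copies of $[1]$ and $c$ is the cyclic permutation of three copies of $[1]$: - Lie bialgebra: $(\mathrm{id}+s)\mu=0$; $(\mathrm{id}+c+c^2)(\mu\otimes\mathrm{id})\mu=0$; $\delta(\mathrm{id}+s)=0$; $\delta(\delta\otimes\mathrm{id})(\mathrm{id}+c+c^2)=0$; $\mu\delta=(\mathrm{id}-s)(\delta\otimes\mathrm{id})(\mathrm{id}\otimes\mu)(\mathrm{id}-s)$; - Drinfeld–Yetter module: $(\mu\otimes\mathrm{id})\pi=(\mathrm{id}\otimes\pi)\pi-(s\otimes\mathrm{id})(\mathrm{id}\otimes\pi)\pi$; $\pi^*(\delta\otimes\mathrm{id})=\pi^*(\mathrm{id}\otimes\pi^*)(s\otimes\mathrm{id})-\pi^*(\mathrm{id}\otimes\pi^*)$;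 $\pi\pi^*=(\mathrm{id}\otimes\pi^*)\big((s\otimes\mathrm{id})(\mathrm{id}\otimes\pi)+\mu\otimes\mathrm{id}\big)-(\delta\otimes\mathrm{id})(\mathrm{id}\otimes\pi)$. Let $\pi^{*(n)}:[V_1]\to[n]\otimes[V_1]$ and $\pi^{(n)}:[n]\otimes[V_1]\to[V_1]$ be the iterated coaction and action, $\pi^{*(0)}=\pi^{(0)}=\mathrm{id}$, $\pi^{*(n+1)}=\pi^*(\mathrm{id}_{[1]}\otimes\pi^{*(n)})$, $\pi^{(n+1)}=(\mathrm{id}_{[1]}\otimes\pi^{(n)})\pi$. For $\sigma\in\mathfrak S_n$ put $$r_n^\sigma=\pi^{*(n)}\,(\sigma\otimes\mathrm{id}_{[V_1]})\,\pi^{(n)}\in\mathrm{End}_{\mathsf{DY}^1}([V_1]),$$ where $\sigma:[n]\to[n]$ carries the $i$-th strand to position $\sigma(i)$. In $\mathrm{End}_{\mathsf{DY}^1}([V_1])$ write $x\circ y$ for "first $x$, then $y$". **Looms.** For $n,m\ge1$ an $n\times m$ loom is a filling $L=(L_{i,j})$ of the grid with $n$ rows (numbered from the top) and $m$ columns (from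 the left) by the following tiles, where $0\le k\le m-1$ and $0\le\ell\le n-1$; strings enter a tile through its left and bottom edges and leave it through its top and right edges: - (cross) $k+1$ strings going straight from left to right, crossing $\ell+1$ strings going straight from bottom to top; - (bracket) one string entering from the left and leaving through the top to the left of $\ell+1$ strings going from bottom to top, without crossing them; - (crossing bracket) one string entering from the left, crossing $\ell+1$ strings going from bottom to top, and leaving through the top to the right of them; - (cobracket) one string entering from the left above $k+1$ strings going from left to right, and leaving through the top without crossing them; - (crossing cobracket) one string entering from the left below $k+1$ strings going from left to right, crossing them and leaving through the top; - (horizontal) $k+1$ strings from left to right; (vertical) $\ell+1$ strings from bottom to top; (empty) no string. Let $t_{i,j},b_{i,j},l_{i,j},r_{i,j}$ be the numbers of strings of $L_{i,j}$ on its top, bottom, left, right edge. The conditions are: $b_{i,j}=t_{i+1,j}$ for $i<n$; $r_{i,j}=l_{i,j+1}$ for $j<m$; $\sum_i l_{i,1}+\sum_j b_{n,j}=\sum_i r_{i,m}+\sum_j t_{1,j}=n+m$; no tile of the first row is horizontal or empty; no tile of the first column is vertical or empty. If $n=0$ or $m=0$ there is exactly one loom, consisting of $m$ vertical strings (for $n=0$),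 respectively $n$ horizontal strings (for $m=0$). Let $\mathfrak L_{n,m}$ be the set of $n\times m$ looms, and let $\beta(L)$ be the number of crossing bracket and crossing cobracket tiles of $L$. **The permutation.** Let $\sigma\in\mathfrak S_n$, $L\in\mathfrak L_{n,m}$, $\tau\in\mathfrak S_m$. Number the ingoing strings of $L$ by $1,\dots,n+m$: first those on the left border, in the order of rows $\sigma(1),\dots,\sigma(n)$ and from top to bottom within a row; then those on the bottom border, from left to right. Number the outgoing strings by $1,\dots,n+m$: first those on the top border, in the order of columns $\tau^{-1}(1),\dots,\tau^{-1}(m)$ and from left to right within a column; then those on the right border, from top to bottom. Following each ingoing string through $L$ to its end gives a bijection; let $\tilde\gamma_{n,m}(\sigma,L,\tau)\in\mathfrak S_{n+m}$ send the number of each ingoing string to the number of the outgoing string in which it ends. **Theorem.** For all $n,m\ge0$, $\sigma\in\mathfrak S_n$ and $\tau\in\mathfrak S_m$, $$r_n^\sigma\circ r_m^\tau=\sum_{L\in\mathfrak L_{n,m}}(-1)^{\beta(L)}\,r_{n+m}^{\tilde\gamma_{n,m}(\sigma,L,\tau)}.$$ -/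

import Mathlib

open CategoryTheory

universe u

/-! ## Colored PROPs by generators and relations -/

namespace ColoredProp

/-- The bijection between the positions of a concatenated word `A ++ B` and the disjoint union of
the positions of `A` and those of `B` (in this order). -/
def appendPos {C : Type} (A B : List C) :
    Fin A.length ⊕ Fin B.length ≃ Fin (A ++ B).length :=
  finSumFinEquiv.trans (finCongr List.length_append.symm)

/-- Side by side juxtaposition of two bijections of positions. -/
def posSum {C : Type} {A B A' B' : List C} (σ : Fin A.length ≃ Fin B.length)
    (τ : Fin A'.length ≃ Fin B'.length) : Fin (A ++ A').length ≃ Fin (B ++ B').length :=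
  (appendPos A A').symm.trans ((Equiv.sumCongr σ τ).trans (appendPos B B'))

/-- The bijection of positions exchanging the two blocks of `A ++ B`. -/
def posFlip {C : Type} (A B : List C) : Fin (A ++ B).length ≃ Fin (B ++ A).length :=
  (appendPos A B).symm.trans ((Equiv.sumComm _ _).trans (appendPos B A))

/-- A bijection between the positions of two words that respects colors: the letter at position
`i` of `A` is the letter at position `σ i` of `B`. -/
def RespectsColors {C : Type} {A B : List C} (σ : Fin A.length ≃ Fin B.length) : Prop :=
  ∀ i, B.get (σ i) = A.get i

/-- Formal expressions for the morphisms `A ⟶ B` of the colored PROP over `K` with set of colors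
`C`, freely generated by the morphisms `G`. Composition `comp f g` is written in diagrammatic
order: first `f`, then `g`. `perm σ` is the permutation morphism that sends the strand at position
`i` to position `σ i`. -/
inductive Diagram (K : Type u) {C : Type} (G : List C → List C → Type) :
    List C → List C → Type u
  | gen {A B : List C} (g : G A B) : Diagram K G A B
  | ident (A : List C) : Diagram K G A A
  | comp {A B D : List C} (f : Diagram K G A B) (g : Diagram K G B D) : Diagram K G A D
  | tensor {A B A' B' : List C} (f : Diagram K G A B) (g : Diagram K G A' B') :
      Diagram K G (A ++ A') (B ++ B')
  | perm {A B : List C} (σ : Fin A.length ≃ Fin B.length) (hσ : RespectsColors σ) : Diagram K G A B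
  | zero (A B : List C) : Diagram K G A B
  | add {A B : List C} (f g : Diagram K G A B) : Diagram K G A B
  | smul {A B : List C} (c : K) (f : Diagram K G A B) : Diagram K G A B

namespace Diagram

infixl:65 " +ₑ " => Diagram.add
infixr:75 " ≫ₑ " => Diagram.comp
infixr:80 " ⊗ₑ " => Diagram.tensor

/-- Transport of an expression along equalities of words. -/
def recast {K : Type u} {C : Type} {G : List C → List C → Type} {A A' B B' : List C}
    (hA : A = A') (hB : B = B') (f : Diagram K G A B) : Diagram K G A' B' :=
  hA ▸ hB ▸ f

/-- The difference of two expressions. -/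
def sub {K : Type u} [Ring K] {C : Type} {G : List C → List C → Type} {A B : List C}
    (f g : Diagram K G A B) : Diagram K G A B :=
  f +ₑ smul (-1) g

infixl:65 " -ₑ " => Diagram.sub

end Diagram

open ColoredProp.Diagram

/-- The equality of morphisms in the colored PROP over `K` generated by `G` subject to the
relations `R`: the smallest congruence which contains `R` and makes the expressions into a
`K`-linear strict symmetric monoidal category on words, with tensor product the concatenation.
The symmetric structure consists of the permutation morphisms: they compose and juxtapose as
permutations do, and the block exchanges `A ++ A' ⟶ A' ++ A` are natural. -/
inductive Eqv {K : Type u} [Field K] {C : Type} {G : List C → List C → Type}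
    (R : ∀ A B : List C, Diagram K G A B → Diagram K G A B → Prop) :
    ∀ {A B : List C}, Diagram K G A B → Diagram K G A B → Prop
  -- the imposed relations
  | rel {A B : List C} {f g : Diagram K G A B} (h : R A B f g) : Eqv R f g
  -- congruence
  | refl {A B : List C} (f : Diagram K G A B) : Eqv R f f
  | symm {A B : List C} {f g : Diagram K G A B} : Eqv R f g → Eqv R g f
  | trans {A B : List C} {f g h : Diagram K G A B} : Eqv R f g → Eqv R g h → Eqv R f h
  | comp_congr {A B D : List C} {f f' : Diagram K G A B} {g g' : Diagram K G B D} :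
      Eqv R f f' → Eqv R g g' → Eqv R (f ≫ₑ g) (f' ≫ₑ g')
  | tensor_congr {A B A' B' : List C} {f f' : Diagram K G A B} {g g' : Diagram K G A' B'} :
      Eqv R f f' → Eqv R g g' → Eqv R (f ⊗ₑ g) (f' ⊗ₑ g')
  | add_congr {A B : List C} {f f' g g' : Diagram K G A B} :
      Eqv R f f' → Eqv R g g' → Eqv R (f +ₑ g) (f' +ₑ g')
  | smul_congr {A B : List C} (c : K) {f f' : Diagram K G A B} :
      Eqv R f f' → Eqv R (smul c f) (smul c f')
  -- the morphisms between two words form a vector space over `K`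
  | add_assoc {A B : List C} (f g h : Diagram K G A B) : Eqv R (f +ₑ g +ₑ h) (f +ₑ (g +ₑ h))
  | add_comm {A B : List C} (f g : Diagram K G A B) : Eqv R (f +ₑ g) (g +ₑ f)
  | add_zero {A B : List C} (f : Diagram K G A B) : Eqv R (f +ₑ zero A B) f
  | zero_smul {A B : List C} (f : Diagram K G A B) : Eqv R (smul 0 f) (zero A B)
  | one_smul {A B : List C} (f : Diagram K G A B) : Eqv R (smul 1 f) f
  | mul_smul {A B : List C} (c d : K) (f : Diagram K G A B) :
      Eqv R (smul (c * d) f) (smul c (smul d f))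
  | add_smul {A B : List C} (c d : K) (f : Diagram K G A B) :
      Eqv R (smul (c + d) f) (smul c f +ₑ smul d f)
  | smul_add {A B : List C} (c : K) (f g : Diagram K G A B) :
      Eqv R (smul c (f +ₑ g)) (smul c f +ₑ smul c g)
  -- category
  | id_comp {A B : List C} (f : Diagram K G A B) : Eqv R (ident A ≫ₑ f) f
  | comp_id {A B : List C} (f : Diagram K G A B) : Eqv R (f ≫ₑ ident B) f
  | comp_assoc {A B D E : List C} (f : Diagram K G A B) (g : Diagram K G B D) (h : Diagram K G D E) :
      Eqv R ((f ≫ₑ g) ≫ₑ h) (f ≫ₑ g ≫ₑ h)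
  -- composition and tensor product are bilinear
  | add_comp {A B D : List C} (f f' : Diagram K G A B) (g : Diagram K G B D) :
      Eqv R ((f +ₑ f') ≫ₑ g) (f ≫ₑ g +ₑ f' ≫ₑ g)
  | comp_add {A B D : List C} (f : Diagram K G A B) (g g' : Diagram K G B D) :
      Eqv R (f ≫ₑ (g +ₑ g')) (f ≫ₑ g +ₑ f ≫ₑ g')
  | smul_comp {A B D : List C} (c : K) (f : Diagram K G A B) (g : Diagram K G B D) :
      Eqv R (smul c f ≫ₑ g) (smul c (f ≫ₑ g))
  | comp_smul {A B D : List C} (c : K) (f : Diagram K G A B) (g : Diagram K G B D) :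
      Eqv R (f ≫ₑ smul c g) (smul c (f ≫ₑ g))
  | add_tensor {A B A' B' : List C} (f f' : Diagram K G A B) (g : Diagram K G A' B') :
      Eqv R ((f +ₑ f') ⊗ₑ g) (f ⊗ₑ g +ₑ f' ⊗ₑ g)
  | tensor_add {A B A' B' : List C} (f : Diagram K G A B) (g g' : Diagram K G A' B') :
      Eqv R (f ⊗ₑ (g +ₑ g')) (f ⊗ₑ g +ₑ f ⊗ₑ g')
  | smul_tensor {A B A' B' : List C} (c : K) (f : Diagram K G A B) (g : Diagram K G A' B') :
      Eqv R (smul c f ⊗ₑ g) (smul c (f ⊗ₑ g))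
  | tensor_smul {A B A' B' : List C} (c : K) (f : Diagram K G A B) (g : Diagram K G A' B') :
      Eqv R (f ⊗ₑ smul c g) (smul c (f ⊗ₑ g))
  -- the tensor product is a bifunctor
  | tensor_id (A B : List C) : Eqv R (ident A ⊗ₑ ident B) (ident (A ++ B))
  | interchange {A B D A' B' D' : List C} (f : Diagram K G A B) (g : Diagram K G B D)
      (f' : Diagram K G A' B') (g' : Diagram K G B' D') :
      Eqv R ((f ⊗ₑ f') ≫ₑ (g ⊗ₑ g')) ((f ≫ₑ g) ⊗ₑ (f' ≫ₑ g'))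
  -- the tensor product is strictly associative and unital
  | tensor_assoc {A B A' B' A'' B'' : List C} (f : Diagram K G A B) (g : Diagram K G A' B')
      (h : Diagram K G A'' B'') :
      Eqv R (((f ⊗ₑ g) ⊗ₑ h).recast (List.append_assoc _ _ _) (List.append_assoc _ _ _))
        (f ⊗ₑ g ⊗ₑ h)
  | unit_tensor {A B : List C} (f : Diagram K G A B) : Eqv R (ident [] ⊗ₑ f) f
  | tensor_unit {A B : List C} (f : Diagram K G A B) :
      Eqv R ((f ⊗ₑ ident []).recast (List.append_nil _) (List.append_nil _)) f
  -- permutation morphisms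
  | perm_id (A : List C) (h : RespectsColors (Equiv.refl (Fin A.length))) :
      Eqv R (perm (Equiv.refl _) h) (ident A)
  | perm_comp {A B D : List C} (σ : Fin A.length ≃ Fin B.length)
      (τ : Fin B.length ≃ Fin D.length) (hσ : RespectsColors σ) (hτ : RespectsColors τ)
      (h : RespectsColors (σ.trans τ)) :
      Eqv R (perm σ hσ ≫ₑ perm τ hτ) (perm (σ.trans τ) h)
  | perm_tensor {A B A' B' : List C} (σ : Fin A.length ≃ Fin B.length)
      (τ : Fin A'.length ≃ Fin B'.length) (hσ : RespectsColors σ) (hτ : RespectsColors τ)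
      (h : RespectsColors (posSum σ τ)) :
      Eqv R (perm σ hσ ⊗ₑ perm τ hτ) (perm (posSum σ τ) h)
  | flip_natural {A B A' B' : List C} (f : Diagram K G A B) (g : Diagram K G A' B')
      (h : RespectsColors (posFlip A A')) (h' : RespectsColors (posFlip B B')) :
      Eqv R ((f ⊗ₑ g) ≫ₑ perm (posFlip B B') h') (perm (posFlip A A') h ≫ₑ (g ⊗ₑ f))

/-- The set of objects of the colored PROP over `K` generated by `G` subject to `R`: the words in
the colors. -/
def Presented {K : Type u} [Field K] {C : Type} {G : List C → List C → Type}
    (_R : ∀ A B : List C, Diagram K G A B → Diagram K G A B → Prop) : Type :=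
  List C

section Category

variable {K : Type u} [Field K] {C : Type} {G : List C → List C → Type}
  (R : ∀ A B : List C, Diagram K G A B → Diagram K G A B → Prop)

/-- Expressions up to equality in the presented colored PROP. -/
def diagramSetoid (A B : List C) : Setoid (Diagram K G A B) where
  r f g := Eqv R f g
  iseqv := ⟨Eqv.refl, Eqv.symm, Eqv.trans⟩

instance category : Category (Presented R) where
  Hom A B := Quotient (diagramSetoid R A B)
  id A := Quotient.mk (diagramSetoid R A A) (ident A)
  comp {A B D} := Quotient.map₂ (sa := diagramSetoid R A B) (sb := diagramSetoid R B D)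
    (sc := diagramSetoid R A D) Diagram.comp fun _ _ h _ _ h' => Eqv.comp_congr h h'
  id_comp := by rintro A B ⟨f⟩; exact Quotient.sound (Eqv.id_comp f)
  comp_id := by rintro A B ⟨f⟩; exact Quotient.sound (Eqv.comp_id f)
  assoc := by rintro A B D E ⟨f⟩ ⟨g⟩ ⟨h⟩; exact Quotient.sound (Eqv.comp_assoc f g h)

/-- The morphism of the presented colored PROP given by an expression. -/
def toHom {A B : List C} (f : Diagram K G A B) :
    (show Presented R from A) ⟶ (show Presented R from B) :=
  Quotient.mk (diagramSetoid R A B) f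

instance homAdd (A B : Presented R) : Add (A ⟶ B) where
  add := Quotient.map₂ (sa := diagramSetoid R A B) (sb := diagramSetoid R A B)
    (sc := diagramSetoid R A B) Diagram.add fun _ _ h _ _ h' => Eqv.add_congr h h'

instance homZero (A B : Presented R) : Zero (A ⟶ B) where
  zero := Quotient.mk (diagramSetoid R A B) (zero A B)

instance homNeg (A B : Presented R) : Neg (A ⟶ B) where
  neg := Quotient.map (sa := diagramSetoid R A B) (sb := diagramSetoid R A B)
    (smul (-1)) fun _ _ h => Eqv.smul_congr _ h

instance homAddCommGroup (A B : Presented R) : AddCommGroup (A ⟶ B) where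
  nsmul := nsmulRec
  zsmul := zsmulRec
  add_assoc := by rintro ⟨f⟩ ⟨g⟩ ⟨h⟩; exact Quotient.sound (Eqv.add_assoc f g h)
  add_comm := by rintro ⟨f⟩ ⟨g⟩; exact Quotient.sound (Eqv.add_comm f g)
  zero_add := by
    rintro ⟨f⟩; exact Quotient.sound ((Eqv.add_comm _ _).trans (Eqv.add_zero f))
  add_zero := by rintro ⟨f⟩; exact Quotient.sound (Eqv.add_zero f)
  neg_add_cancel := by
    rintro ⟨f⟩
    refine Quotient.sound (Eqv.trans (Eqv.add_congr (Eqv.refl _) (Eqv.one_smul f).symm) ?_)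
    refine (Eqv.add_smul (-1) 1 f).symm.trans ?_
    rw [neg_add_cancel]
    exact Eqv.zero_smul f

instance homModule (A B : Presented R) : Module K (A ⟶ B) where
  smul c := Quotient.map (sa := diagramSetoid R A B) (sb := diagramSetoid R A B)
    (smul c) fun _ _ h => Eqv.smul_congr _ h
  one_smul := by rintro ⟨f⟩; exact Quotient.sound (Eqv.one_smul f)
  mul_smul := by rintro c d ⟨f⟩; exact Quotient.sound (Eqv.mul_smul c d f)
  smul_zero c := by
    refine Quotient.sound ((Eqv.smul_congr c (Eqv.zero_smul (zero A B)).symm).trans ?_)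
    refine (Eqv.mul_smul c 0 _).symm.trans ?_
    rw [mul_zero]
    exact Eqv.zero_smul _
  smul_add := by rintro c ⟨f⟩ ⟨g⟩; exact Quotient.sound (Eqv.smul_add c f g)
  add_smul := by rintro c d ⟨f⟩; exact Quotient.sound (Eqv.add_smul c d f)
  zero_smul := by rintro ⟨f⟩; exact Quotient.sound (Eqv.zero_smul f)

instance preadditive : Preadditive (Presented R) where
  add_comp := by rintro A B D ⟨f⟩ ⟨f'⟩ ⟨g⟩; exact Quotient.sound (Eqv.add_comp f f' g)
  comp_add := by rintro A B D ⟨f⟩ ⟨g⟩ ⟨g'⟩; exact Quotient.sound (Eqv.comp_add f g g')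

instance linear : Linear K (Presented R) where
  smul_comp := by rintro A B D c ⟨f⟩ ⟨g⟩; exact Quotient.sound (Eqv.smul_comp c f g)
  comp_smul := by rintro A B D ⟨f⟩ c ⟨g⟩; exact Quotient.sound (Eqv.comp_smul c f g)

end Category

end ColoredProp

/-! ## The Drinfeld–Yetter PROP with one module -/

namespace DrinfeldYetter

open ColoredProp ColoredProp.Diagram

/-- The two colors: the Lie bialgebra object `[1]` and the Drinfeld–Yetter module `[V_1]`. -/
inductive Color
  | b
  | v

open Color

/-- The generating morphisms: bracket, cobracket, action and coaction. -/
inductive Gen : List Color → List Color → Type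
  | mu : Gen [b, b] [b]
  | delta : Gen [b] [b, b]
  | act : Gen [b, v] [v]
  | coact : Gen [v] [b, v]

section Relations

variable (K : Type u)

/-- The bracket `[2] ⟶ [1]`. -/
def mu : Diagram K Gen [b, b] [b] := gen Gen.mu

/-- The cobracket `[1] ⟶ [2]`. -/
def delta : Diagram K Gen [b] [b, b] := gen Gen.delta

/-- The action `[1] ⊗ [V_1] ⟶ [V_1]`. -/
def act : Diagram K Gen [b, v] [v] := gen Gen.act

/-- The coaction `[V_1] ⟶ [1] ⊗ [V_1]`. -/
def coact : Diagram K Gen [v] [b, v] := gen Gen.coact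

/-- The identity of `[1]`. -/
def idB : Diagram K Gen [b] [b] := ident [b]

/-- The identity of `[V_1]`. -/
def idV : Diagram K Gen [v] [v] := ident [v]

/-- The tensor product `id ⊗ f` with one strand `[1]` on the left. -/
def underB {A B : List Color} (f : Diagram K Gen A B) : Diagram K Gen (b :: A) (b :: B) :=
  idB K ⊗ₑ f

/-- The object `[n] = [1] ⊗ ⋯ ⊗ [1]`. -/
abbrev bs (n : ℕ) : List Color := List.replicate n b

/-- A permutation of `n` letters as a bijection of the positions of the word `[n]`. -/
def bsPerm {n : ℕ} (σ : Equiv.Perm (Fin n)) : Fin (bs n).length ≃ Fin (bs n).length :=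
  (finCongr List.length_replicate).trans (σ.trans (finCongr List.length_replicate.symm))

theorem bsPerm_respectsColors {n : ℕ} (σ : Equiv.Perm (Fin n)) :
    RespectsColors (bsPerm σ) := fun i => by simp [bs]

/-- The permutation morphism `[n] ⟶ [n]` sending the `i`-th strand to position `σ i`. -/
def permB {n : ℕ} (σ : Equiv.Perm (Fin n)) : Diagram K Gen (bs n) (bs n) :=
  perm (bsPerm σ) (bsPerm_respectsColors σ)

/-- The exchange of two strands. -/
def swapB : Diagram K Gen [b, b] [b, b] := permB K (n := 2) (Equiv.swap 0 1)

/-- The cyclic permutation of three strands. -/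
def cycB : Diagram K Gen [b, b, b] [b, b, b] := permB K (n := 3) (finRotate 3)

variable [Field K]

/-- The defining relations (compositions are in diagrammatic order). -/
inductive Rel : ∀ A B : List Color, Diagram K Gen A B → Diagram K Gen A B → Prop
  /-- antisymmetry of the bracket -/
  | bracket_antisymm : Rel _ _ ((ident [b, b] +ₑ swapB K) ≫ₑ mu K) (zero _ _)
  /-- Jacobi identity -/
  | jacobi : Rel _ _
      ((ident [b, b, b] +ₑ cycB K +ₑ cycB K ≫ₑ cycB K) ≫ₑ (mu K ⊗ₑ idB K) ≫ₑ mu K) (zero _ _)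
  /-- antisymmetry of the cobracket -/
  | cobracket_antisymm : Rel _ _ (delta K ≫ₑ (ident [b, b] +ₑ swapB K)) (zero _ _)
  /-- co-Jacobi identity -/
  | cojacobi : Rel _ _
      (delta K ≫ₑ (delta K ⊗ₑ idB K) ≫ₑ (ident [b, b, b] +ₑ cycB K +ₑ cycB K ≫ₑ cycB K))
      (zero _ _)
  /-- cocycle condition -/
  | cocycle : Rel _ _ (mu K ≫ₑ delta K)
      ((ident [b, b] -ₑ swapB K) ≫ₑ (delta K ⊗ₑ idB K) ≫ₑ underB K (mu K) ≫ₑ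
        (ident [b, b] -ₑ swapB K))
  /-- Lie action -/
  | action : Rel _ _ ((mu K ⊗ₑ idV K) ≫ₑ act K)
      (underB K (act K) ≫ₑ act K -ₑ (swapB K ⊗ₑ idV K) ≫ₑ underB K (act K) ≫ₑ act K)
  /-- Lie coaction -/
  | coaction : Rel _ _ (coact K ≫ₑ (delta K ⊗ₑ idV K))
      (coact K ≫ₑ underB K (coact K) ≫ₑ (swapB K ⊗ₑ idV K) -ₑ coact K ≫ₑ underB K (coact K))
  /-- Drinfeld–Yetter relation -/
  | drinfeldYetter : Rel _ _ (act K ≫ₑ coact K)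
      (underB K (coact K) ≫ₑ ((swapB K ⊗ₑ idV K) ≫ₑ underB K (act K) +ₑ mu K ⊗ₑ idV K)
        -ₑ (delta K ⊗ₑ idV K) ≫ₑ underB K (act K))

/-- The colored PROP of a Lie bialgebra together with a Drinfeld–Yetter module over it. -/
abbrev DY1 : Type := Presented (Rel K)

/-- The object `[V_1]`. -/
def V : DY1 K := [v]

end Relations

section Basis

variable (K : Type u)

/-- The iterated coaction `[V_1] ⟶ [n] ⊗ [V_1]`. -/
def coactN : ∀ n : ℕ, Diagram K Gen [v] (bs n ++ [v])
  | 0 => idV K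
  | n + 1 => coact K ≫ₑ underB K (coactN n)

/-- The iterated action `[n] ⊗ [V_1] ⟶ [V_1]`. -/
def actN : ∀ n : ℕ, Diagram K Gen (bs n ++ [v]) [v]
  | 0 => idV K
  | n + 1 => underB K (actN n) ≫ₑ act K

/-- The standard basis element `r_n^σ` of the universal Drinfeld–Yetter algebra
`End ([V_1])`: first the `n`-fold coaction, then `σ ⊗ id`, then the `n`-fold action. -/
def r [Field K] {n : ℕ} (σ : Equiv.Perm (Fin n)) : V K ⟶ V K :=
  toHom (Rel K) (coactN K n ≫ₑ (permB K σ ⊗ₑ idV K) ≫ₑ actN K n)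

end Basis

/-! ## Drinfeld–Yetter looms -/

/-- The tiles of `n × m` looms. Ingoing strings enter a tile through its left and bottom edges,
outgoing strings leave it through its top and right edges. A parameter `k : Fin m` is the number of
additional parallel horizontal strings, a parameter `l : Fin n` that of additional parallel
vertical strings.
* `cross k l`: `k + 1` horizontal strings crossing `l + 1` vertical strings;
* `bracket l`: a string from the left edge turning to the top edge on the left of `l + 1` vertical
  strings, which it does not cross;
* `bracketX l`: a string from the left edge crossing `l + 1` vertical strings and then turning to
  the top edge on the right of them;
* `cobracket k`: a string from the left edge turning to the top edge above `k + 1` horizontal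
  strings, which it does not cross;
* `cobracketX k`: a string starting on the left edge below `k + 1` horizontal strings, crossing
  them and leaving through the top edge;
* `horizontal k`, `vertical l`: `k + 1` horizontal (`l + 1` vertical) strings;
* `empty`: no string. -/
inductive Tile (n m : ℕ)
  | cross (k : Fin m) (l : Fin n)
  | bracket (l : Fin n)
  | bracketX (l : Fin n)
  | cobracket (k : Fin m)
  | cobracketX (k : Fin m)
  | horizontal (k : Fin m)
  | vertical (l : Fin n)
  | empty
  deriving DecidableEq, Fintype

namespace Tile

variable {n m : ℕ}

/-- Number of strings on the top edge. -/
def top : Tile n m → ℕ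
  | cross _ l => l + 1
  | bracket l => l + 2
  | bracketX l => l + 2
  | cobracket _ => 1
  | cobracketX _ => 1
  | horizontal _ => 0
  | vertical l => l + 1
  | empty => 0

/-- Number of strings on the bottom edge. -/
def bottom : Tile n m → ℕ
  | cross _ l => l + 1
  | bracket l => l + 1
  | bracketX l => l + 1
  | cobracket _ => 0
  | cobracketX _ => 0
  | horizontal _ => 0
  | vertical l => l + 1
  | empty => 0

/-- Number of strings on the left edge. -/
def left : Tile n m → ℕ
  | cross k _ => k + 1
  | bracket _ => 1
  | bracketX _ => 1
  | cobracket k => k + 2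
  | cobracketX k => k + 2
  | horizontal k => k + 1
  | vertical _ => 0
  | empty => 0

/-- Number of strings on the right edge. -/
def right : Tile n m → ℕ
  | cross k _ => k + 1
  | bracket _ => 0
  | bracketX _ => 0
  | cobracket k => k + 1
  | cobracketX k => k + 1
  | horizontal k => k + 1
  | vertical _ => 0
  | empty => 0

end Tile

/-- Tilings of the grid with `n` rows and `m` columns. Rows are numbered from top to bottom and
columns from left to right, starting from `0`. -/
abbrev Tiling (n m : ℕ) := Fin n → Fin m → Tile n m

section Looms

variable {n m : ℕ}

/-- Number of strings on the left border of row `i` (one if the grid has no column). -/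
def leftWeight (L : Tiling n m) (i : Fin n) : ℕ :=
  if h : 0 < m then (L i ⟨0, h⟩).left else 1

/-- Number of strings on the right border of row `i` (one if the grid has no column). -/
def rightWeight (L : Tiling n m) (i : Fin n) : ℕ :=
  if h : 0 < m then (L i ⟨m - 1, Nat.sub_one_lt_of_lt h⟩).right else 1

/-- Number of strings on the top border of column `j` (one if the grid has no row). -/
def topWeight (L : Tiling n m) (j : Fin m) : ℕ :=
  if h : 0 < n then (L ⟨0, h⟩ j).top else 1

/-- Number of strings on the bottom border of column `j` (one if the grid has no row). -/
def bottomWeight (L : Tiling n m) (j : Fin m) : ℕ :=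
  if h : 0 < n then (L ⟨n - 1, Nat.sub_one_lt_of_lt h⟩ j).bottom else 1

/-- The conditions defining Drinfeld–Yetter looms. If `n = 0` or `m = 0`, the only tiling is a
loom; it stands for `m` vertical, respectively `n` horizontal, strings. -/
structure IsLoom (L : Tiling n m) : Prop where
  vertical_match : ∀ (i : Fin n) (j : Fin m) (h : (i : ℕ) + 1 < n),
    (L i j).bottom = (L ⟨i + 1, h⟩ j).top
  horizontal_match : ∀ (i : Fin n) (j : Fin m) (h : (j : ℕ) + 1 < m),
    (L i j).right = (L i ⟨j + 1, h⟩).left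
  ingoing : ∑ i, leftWeight L i + ∑ j, bottomWeight L j = n + m
  outgoing : ∑ i, rightWeight L i + ∑ j, topWeight L j = n + m
  first_row : ∀ (h : 0 < n) (j : Fin m),
    (∀ k, L ⟨0, h⟩ j ≠ Tile.horizontal k) ∧ L ⟨0, h⟩ j ≠ Tile.empty
  first_column : ∀ (h : 0 < m) (i : Fin n),
    (∀ l, L i ⟨0, h⟩ ≠ Tile.vertical l) ∧ L i ⟨0, h⟩ ≠ Tile.empty

variable (n m) in
/-- The set of `n × m` Drinfeld–Yetter looms. -/
@[ext]
structure Loom where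
  tiling : Tiling n m
  isLoom : IsLoom tiling

noncomputable instance : Fintype (Loom n m) :=
  @Fintype.ofFinite _ (Finite.of_injective Loom.tiling fun _ _ => Loom.ext)

/-- The number of tiles of a loom of one of the types `cobracketX` and `bracketX`. -/
def crossCount (L : Loom n m) : ℕ :=
  (Finset.univ.filter fun x : Fin n × Fin m =>
    (∃ k, L.tiling x.1 x.2 = Tile.cobracketX k) ∨ ∃ l, L.tiling x.1 x.2 = Tile.bracketX l).card

/-! ### The permutation of a loom -/

/-- A point where a string meets a grid line. `hor i j p` is the `p`-th string, from the top, on the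
left edge of the tile `(i, j)` (on the right border of row `i` if `j = m`); `ver i j q` is the
`q`-th string, from the left, on the top edge of the tile `(i, j)` (on the bottom border of column
`j` if `i = n`). All counts start from `0`. -/
inductive Point
  | hor (i j p : ℕ)
  | ver (i j q : ℕ)
  deriving DecidableEq

open Point

/-- Where the string entering the tile `t` at `(i, j)` through its left edge at height `p` goes. -/
def fromLeft (t : Tile n m) (i j p : ℕ) : Point :=
  match t with
  | .cross _ _ => hor i (j + 1) p
  | .bracket _ => ver i j 0
  | .bracketX l => ver i j (l + 1)
  | .cobracket _ => if p = 0 then ver i j 0 else hor i (j + 1) (p - 1)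
  | .cobracketX k => if p = k + 1 then ver i j 0 else hor i (j + 1) p
  | .horizontal _ => hor i (j + 1) p
  -- no string enters the remaining tiles from the left
  | .vertical _ => hor i j p
  | .empty => hor i j p

/-- Where the string entering the tile `t` at `(i, j)` through its bottom edge at abscissa `q`
goes. -/
def fromBottom (t : Tile n m) (i j q : ℕ) : Point :=
  match t with
  | .cross _ _ => ver i j q
  | .bracket _ => ver i j (q + 1)
  | .bracketX _ => ver i j q
  | .vertical _ => ver i j q
  -- no string enters the remaining tiles from the bottom
  | .cobracket _ => ver (i + 1) j q
  | .cobracketX _ => ver (i + 1) j q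
  | .horizontal _ => ver (i + 1) j q
  | .empty => ver (i + 1) j q

/-- Follow a string through one tile; strings that have reached the top or the right border
stay there. -/
def step (L : Tiling n m) : Point → Point
  | hor i j p => if h : i < n ∧ j < m then fromLeft (L ⟨i, h.1⟩ ⟨j, h.2⟩) i j p else hor i j p
  | ver 0 j q => ver 0 j q
  | ver (i + 1) j q =>
    if h : i < n ∧ j < m then fromBottom (L ⟨i, h.1⟩ ⟨j, h.2⟩) i j q else ver (i + 1) j q

/-- Follow a string until it leaves the loom. -/
def trace (L : Tiling n m) (x : Point) : Point := (step L)^[n + m] x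

/-- The ingoing strings of the loom `L` with `σ` glued to its left edge, in their order: from top to
bottom along the left side, then from left to right along the bottom. The permutation `σ` carries
position `p` on its outer side to row `σ p` of the loom, the strings in one row moving together. -/
def ingoing (σ : Equiv.Perm (Fin n)) (L : Tiling n m) : List Point :=
  (List.finRange n).flatMap (fun p => (List.range (leftWeight L (σ p))).map (hor (σ p) 0)) ++
    (List.finRange m).flatMap (fun j => (List.range (bottomWeight L j)).map (ver n j))

/-- The outgoing strings of the loom `L` with `τ` glued to its top edge, in their order: from left to
right along the top, then from top to bottom along the right side. The permutation `τ` carries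
column `j` of the loom to position `τ j` on its outer side, the strings in one column moving
together. -/
def outgoing (L : Tiling n m) (τ : Equiv.Perm (Fin m)) : List Point :=
  (List.finRange m).flatMap
      (fun q => (List.range (topWeight L (τ.symm q))).map (ver 0 (τ.symm q))) ++
    (List.finRange n).flatMap (fun i => (List.range (rightWeight L i)).map (hor i m))

/-! The strings of a loom define a permutation: following strings backwards shows that distinct
ingoing strings have distinct ends. -/

/-- Follow a string backwards through one tile. -/
def stepBack (L : Tiling n m) : Point → Point
  | hor i 0 p => hor i 0 p
  | hor i (j + 1) p =>
    if h : i < n ∧ j < m then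
      match L ⟨i, h.1⟩ ⟨j, h.2⟩ with
      | .cobracket _ => hor i j (p + 1)
      | _ => hor i j p
    else hor i (j + 1) p
  | ver i j q =>
    if h : i < n ∧ j < m then
      match L ⟨i, h.1⟩ ⟨j, h.2⟩ with
      | .bracket _ => if q = 0 then hor i j 0 else ver (i + 1) j (q - 1)
      | .bracketX l => if q = l + 1 then hor i j 0 else ver (i + 1) j q
      | .cobracket _ => hor i j 0
      | .cobracketX k => hor i j (k + 1)
      | _ => ver (i + 1) j q
    else ver i j q

/-- The points that lie on a string of the tiling. -/
def OnString (L : Tiling n m) : Point → Prop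
  | hor i j p => ∃ hi : i < n,
      if h : j < m then p < (L ⟨i, hi⟩ ⟨j, h⟩).left else j = m ∧ p < rightWeight L ⟨i, hi⟩
  | ver i j q => ∃ hj : j < m,
      if h : i < n then q < (L ⟨i, h⟩ ⟨j, hj⟩).top else i = n ∧ q < bottomWeight L ⟨j, hj⟩

/-- The points on the top and on the right border. -/
def IsEnd (m : ℕ) : Point → Prop
  | hor _ j _ => m ≤ j
  | ver i _ _ => i = 0

theorem step_of_isEnd (L : Tiling n m) {x : Point} (hx : IsEnd m x) : step L x = x := by
  match x, hx with
  | hor i j p, hx => exact dif_neg fun h => absurd h.2 (not_lt.2 hx)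
  | ver 0 j q, _ => rfl

theorem onString_right {L : Tiling n m} (hL : IsLoom L) {i j p : ℕ} (hi : i < n) (hj : j < m)
    (hp : p < (L ⟨i, hi⟩ ⟨j, hj⟩).right) : OnString L (hor i (j + 1) p) := by
  refine ⟨hi, ?_⟩
  split_ifs with h
  · rwa [← hL.horizontal_match ⟨i, hi⟩ ⟨j, hj⟩ h]
  · obtain rfl : m = j + 1 := by omega
    simpa [rightWeight] using hp

theorem lt_bottom {L : Tiling n m} (hL : IsLoom L) {i j q : ℕ} (hi : i < n) (hj : j < m)
    (hq : OnString L (ver (i + 1) j q)) : q < (L ⟨i, hi⟩ ⟨j, hj⟩).bottom := by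
  obtain ⟨_, hq⟩ := hq
  split_ifs at hq with h
  · rwa [hL.vertical_match ⟨i, hi⟩ ⟨j, hj⟩ h]
  · obtain ⟨rfl, hq⟩ := hq
    simpa [bottomWeight] using hq

/-- A measure of progress along a string. -/
def rank (n : ℕ) : Point → ℕ
  | hor i j _ => j + n - i
  | ver i j _ => j + n + 1 - i

theorem step_spec {L : Tiling n m} (hL : IsLoom L) {x : Point} (hx : OnString L x)
    (he : ¬ IsEnd m x) :
    OnString L (step L x) ∧ stepBack L (step L x) = x ∧ rank n (step L x) = rank n x + 1 ∧
      rank n x < n + m := by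
  match x, hx, he with
  | hor i j p, hx, he =>
    obtain ⟨hi, hp⟩ := hx
    have hj : j < m := not_le.1 he
    have hr := fun p => onString_right hL (p := p) hi hj
    have ht : ∀ q, q < (L ⟨i, hi⟩ ⟨j, hj⟩).top → OnString L (ver i j q) := fun q hq =>
      ⟨hj, by simpa [hi] using hq⟩
    simp only [hj, dif_pos] at hp
    have hs : step L (hor i j p) = fromLeft (L ⟨i, hi⟩ ⟨j, hj⟩) i j p := dif_pos ⟨hi, hj⟩
    rw [hs]
    generalize htile : L ⟨i, hi⟩ ⟨j, hj⟩ = t at hp hr ht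
    cases t <;> simp only [Tile.left, Tile.right, Tile.top] at hp hr ht <;>
      simp only [fromLeft] <;> (try split_ifs) <;>
      (try subst_vars) <;>
      first
      | omega
      | (refine ⟨?_, ?_, ?_, ?_⟩
         · first | exact hr _ (by omega) | exact ht _ (by omega)
         · simp [stepBack, hi, hj, htile]; try omega
         · simp only [rank]; omega
         · simp only [rank]; omega)
  | ver 0 j q, hx, he => exact absurd rfl he
  | ver (i + 1) j q, hx, he =>
    have hi : i < n := by
      obtain ⟨_, h⟩ := hx
      split_ifs at h <;> omega
    have hj : j < m := hx.1
    have hq := lt_bottom hL hi hj hx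
    have ht : ∀ q, q < (L ⟨i, hi⟩ ⟨j, hj⟩).top → OnString L (ver i j q) := fun q hq =>
      ⟨hj, by simpa [hi] using hq⟩
    have hs : step L (ver (i + 1) j q) = fromBottom (L ⟨i, hi⟩ ⟨j, hj⟩) i j q := dif_pos ⟨hi, hj⟩
    rw [hs]
    generalize htile : L ⟨i, hi⟩ ⟨j, hj⟩ = t at hq ht
    cases t <;> simp only [Tile.bottom, Tile.top] at hq ht <;>
      simp only [fromBottom] <;>
      first
      | omega
      | (refine ⟨?_, ?_, ?_, ?_⟩
         · exact ht _ (by omega)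
         · simp [stepBack, hi, hj, htile]; try omega
         · simp only [rank]; omega
         · simp only [rank]; omega)

theorem iterate_step_spec {L : Tiling n m} (hL : IsLoom L) {x : Point} (hx : OnString L x)
    (hb : stepBack L x = x) (t : ℕ) :
    OnString L ((step L)^[t] x) ∧ (stepBack L)^[t] ((step L)^[t] x) = x ∧
      (IsEnd m ((step L)^[t] x) ∨ t ≤ rank n ((step L)^[t] x)) := by
  induction t with
  | zero => exact ⟨hx, rfl, Or.inr (Nat.zero_le _)⟩
  | succ t ih =>
    obtain ⟨h1, h2, h3⟩ := ih
    rw [Function.iterate_succ_apply' (step L)]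
    by_cases he : IsEnd m ((step L)^[t] x)
    · rw [step_of_isEnd L he]
      exact ⟨h1, by rw [Function.iterate_succ_apply', h2, hb], Or.inl he⟩
    · obtain ⟨g1, g2, g3, _⟩ := step_spec hL h1 he
      refine ⟨g1, by rw [Function.iterate_succ_apply, g2, h2], Or.inr ?_⟩
      have := h3.resolve_left he
      omega

theorem mem_ingoing {σ : Equiv.Perm (Fin n)} {L : Tiling n m} {x : Point}
    (hx : x ∈ ingoing σ L) : OnString L x ∧ stepBack L x = x := by
  simp only [ingoing, List.mem_append, List.mem_flatMap, List.mem_finRange, List.mem_map,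
    List.mem_range, true_and] at hx
  obtain ⟨p, s, hs, rfl⟩ | ⟨j, s, hs, rfl⟩ := hx
  · refine ⟨⟨(σ p).2, ?_⟩, rfl⟩
    split_ifs with h
    · simpa [leftWeight, h] using hs
    · obtain rfl : m = 0 := by omega
      simpa [leftWeight, rightWeight] using hs
  · refine ⟨⟨j.2, ?_⟩, by simp [stepBack]⟩
    simpa using hs

theorem trace_mem_outgoing {L : Tiling n m} (hL : IsLoom L) (σ : Equiv.Perm (Fin n))
    (τ : Equiv.Perm (Fin m)) {x : Point} (hx : x ∈ ingoing σ L) :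
    trace L x ∈ outgoing L τ := by
  obtain ⟨h1, h2⟩ := mem_ingoing hx
  obtain ⟨g1, -, g3⟩ := iterate_step_spec hL h1 h2 (n + m)
  have he : IsEnd m (trace L x) := by
    by_contra he
    have := (step_spec hL g1 he).2.2.2
    have := g3.resolve_left he
    omega
  change OnString L (trace L x) at g1
  generalize trace L x = y at g1 he
  simp only [outgoing, List.mem_append, List.mem_flatMap, List.mem_finRange, List.mem_map,
    List.mem_range, true_and]
  match y, g1, he with
  | hor i j p, g1, he =>
    obtain ⟨hi, hp⟩ := g1
    rw [dif_neg (not_lt.2 he)] at hp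
    obtain ⟨rfl, hp⟩ := hp
    exact Or.inr ⟨⟨i, hi⟩, p, hp, rfl⟩
  | ver i j q, g1, he =>
    obtain ⟨hj, hq⟩ := g1
    obtain rfl : i = 0 := he
    refine Or.inl ⟨τ ⟨j, hj⟩, q, ?_, by simp⟩
    rw [Equiv.symm_apply_apply]
    split_ifs at hq with h
    · simpa [topWeight, h] using hq
    · obtain rfl : n = 0 := by omega
      simpa [topWeight, bottomWeight] using hq

theorem trace_injOn {L : Tiling n m} (hL : IsLoom L) {σ : Equiv.Perm (Fin n)} {x y : Point}
    (hx : x ∈ ingoing σ L) (hy : y ∈ ingoing σ L) (h : trace L x = trace L y) : x = y := by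
  obtain ⟨x1, x2⟩ := mem_ingoing hx
  obtain ⟨y1, y2⟩ := mem_ingoing hy
  rw [← (iterate_step_spec hL x1 x2 (n + m)).2.1, ← (iterate_step_spec hL y1 y2 (n + m)).2.1]
  exact congrArg _ h

theorem length_ingoing {L : Tiling n m} (hL : IsLoom L) (σ : Equiv.Perm (Fin n)) :
    (ingoing σ L).length = n + m := by
  rw [← hL.ingoing, ← Equiv.sum_comp σ (leftWeight L)]
  simp [DrinfeldYetter.ingoing, List.length_flatMap, ← List.ofFn_eq_map, List.sum_ofFn]

theorem length_outgoing {L : Tiling n m} (hL : IsLoom L) (τ : Equiv.Perm (Fin m)) :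
    (outgoing L τ).length = n + m := by
  rw [← hL.outgoing, ← Equiv.sum_comp τ.symm (topWeight L), add_comm]
  simp [DrinfeldYetter.outgoing, List.length_flatMap, ← List.ofFn_eq_map, List.sum_ofFn]

theorem nodup_ingoing (σ : Equiv.Perm (Fin n)) (L : Tiling n m) : (ingoing σ L).Nodup := by
  refine List.Nodup.append ?_ ?_ ?_
  · refine List.nodup_flatMap.2 ⟨fun p _ => ?_, ?_⟩
    · exact List.nodup_range.map fun a b h => by simpa using h
    · refine (List.nodup_finRange n).imp fun {a b} hab => ?_
      simp only [Function.onFun, List.disjoint_left, List.mem_map, List.mem_range]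
      rintro _ ⟨s, -, rfl⟩ ⟨s', -, h⟩
      exact hab (σ.injective (Fin.ext (by simpa using (Point.hor.inj h).1.symm)))
  · refine List.nodup_flatMap.2 ⟨fun p _ => ?_, ?_⟩
    · exact List.nodup_range.map fun a b h => by simpa using h
    · refine (List.nodup_finRange m).imp fun {a b} hab => ?_
      simp only [Function.onFun, List.disjoint_left, List.mem_map, List.mem_range]
      rintro _ ⟨s, -, rfl⟩ ⟨s', -, h⟩
      exact hab (Fin.ext (by simpa using (Point.ver.inj h).2.1.symm))
  · simp only [List.disjoint_left, List.mem_flatMap, List.mem_map]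
    rintro _ ⟨_, -, _, -, rfl⟩ ⟨_, -, _, -, h⟩
    cases h

/-- The number of the outgoing string in which the `a`-th ingoing string ends. -/
def endIndex (σ : Equiv.Perm (Fin n)) (L : Loom n m) (τ : Equiv.Perm (Fin m))
    (a : Fin (n + m)) : Fin (n + m) :=
  ⟨(outgoing L.tiling τ).idxOf
      (trace L.tiling ((ingoing σ L.tiling).get (a.cast (length_ingoing L.isLoom σ).symm))), by
    exact (List.idxOf_lt_length_iff.2
      (trace_mem_outgoing L.isLoom σ τ (List.get_mem _ _))).trans_eq (length_outgoing L.isLoom τ)⟩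

theorem endIndex_bijective (σ : Equiv.Perm (Fin n)) (L : Loom n m) (τ : Equiv.Perm (Fin m)) :
    Function.Bijective (endIndex σ L τ) := by
  refine Finite.injective_iff_bijective.1 fun a b h => ?_
  have h1 := (List.idxOf_inj (trace_mem_outgoing L.isLoom σ τ (List.get_mem _ _))).1 (Fin.mk.inj h)
  have h2 := trace_injOn L.isLoom (List.get_mem _ _) (List.get_mem _ _) h1
  have h3 := (nodup_ingoing σ L.tiling).injective_get h2
  simpa using h3

/-- The permutation of a loom `L` with `σ` glued to its left edge and `τ` glued to its top edge:
it sends the number of an ingoing string to the number of the outgoing string in which it ends. -/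
noncomputable def gluedPerm (σ : Equiv.Perm (Fin n)) (L : Loom n m) (τ : Equiv.Perm (Fin m)) :
    Equiv.Perm (Fin (n + m)) :=
  Equiv.ofBijective (endIndex σ L τ) (endIndex_bijective σ L τ)

end Looms

end DrinfeldYetter

/-! The composite of the two basis elements is `n` coactions, `n` actions, `m` coactions and `m`
actions, in this order. It is brought to the form "coactions first, actions last" by moving the
inner actions past the inner coactions. When an action (a row) meets a coaction (a column), the
Drinfeld–Yetter relation gives three terms: the two are exchanged, or a bracket appears, or, with a
minus sign, a cobracket. The bracket slides forward to a later action, where the Lie action relation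
turns it into a difference of two orders of two actions. The cobracket slides back to an earlier
coaction, where the coaction relation does the same for coactions. So every encounter is one of five
local pictures: crossing, bracket and cobracket with sign `+`, crossing bracket and crossing
cobracket with sign `-`. The three other tiles record that the action, the coaction or both have
already been used up.

To make this a computation in a ring, every strand carries a label. Families of morphisms indexed by
lists of labels and compatible with permutations of strands are acted upon, by precomposition, by
operators `opC`, `opA`, `opM`, `opD` that emit, absorb, merge and split labelled strands. The
defining relations then become the commutation rules `ArrowRelations`, in which no permutation is
visible. Evaluating a product of emissions followed by absorptions on the identity of the module
gives back a basis element (`prodC_mul_prodA_apply`, `r_eq`). The rewriting is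
`ArrowRelations.row_expansion` for one action and `ArrowRelations.fill_expansion` for all of them.
It yields a sum over fillings of the grid by tile shapes that fit along their edges.

Two facts turn this into the sum over looms. The number of parallel strings in every tile of a loom
is forced by the shapes (`loomEquiv`), by a count of the strings on the border. And a string keeps
its label all the way through a loom (`IsLoom.label_trace`), so that the permutation of the loom is
the one read off from the labels of the emissions and absorptions in the corresponding term. -/

namespace DrinfeldYetter

/-! ## Strand calculus -/

/-- The object `b ⊗ ⋯ ⊗ b ⊗ V`, with one strand `b` for every label of a list. -/
def strands {𝒞 : Type*} [Category 𝒞] (U : 𝒞 ⥤ 𝒞) (V : 𝒞) {ℓ : Type*} : List ℓ → 𝒞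
  | [] => V
  | _ :: S => U.obj (strands U V S)

theorem comp_comp_assoc {𝒞 : Type*} [Category 𝒞] {Y₁ Y₂ Y₃ Y₄ Y₅ : 𝒞}
    (f₁ : Y₁ ⟶ Y₂) (f₂ : Y₂ ⟶ Y₃) (f₃ : Y₃ ⟶ Y₄) (f₄ : Y₄ ⟶ Y₅) : f₁ ≫ f₂ ≫ f₃ ≫ f₄ = (f₁ ≫ f₂ ≫ f₃) ≫ f₄ := by
  simp only [Category.assoc]

/-- A preadditive category with an endofunctor `U = b ⊗ -`, a symmetry, a bracket and a cobracket
on `b`, and a Drinfeld–Yetter module `V` over `b`. The morphism `pm S S'` permutes the strands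
according to their labels. -/
structure StrandCalculus (𝒞 : Type*) [Category 𝒞] [Preadditive 𝒞] (ℓ : Type*) where
  U : 𝒞 ⥤ 𝒞
  map_add : ∀ {X Y : 𝒞} (f g : X ⟶ Y), U.map (f + g) = U.map f + U.map g
  V : 𝒞
  sw : ∀ X, U.obj (U.obj X) ⟶ U.obj (U.obj X)
  br : ∀ X, U.obj (U.obj X) ⟶ U.obj X
  cobr : ∀ X, U.obj X ⟶ U.obj (U.obj X)
  act : U.obj V ⟶ V
  coact : V ⟶ U.obj V
  sw_nat : ∀ {X Y : 𝒞} (f : X ⟶ Y), U.map (U.map f) ≫ sw Y = sw X ≫ U.map (U.map f)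
  br_nat : ∀ {X Y : 𝒞} (f : X ⟶ Y), U.map (U.map f) ≫ br Y = br X ≫ U.map f
  cobr_nat : ∀ {X Y : 𝒞} (f : X ⟶ Y), U.map f ≫ cobr Y = cobr X ≫ U.map (U.map f)
  sw_sw : ∀ X, sw X ≫ sw X = 𝟙 _
  braid : ∀ X, sw (U.obj X) ≫ U.map (sw X) ≫ sw (U.obj X) =
    U.map (sw X) ≫ sw (U.obj X) ≫ U.map (sw X)
  br_sw : ∀ X, br (U.obj X) ≫ sw X = U.map (sw X) ≫ sw (U.obj X) ≫ U.map (br X)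
  cobr_sw : ∀ X, sw X ≫ cobr (U.obj X) = U.map (cobr X) ≫ sw (U.obj X) ≫ U.map (sw X)
  br_act : br V ≫ act = U.map act ≫ act - sw V ≫ U.map act ≫ act
  coact_cobr : coact ≫ cobr V = coact ≫ U.map coact ≫ sw V - coact ≫ U.map coact
  act_coact : act ≫ coact =
    U.map coact ≫ sw V ≫ U.map act + U.map coact ≫ br V - cobr V ≫ U.map act
  pm : ∀ S S' : List ℓ, strands U V S ⟶ strands U V S'
  -- Only distinct labels determine where each strand goes, so the laws of `pm` are imposed on lists
  -- without repetitions.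
  pm_refl : ∀ {S}, S.Nodup → pm S S = 𝟙 _
  pm_trans : ∀ {S S' S''}, S.Nodup → S.Perm S' → S'.Perm S'' → pm S S' ≫ pm S' S'' = pm S S''
  pm_cons : ∀ {a S S'}, (a :: S).Nodup → S.Perm S' → pm (a :: S) (a :: S') = U.map (pm S S')
  pm_swap : ∀ {a b S}, (a :: b :: S).Nodup → pm (a :: b :: S) (b :: a :: S) = sw (strands U V S)

namespace StrandCalculus

variable {𝒞 : Type*} [Category 𝒞] [Preadditive 𝒞] {ℓ : Type*} (X : StrandCalculus 𝒞 ℓ)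

/-- The object with strands labelled by `S`. -/
abbrev ob (S : List ℓ) : 𝒞 := strands X.U X.V S

theorem map_sub {Y Z : 𝒞} (f g : Y ⟶ Z) : X.U.map (f - g) = X.U.map f - X.U.map g := by
  rw [eq_sub_iff_add_eq, ← X.map_add, sub_add_cancel]

/-- The coaction, the new strand being moved to the front. -/
def emit : ∀ S : List ℓ, X.ob S ⟶ X.U.obj (X.ob S)
  | [] => X.coact
  | _ :: S => X.U.map (emit S) ≫ X.sw _

/-- The action of the strand at the front. -/
def absorb : ∀ S : List ℓ, X.U.obj (X.ob S) ⟶ X.ob S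
  | [] => X.act
  | _ :: S => X.sw _ ≫ X.U.map (absorb S)

/-! ### Transport of the module relations across one more strand. -/

section Steps

variable {Y Z : 𝒞} {e : Y ⟶ X.U.obj Y} {a : X.U.obj Y ⟶ Y} {e' : Z ⟶ X.U.obj Z}
  {a' : X.U.obj Z ⟶ Z}

/-- The pair `(e, a)` on `Y` induces one on `b ⊗ Y` by braiding past the extra strand. The exchange
term is handled by the Yang–Baxter relation, the two others by pulling a strand through the bracket
or the cobracket. -/
theorem absorb_emit_step
    (h : a ≫ e = X.U.map e ≫ X.sw Y ≫ X.U.map a + X.U.map e ≫ X.br Y - X.cobr Y ≫ X.U.map a) :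
    (X.sw Y ≫ X.U.map a) ≫ X.U.map e ≫ X.sw Y =
      X.U.map (X.U.map e ≫ X.sw Y) ≫ X.sw (X.U.obj Y) ≫ X.U.map (X.sw Y ≫ X.U.map a) +
        X.U.map (X.U.map e ≫ X.sw Y) ≫ X.br (X.U.obj Y) -
        X.cobr (X.U.obj Y) ≫ X.U.map (X.sw Y ≫ X.U.map a) := by
  have h1 : X.U.map a ≫ X.U.map e = _ := (X.U.map_comp _ _).symm.trans (congrArg X.U.map h)
  have hs : X.U.map (X.sw Y) ≫ X.U.map (X.sw Y) = 𝟙 _ := by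
    rw [← X.U.map_comp, X.sw_sw, X.U.map_id]
  -- `br_sw`, and below `cobr_sw`, with one swap carried to the other side, swaps being involutive.
  have hb : X.U.map (X.sw Y) ≫ X.br (X.U.obj Y) =
      X.sw (X.U.obj Y) ≫ X.U.map (X.br Y) ≫ X.sw Y := by
    rw [← Category.comp_id (X.br _), ← X.sw_sw Y, reassoc_of% X.br_sw, reassoc_of% hs]
  have hd : X.cobr (X.U.obj Y) ≫ X.U.map (X.sw Y) =
      X.sw Y ≫ X.U.map (X.cobr Y) ≫ X.sw (X.U.obj Y) := by
    rw [← Category.id_comp (X.cobr _), ← X.sw_sw Y]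
    simp only [Category.assoc]
    rw [reassoc_of% X.cobr_sw, hs, Category.comp_id]
  simp only [map_sub, X.map_add, Functor.map_comp] at h1
  simp only [Category.assoc, Functor.map_comp]
  rw [reassoc_of% h1]
  simp only [Preadditive.comp_add, Preadditive.add_comp, Preadditive.comp_sub,
    Preadditive.sub_comp, Category.assoc]
  congr 1
  · congr 1
    · rw [← reassoc_of% X.sw_nat e, X.sw_nat, reassoc_of% X.braid]
    · rw [hb, ← reassoc_of% X.sw_nat e]
  · rw [X.sw_nat, reassoc_of% hd]

theorem br_absorb_step (h : X.br Y ≫ a = X.U.map a ≫ a - X.sw Y ≫ X.U.map a ≫ a) :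
    X.br (X.U.obj Y) ≫ X.sw Y ≫ X.U.map a =
      X.U.map (X.sw Y ≫ X.U.map a) ≫ X.sw Y ≫ X.U.map a -
        X.sw (X.U.obj Y) ≫ X.U.map (X.sw Y ≫ X.U.map a) ≫ X.sw Y ≫ X.U.map a := by
  have h1 : X.U.map (X.br Y) ≫ X.U.map a = _ :=
    (X.U.map_comp _ _).symm.trans (congrArg X.U.map h)
  simp only [map_sub, Functor.map_comp] at h1
  simp only [Category.assoc, Functor.map_comp]
  rw [reassoc_of% X.br_sw, h1, reassoc_of% X.sw_nat a, reassoc_of% X.braid]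
  simp only [Preadditive.comp_sub]

theorem emit_cobr_step (h : e ≫ X.cobr Y = e ≫ X.U.map e ≫ X.sw Y - e ≫ X.U.map e) :
    (X.U.map e ≫ X.sw Y) ≫ X.cobr (X.U.obj Y) =
      (X.U.map e ≫ X.sw Y) ≫ X.U.map (X.U.map e ≫ X.sw Y) ≫ X.sw (X.U.obj Y) -
        (X.U.map e ≫ X.sw Y) ≫ X.U.map (X.U.map e ≫ X.sw Y) := by
  have h1 : X.U.map e ≫ X.U.map (X.cobr Y) = _ :=
    (X.U.map_comp _ _).symm.trans (congrArg X.U.map h)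
  simp only [map_sub, Functor.map_comp] at h1
  simp only [Category.assoc, Functor.map_comp]
  rw [X.cobr_sw, reassoc_of% h1, ← reassoc_of% X.sw_nat e, ← reassoc_of% X.sw_nat e, X.braid]
  simp only [Preadditive.sub_comp, Category.assoc]

theorem emit_nat_step {f : Y ⟶ Z} (h : f ≫ e' = e ≫ X.U.map f) :
    X.U.map f ≫ X.U.map e' ≫ X.sw Z = (X.U.map e ≫ X.sw Y) ≫ X.U.map (X.U.map f) := by
  rw [← X.U.map_comp_assoc, h, X.U.map_comp_assoc, X.sw_nat, Category.assoc]

theorem absorb_nat_step {f : Y ⟶ Z} (h : X.U.map f ≫ a' = a ≫ f) :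
    X.U.map (X.U.map f) ≫ X.sw Z ≫ X.U.map a' = (X.sw Y ≫ X.U.map a) ≫ X.U.map f := by
  rw [reassoc_of% X.sw_nat, ← X.U.map_comp, h, X.U.map_comp, Category.assoc]

theorem emit_nat_swap :
    X.sw Y ≫ X.U.map (X.U.map e ≫ X.sw Y) ≫ X.sw (X.U.obj Y) =
      (X.U.map (X.U.map e ≫ X.sw Y) ≫ X.sw (X.U.obj Y)) ≫ X.U.map (X.sw Y) := by
  simp only [Category.assoc, Functor.map_comp]
  rw [← reassoc_of% X.sw_nat e, X.braid]

theorem absorb_nat_swap :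
    X.U.map (X.sw Y) ≫ X.sw (X.U.obj Y) ≫ X.U.map (X.sw Y ≫ X.U.map a) =
      (X.sw (X.U.obj Y) ≫ X.U.map (X.sw Y ≫ X.U.map a)) ≫ X.sw Y := by
  simp only [Category.assoc, Functor.map_comp]
  rw [X.sw_nat, reassoc_of% X.braid]

theorem emit_second {W : 𝒞} (g : X.U.obj (X.U.obj Y) ⟶ W) :
    (X.U.map e ≫ X.sw Y) ≫ X.sw Y ≫ g = X.U.map e ≫ g := by
  rw [Category.assoc, reassoc_of% X.sw_sw]

theorem absorb_second {W : 𝒞} (g : X.U.obj Y ⟶ W) :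
    X.sw Y ≫ (X.sw Y ≫ X.U.map a) ≫ g = X.U.map a ≫ g := by
  rw [Category.assoc, reassoc_of% X.sw_sw]

theorem emit_third {W : 𝒞} (g : X.U.obj (X.U.obj (X.U.obj Y)) ⟶ W) :
    X.U.map (X.U.map e ≫ X.sw Y) ≫ X.U.map (X.sw Y) ≫ g = X.U.map (X.U.map e) ≫ g := by
  rw [← X.U.map_comp_assoc, Category.assoc, X.sw_sw, Category.comp_id]

theorem absorb_third {W : 𝒞} (g : X.U.obj (X.U.obj Y) ⟶ W) :
    X.U.map (X.sw Y) ≫ X.U.map (X.sw Y ≫ X.U.map a) ≫ g = X.U.map (X.U.map a) ≫ g := by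
  rw [← X.U.map_comp_assoc, reassoc_of% X.sw_sw]

theorem absorb_emit_comp {W : 𝒞}
    (h : a ≫ e = X.U.map e ≫ X.sw Y ≫ X.U.map a + X.U.map e ≫ X.br Y - X.cobr Y ≫ X.U.map a)
    (g : X.U.obj Y ⟶ W) :
    a ≫ e ≫ g = X.U.map e ≫ (X.sw Y ≫ X.U.map a) ≫ g + X.U.map e ≫ X.br Y ≫ g -
      X.cobr Y ≫ X.U.map a ≫ g := by
  rw [reassoc_of% h]
  simp only [Preadditive.add_comp, Preadditive.sub_comp, Category.assoc]

theorem br_absorb_comp {W : 𝒞} (h : X.br Y ≫ a = X.U.map a ≫ a - X.sw Y ≫ X.U.map a ≫ a)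
    (g : Y ⟶ W) :
    X.br Y ≫ a ≫ g = X.U.map a ≫ a ≫ g - (X.sw Y ≫ X.U.map a) ≫ a ≫ g := by
  rw [reassoc_of% h]
  simp only [Preadditive.sub_comp, Category.assoc]

theorem emit_cobr_comp {W : 𝒞} (h : e ≫ X.cobr Y = e ≫ X.U.map e ≫ X.sw Y - e ≫ X.U.map e)
    (g : X.U.obj (X.U.obj Y) ⟶ W) :
    e ≫ X.cobr Y ≫ g = e ≫ (X.U.map e ≫ X.sw Y) ≫ g - e ≫ X.U.map e ≫ g := by
  rw [reassoc_of% h]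
  simp only [Preadditive.sub_comp, Category.assoc]

theorem coactL_append_step {k : X.V ⟶ Y} {q : X.U.obj Y ⟶ Z} {k' : X.V ⟶ Z}
    {q' : X.U.obj (X.U.obj Y) ⟶ X.U.obj Z} (h : k' = k ≫ e ≫ q) (hq : X.sw Y ≫ q' = X.U.map q) :
    X.coact ≫ X.U.map k' = (X.coact ≫ X.U.map k) ≫ (X.U.map e ≫ X.sw Y) ≫ q' := by
  simp only [h, Functor.map_comp, Category.assoc, hq]

theorem actL_append_step {k : Y ⟶ X.V} {q : Z ⟶ X.U.obj Y} {k' : Z ⟶ X.V}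
    {q' : X.U.obj Z ⟶ X.U.obj (X.U.obj Y)} (h : k' = q ≫ a ≫ k) (hq : q' ≫ X.sw Y = X.U.map q) :
    X.U.map k' ≫ X.act = q' ≫ (X.sw Y ≫ X.U.map a) ≫ X.U.map k ≫ X.act := by
  simp only [h, Functor.map_comp, Category.assoc, ← hq]

end Steps

/-- Induction on the strands standing between the front and the module: the base case is the
relation for the module itself, the step slides everything across one strand. The next two
identities are obtained in the same way. -/
theorem absorb_emit (S : List ℓ) : X.absorb S ≫ X.emit S =
    X.U.map (X.emit S) ≫ X.sw _ ≫ X.U.map (X.absorb S) + X.U.map (X.emit S) ≫ X.br _ -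
      X.cobr _ ≫ X.U.map (X.absorb S) := by
  induction S with
  | nil => exact X.act_coact
  | cons a S ih => exact X.absorb_emit_step ih

theorem br_absorb (S : List ℓ) : X.br _ ≫ X.absorb S =
    X.U.map (X.absorb S) ≫ X.absorb S - X.sw _ ≫ X.U.map (X.absorb S) ≫ X.absorb S := by
  induction S with
  | nil => exact X.br_act
  | cons a S ih => exact X.br_absorb_step ih

theorem emit_cobr (S : List ℓ) : X.emit S ≫ X.cobr _ =
    X.emit S ≫ X.U.map (X.emit S) ≫ X.sw _ - X.emit S ≫ X.U.map (X.emit S) := by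
  induction S with
  | nil => exact X.coact_cobr
  | cons a S ih => exact X.emit_cobr_step ih

/-- The constructors of `List.Perm` generate all permutations from transpositions of the first two
strands, possibly below further strands. For such a transposition the claim is the Yang–Baxter
relation together with naturality of the swap. -/
theorem pm_emit {S S' : List ℓ} (hS : S.Nodup) (h : S.Perm S') :
    X.pm S S' ≫ X.emit S' = X.emit S ≫ X.U.map (X.pm S S') := by
  induction h with
  | nil =>
    rw [X.pm_refl hS, X.U.map_id, Category.id_comp, Category.comp_id]
  | cons x h ih =>
    rw [X.pm_cons hS h]
    exact X.emit_nat_step (ih hS.of_cons)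
  | swap x y l =>
    rw [X.pm_swap hS]
    exact X.emit_nat_swap
  | trans h h' ih ih' =>
    rw [← X.pm_trans hS h h', Category.assoc, ih' ((h.nodup_iff).1 hS), reassoc_of% ih hS,
      X.U.map_comp]

theorem pm_absorb {S S' : List ℓ} (hS : S.Nodup) (h : S.Perm S') :
    X.U.map (X.pm S S') ≫ X.absorb S' = X.absorb S ≫ X.pm S S' := by
  induction h with
  | nil =>
    rw [X.pm_refl hS, X.U.map_id, Category.id_comp, Category.comp_id]
  | cons x h ih =>
    rw [X.pm_cons hS h]
    exact X.absorb_nat_step (ih hS.of_cons)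
  | swap x y l =>
    rw [X.pm_swap hS]
    exact X.absorb_nat_swap
  | trans h h' ih ih' =>
    rw [← X.pm_trans hS h h', X.U.map_comp, Category.assoc, ih' ((h.nodup_iff).1 hS),
      reassoc_of% ih hS]

/-! ### Equivariant families -/

/-- Families of morphisms from all the objects of labelled strands to the module, compatible with
the permutations of strands and vanishing if a label is repeated. -/
def families : AddSubgroup (∀ S : List ℓ, X.ob S ⟶ X.V) where
  -- Vanishing on repeated labels fixes the values about which equivariance says nothing, so that a
  -- family is determined by its values on lists without repetitions.
  carrier := {φ | (∀ S, ¬ S.Nodup → φ S = 0) ∧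
    ∀ S S', S.Nodup → S.Perm S' → φ S = X.pm S S' ≫ φ S'}
  add_mem' := by
    rintro φ ψ ⟨h1, h2⟩ ⟨h3, h4⟩
    refine ⟨fun S hS => ?_, fun S S' hS h => ?_⟩
    · rw [Pi.add_apply, h1 S hS, h3 S hS, add_zero]
    · rw [Pi.add_apply, Pi.add_apply, h2 S S' hS h, h4 S S' hS h, Preadditive.comp_add]
  zero_mem' := ⟨fun _ _ => rfl, fun S S' _ _ => by simp⟩
  neg_mem' := by
    rintro φ ⟨h1, h2⟩
    refine ⟨fun S hS => ?_, fun S S' hS h => ?_⟩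
    · rw [Pi.neg_apply, h1 S hS, neg_zero]
    · rw [Pi.neg_apply, Pi.neg_apply, h2 S S' hS h, Preadditive.comp_neg]

variable {X}

theorem families_perm (φ : X.families) {S S' : List ℓ} (hS : S.Nodup) (h : S.Perm S') :
    φ.1 S = X.pm S S' ≫ φ.1 S' :=
  φ.2.2 S S' hS h

theorem families_ext {φ ψ : X.families} (h : ∀ S : List ℓ, S.Nodup → φ.1 S = ψ.1 S) : φ = ψ := by
  refine Subtype.ext (funext fun S => ?_)
  by_cases hS : S.Nodup
  · exact h S hS
  · rw [φ.2.1 S hS, ψ.2.1 S hS]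

theorem families_eq_of_perm {φ ψ : X.families} {S S' : List ℓ} (hS : S.Nodup) (h : S.Perm S')
    (h' : φ.1 S' = ψ.1 S') : φ.1 S = ψ.1 S := by
  rw [families_perm φ hS h, families_perm ψ hS h, h']

variable (X)

open Classical in
/-- The operator on families given by a local morphism that replaces strands `I` by strands `O`. -/
noncomputable def localOp (I O : List ℓ) (t : ∀ S, X.ob (I ++ S) ⟶ X.ob (O ++ S))
    (ht : ∀ S S', (I ++ S).Nodup → (O ++ S).Nodup → S.Perm S' →
      X.pm (I ++ S) (I ++ S') ≫ t S' = t S ≫ X.pm (O ++ S) (O ++ S')) :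
    AddMonoid.End X.families where
  toFun φ := ⟨fun S =>
      -- The remaining strands `S₀` are determined only up to order; `ht` and the equivariance of
      -- `φ` make the value independent of the order chosen.
      if h : ∃ S₀, S.Nodup ∧ (O ++ S₀).Nodup ∧ S.Perm (I ++ S₀) then
        X.pm S (I ++ h.choose) ≫ t h.choose ≫ φ.1 (O ++ h.choose) else 0, by
    refine ⟨fun S hS => dif_neg fun ⟨_, h, _⟩ => hS h, fun S S' hS h => ?_⟩
    by_cases h1 : ∃ S₀, S.Nodup ∧ (O ++ S₀).Nodup ∧ S.Perm (I ++ S₀)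
    · dsimp only
      have h2 : ∃ S₀, S'.Nodup ∧ (O ++ S₀).Nodup ∧ S'.Perm (I ++ S₀) := by
        obtain ⟨S₀, g1, g2, g3⟩ := h1
        exact ⟨S₀, h.nodup_iff.1 g1, g2, h.symm.trans g3⟩
      rw [dif_pos h1, dif_pos h2]
      obtain ⟨a1, a2, a3⟩ := h1.choose_spec
      obtain ⟨b1, b2, b3⟩ := h2.choose_spec
      generalize h1.choose = S₁ at *
      generalize h2.choose = S₂ at *
      have h12 : (I ++ S₂).Perm (I ++ S₁) := b3.symm.trans (h.symm.trans a3)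
      have h12' : S₂.Perm S₁ := (List.perm_append_left_iff I).1 h12
      rw [← X.pm_trans hS (h.trans b3) h12, Category.assoc,
        reassoc_of% ht S₂ S₁ (b3.nodup_iff.1 b1) b2 h12',
        ← families_perm φ b2 (h12'.append_left O), ← X.pm_trans hS h b3, Category.assoc]
    · dsimp only
      have h2 : ¬ ∃ S₀, S'.Nodup ∧ (O ++ S₀).Nodup ∧ S'.Perm (I ++ S₀) := by
        rintro ⟨S₀, g1, g2, g3⟩
        exact h1 ⟨S₀, hS, g2, h.trans g3⟩
      rw [dif_neg h1, dif_neg h2, Limits.comp_zero]⟩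
  map_zero' := by
    refine Subtype.ext (funext fun S => ?_)
    dsimp only
    split_ifs
    · change _ ≫ _ ≫ 0 = _
      simp only [Limits.comp_zero]; rfl
    · rfl
  map_add' φ ψ := by
    refine Subtype.ext (funext fun S => ?_)
    by_cases h : ∃ S₀, S.Nodup ∧ (O ++ S₀).Nodup ∧ S.Perm (I ++ S₀)
    · have h1 : ∀ φ : X.families, (if h : ∃ S₀, S.Nodup ∧ (O ++ S₀).Nodup ∧ S.Perm (I ++ S₀) then
          X.pm S (I ++ h.choose) ≫ t h.choose ≫ φ.1 (O ++ h.choose) else 0) = _ :=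
        fun φ => dif_pos h
      refine (h1 (φ + ψ)).trans (Eq.trans ?_ (congrArg₂ (· + ·) (h1 φ) (h1 ψ)).symm)
      exact (congrArg (_ ≫ ·) (Preadditive.comp_add _ _ _ _ _ _)).trans
        (Preadditive.comp_add _ _ _ _ _ _)
    · have h1 : ∀ φ : X.families, (if h : ∃ S₀, S.Nodup ∧ (O ++ S₀).Nodup ∧ S.Perm (I ++ S₀) then
          X.pm S (I ++ h.choose) ≫ t h.choose ≫ φ.1 (O ++ h.choose) else 0) = 0 :=
        fun φ => dif_neg h
      exact (h1 (φ + ψ)).trans ((add_zero _).symm.trans (congrArg₂ (· + ·) (h1 φ) (h1 ψ)).symm)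

variable {X} {I O : List ℓ} {t : ∀ S, X.ob (I ++ S) ⟶ X.ob (O ++ S)}
  {ht : ∀ S S', (I ++ S).Nodup → (O ++ S).Nodup → S.Perm S' →
      X.pm (I ++ S) (I ++ S') ≫ t S' = t S ≫ X.pm (O ++ S) (O ++ S')}

theorem localOp_apply (φ : X.families) {S : List ℓ} (hI : (I ++ S).Nodup) (hO : (O ++ S).Nodup) :
    (X.localOp I O t ht φ).1 (I ++ S) = t S ≫ φ.1 (O ++ S) := by
  have h : ∃ S₀, (I ++ S).Nodup ∧ (O ++ S₀).Nodup ∧ (I ++ S).Perm (I ++ S₀) :=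
    ⟨S, hI, hO, List.Perm.refl _⟩
  refine (dif_pos h).trans ?_
  obtain ⟨-, -, a3⟩ := h.choose_spec
  have a4 := (List.perm_append_left_iff I).1 a3
  rw [reassoc_of% ht _ _ hI hO a4, ← families_perm φ hO (a4.append_left O)]

theorem localOp_eq_zero (φ : X.families) {S : List ℓ}
    (h : ∀ S₀, (O ++ S₀).Nodup → S.Perm (I ++ S₀) → φ.1 (O ++ S₀) = 0) :
    (X.localOp I O t ht φ).1 S = 0 := by
  by_cases h' : ∃ S₀, S.Nodup ∧ (O ++ S₀).Nodup ∧ S.Perm (I ++ S₀)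
  · refine (dif_pos h').trans ?_
    rw [h _ h'.choose_spec.2.1 h'.choose_spec.2.2, Limits.comp_zero, Limits.comp_zero]
  · exact dif_neg h'

/-! ### The operators -/

variable (X)

/-- Emit a strand by the coaction. -/
noncomputable def opC (a : ℓ) : AddMonoid.End X.families :=
  X.localOp [] [a] (fun S => X.emit S) fun _ _ hI hO h =>
    (X.pm_emit hI h).trans (congrArg (_ ≫ ·) (X.pm_cons hO h).symm)

/-- Absorb a strand by the action. -/
noncomputable def opA (a : ℓ) : AddMonoid.End X.families :=
  X.localOp [a] [] (fun S => X.absorb S) fun _ _ hI hO h =>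
    (congrArg (· ≫ _) (X.pm_cons hI h)).trans (X.pm_absorb hO h)

theorem pm_cons_cons {a b : ℓ} {S S' : List ℓ} (hS : (a :: b :: S).Nodup) (h : S.Perm S') :
    X.pm (a :: b :: S) (a :: b :: S') = X.U.map (X.U.map (X.pm S S')) :=
  (X.pm_cons hS (h.cons b)).trans (congrArg _ (X.pm_cons hS.of_cons h))

/-- Merge the strand `a` into the strand `b` by the bracket. -/
noncomputable def opM (a b : ℓ) : AddMonoid.End X.families :=
  X.localOp [a, b] [b] (fun S => X.br (X.ob S)) fun _ _ hI hO h =>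
    (congrArg (· ≫ _) (X.pm_cons_cons hI h)).trans
      ((X.br_nat _).trans (congrArg (_ ≫ ·) (X.pm_cons hO h).symm))

/-- Split a strand `b` off the strand `a` by the cobracket. -/
noncomputable def opD (a b : ℓ) : AddMonoid.End X.families :=
  X.localOp [a] [b, a] (fun S => X.cobr (X.ob S)) fun _ _ hI hO h =>
    (congrArg (· ≫ _) (X.pm_cons hI h)).trans
      ((X.cobr_nat _).trans (congrArg (_ ≫ ·) (X.pm_cons_cons hO h).symm))

variable {X} (φ : X.families) {a b c : ℓ} {S : List ℓ}

theorem opC_apply (h : (a :: S).Nodup) : (X.opC a φ).1 S = X.emit S ≫ φ.1 (a :: S) :=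
  localOp_apply φ (I := []) h.of_cons h

theorem opA_apply (h : (a :: S).Nodup) : (X.opA a φ).1 (a :: S) = X.absorb S ≫ φ.1 S :=
  localOp_apply φ (O := []) h h.of_cons

theorem opM_apply (h : (a :: b :: S).Nodup) :
    (X.opM a b φ).1 (a :: b :: S) = X.br (X.ob S) ≫ φ.1 (b :: S) :=
  localOp_apply φ (I := [a, b]) (O := [b]) h h.of_cons

theorem opD_apply (h : (b :: a :: S).Nodup) :
    (X.opD a b φ).1 (a :: S) = X.cobr (X.ob S) ≫ φ.1 (b :: a :: S) :=
  localOp_apply φ (I := [a]) (O := [b, a]) h.of_cons h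

/-- This criterion and its analogues dispose of the lists to which an operator does not apply; on
them every term of the relations below vanishes. -/
theorem opC_eq_zero (h : a ∉ S → φ.1 (a :: S) = 0) : (X.opC a φ).1 S = 0 :=
  localOp_eq_zero φ fun S₀ h1 h2 => by
    rw [families_perm φ h1 (h2.symm.cons a), h fun h' => (List.nodup_cons.1 h1).1 (h2.mem_iff.1 h'),
      Limits.comp_zero]

theorem opA_eq_zero (h : ∀ S₀, S.Perm (a :: S₀) → φ.1 S₀ = 0) : (X.opA a φ).1 S = 0 :=
  localOp_eq_zero φ fun S₀ _ h2 => h S₀ h2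

theorem opM_eq_zero (h : ∀ S₀, S.Perm (a :: b :: S₀) → φ.1 (b :: S₀) = 0) :
    (X.opM a b φ).1 S = 0 :=
  localOp_eq_zero φ fun S₀ _ h2 => h S₀ h2

theorem opD_eq_zero (h : ∀ S₀, S.Perm (a :: S₀) → b ∉ S → φ.1 (b :: a :: S₀) = 0) :
    (X.opD a b φ).1 S = 0 :=
  localOp_eq_zero φ fun S₀ h1 h2 => h S₀ h2 fun h => (List.nodup_cons.1 h1).1 (h2.mem_iff.1 h)

theorem opC_of_mem (h : a ∈ S) : (X.opC a φ).1 S = 0 := opC_eq_zero φ fun h' => absurd h h'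

theorem opA_of_notMem (h : a ∉ S) : (X.opA a φ).1 S = 0 :=
  opA_eq_zero φ fun _ h2 => absurd (h2.mem_iff.2 (by simp)) h

theorem opM_of_notMem (h : ¬ (a ∈ S ∧ b ∈ S)) : (X.opM a b φ).1 S = 0 :=
  opM_eq_zero φ fun _ h2 => absurd ⟨h2.mem_iff.2 (by simp), h2.mem_iff.2 (by simp)⟩ h

theorem opD_of_notMem (h : ¬ (a ∈ S ∧ b ∉ S)) : (X.opD a b φ).1 S = 0 :=
  opD_eq_zero φ fun _ h2 h' => absurd ⟨h2.mem_iff.2 (by simp), h'⟩ h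

/-- The relations involve emissions below strands that stay in front. Equivariance moves the emitted
label to second place at the cost of a swap, which cancels the last swap of `emit`. -/
theorem opC_apply_second (h : (a :: b :: S).Nodup) :
    (X.opC a φ).1 (b :: S) = X.U.map (X.emit S) ≫ φ.1 (b :: a :: S) := by
  rw [opC_apply φ h, families_perm φ h (List.Perm.swap b a S), X.pm_swap h]
  exact X.emit_second _

theorem opA_apply_second (h : (a :: b :: S).Nodup) :
    (X.opA b φ).1 (a :: b :: S) = X.U.map (X.absorb S) ≫ φ.1 (a :: S) := by
  have h' : (b :: a :: S).Nodup := (List.Perm.swap b a S).nodup_iff.1 h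
  rw [families_perm _ h (List.Perm.swap b a S), opA_apply φ h', X.pm_swap h]
  exact X.absorb_second _

theorem opC_apply_third (h : (a :: b :: c :: S).Nodup) :
    (X.opC a φ).1 (b :: c :: S) = X.U.map (X.U.map (X.emit S)) ≫ φ.1 (b :: c :: a :: S) := by
  have h1 : (a :: c :: S).Nodup := by simp_all
  have h2 : (b :: a :: c :: S).Nodup := (List.Perm.swap b a _).nodup_iff.1 h
  rw [opC_apply_second φ h, families_perm φ h2 ((List.Perm.swap c a S).cons b),
    X.pm_cons h2 (List.Perm.swap c a S), X.pm_swap h1]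
  exact X.emit_third _

theorem opA_apply_third (h : (a :: b :: c :: S).Nodup) :
    (X.opA c φ).1 (a :: b :: c :: S) = X.U.map (X.U.map (X.absorb S)) ≫ φ.1 (a :: b :: S) := by
  have h1 : (b :: c :: S).Nodup := h.of_cons
  have h2 : (a :: c :: b :: S).Nodup := ((List.Perm.swap c b S).cons a).nodup_iff.1 h
  rw [families_perm _ h ((List.Perm.swap c b S).cons a), opA_apply_second φ h2,
    X.pm_cons h (List.Perm.swap c b S), X.pm_swap h1]
  exact X.absorb_third _

/-- A list without repetitions, with a given member moved to the front. -/
theorem exists_perm_cons (h : a ∈ S) : ∃ S₀, S.Perm (a :: S₀) := by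
  obtain ⟨s, t, rfl⟩ := List.append_of_mem h
  exact ⟨s ++ t, List.perm_middle⟩

theorem exists_perm_cons_cons (hab : a ≠ b) (h : a ∈ S) (h' : b ∈ S) :
    ∃ S₀, S.Perm (a :: b :: S₀) := by
  obtain ⟨S₁, h1⟩ := exists_perm_cons h
  obtain ⟨S₀, h0⟩ := exists_perm_cons (a := b) (S := S₁) (by
    have := h1.mem_iff.1 h'
    simpa [hab.symm] using this)
  exact ⟨S₀, h1.trans (h0.cons a)⟩

theorem exists_perm_cons_cons_cons (hab : a ≠ b) (hac : a ≠ c) (hbc : b ≠ c) (h : a ∈ S)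
    (h' : b ∈ S) (h'' : c ∈ S) : ∃ S₀, S.Perm (a :: b :: c :: S₀) := by
  obtain ⟨S₁, h1⟩ := exists_perm_cons_cons hab h h'
  obtain ⟨S₀, h0⟩ := exists_perm_cons (a := c) (S := S₁) (by
    have := h1.mem_iff.1 h''
    simpa [hac.symm, hbc.symm] using this)
  exact ⟨S₀, h1.trans ((h0.cons b).cons a)⟩

theorem end_mul_apply (f g : AddMonoid.End X.families) : (f * g) φ = f (g φ) := rfl

theorem end_add_apply (f g : AddMonoid.End X.families) : ((f + g) φ).1 S = (f φ).1 S + (g φ).1 S :=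
  rfl

theorem end_sub_apply (f g : AddMonoid.End X.families) : ((f - g) φ).1 S = (f φ).1 S - (g φ).1 S :=
  rfl

theorem end_ext {f g : AddMonoid.End X.families}
    (h : ∀ (φ : X.families) (S : List ℓ), S.Nodup → (f φ).1 S = (g φ).1 S) : f = g :=
  AddMonoidHom.ext fun φ => families_ext (h φ)

/-- Operators act by precomposition, so the left factor of a product is the earlier morphism, and on
`a :: S₀` the claim is `absorb_emit S₀` with names for the strands. In the bracket term the merged
strand is called `b`; in the cobracket term the strand split off is `b`, and `a` is the one that is
absorbed. -/
theorem opA_mul_opC (hab : a ≠ b) : X.opA a * X.opC b =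
    X.opC b * X.opA a + X.opC b * X.opM a b - X.opD a b * X.opA a := by
  refine end_ext fun φ S hS => ?_
  by_cases h : a ∈ S ∧ b ∉ S
  · obtain ⟨S₀, h0⟩ := exists_perm_cons h.1
    refine families_eq_of_perm hS h0 ?_
    have h1 := h0.nodup_iff.1 hS
    have hb' : b ∉ S₀ := fun h' => h.2 (h0.mem_iff.2 (by simp [h']))
    have h2 : (b :: a :: S₀).Nodup := by simp_all [hab.symm]
    have h3 : (b :: S₀).Nodup := by simp_all
    have h4 : (a :: b :: S₀).Nodup := (List.Perm.swap a b _).nodup_iff.1 h2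
    simp only [end_sub_apply, end_add_apply, end_mul_apply]
    rw [opA_apply _ h1, opC_apply _ h3, opC_apply_second _ h2, opC_apply_second _ h2,
      opM_apply _ h4, opD_apply _ h2, opA_apply _ h4, opA_apply_second _ h2]
    exact X.absorb_emit_comp (X.absorb_emit S₀) _
  · simp only [end_sub_apply, end_add_apply, end_mul_apply]
    rw [opD_of_notMem _ h, opA_eq_zero _ fun S₀ h0 => ?_, opC_eq_zero _ fun hb => ?_,
      opC_eq_zero _ fun hb => ?_, add_zero, sub_zero]
    · exact opM_of_notMem _ fun h' => h ⟨(List.mem_cons.1 h'.1).resolve_left hab, hb⟩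
    · exact opA_of_notMem _ fun h' => h ⟨(List.mem_cons.1 h').resolve_left hab, hb⟩
    · refine opC_of_mem _ ?_
      have h1 : b ∈ S := by
        by_contra hb
        exact h ⟨h0.mem_iff.2 (by simp), hb⟩
      exact (List.mem_cons.1 (h0.mem_iff.1 h1)).resolve_left hab.symm

theorem opM_mul_opA (hab : a ≠ b) :
    X.opM a b * X.opA b = X.opA b * X.opA a - X.opA a * X.opA b := by
  refine end_ext fun φ S hS => ?_
  by_cases h : a ∈ S ∧ b ∈ S
  · obtain ⟨S₀, h0⟩ := exists_perm_cons_cons hab h.1 h.2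
    refine families_eq_of_perm hS h0 ?_
    have h1 := h0.nodup_iff.1 hS
    have h2 : (a :: S₀).Nodup := by simp_all
    have h3 := h1.of_cons
    simp only [end_sub_apply, end_mul_apply]
    rw [opM_apply _ h1, opA_apply _ h3, opA_apply _ h1, opA_apply _ h3, opA_apply_second _ h1,
      opA_apply _ h2]
    exact X.br_absorb_comp (X.br_absorb S₀) _
  · simp only [end_sub_apply, end_mul_apply]
    rw [opM_of_notMem _ h, opA_eq_zero _ fun S₀ h0 => opA_of_notMem _ fun h' => h
      ⟨h0.mem_iff.2 (by simp [h']), h0.mem_iff.2 (by simp)⟩,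
      opA_eq_zero _ fun S₀ h0 => opA_of_notMem _ fun h' => h
      ⟨h0.mem_iff.2 (by simp), h0.mem_iff.2 (by simp [h'])⟩, sub_zero]

theorem opC_mul_opD (hab : a ≠ b) :
    X.opC a * X.opD a b = X.opC a * X.opC b - X.opC b * X.opC a := by
  refine end_ext fun φ S hS => ?_
  simp only [end_sub_apply, end_mul_apply]
  by_cases h : a ∉ S ∧ b ∉ S
  · have h1 : (b :: a :: S).Nodup := by simp_all [hab.symm]
    have h2 : (b :: S).Nodup := by simp_all
    have h3 := h1.of_cons
    have h4 : (a :: b :: S).Nodup := (List.Perm.swap a b _).nodup_iff.1 h1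
    rw [opC_apply _ h3, opD_apply _ h1, opC_apply _ h3, opC_apply _ h1, opC_apply _ h2,
      opC_apply_second _ h4]
    exact X.emit_cobr_comp (X.emit_cobr S) _
  · rw [opC_eq_zero _ fun ha => opD_of_notMem _ fun h' => h ⟨ha, fun hb => h'.2 (by simp [hb])⟩,
      opC_eq_zero _ fun ha => opC_of_mem _ ?_, opC_eq_zero _ fun hb => opC_of_mem _ ?_, sub_zero]
    · by_contra ha
      exact h ⟨fun h' => ha (by simp [h']), hb⟩
    · by_contra hb
      exact h ⟨ha, fun h' => hb (by simp [h'])⟩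

/-- With `a` and `b` in front, the bracket touches only the first two strands and the emission takes
place below them, so this is naturality of the bracket. The three other commutations are naturality
as well. -/
theorem commute_opM_opC (hab : a ≠ b) (hca : c ≠ a) (hcb : c ≠ b) :
    Commute (X.opM a b) (X.opC c) := by
  refine end_ext fun φ S hS => ?_
  simp only [end_mul_apply]
  by_cases h : (a ∈ S ∧ b ∈ S) ∧ c ∉ S
  · obtain ⟨S₀, h0⟩ := exists_perm_cons_cons hab h.1.1 h.1.2
    refine families_eq_of_perm hS h0 ?_
    have h1 := h0.nodup_iff.1 hS
    have hc : c ∉ a :: b :: S₀ := fun h' => h.2 (h0.mem_iff.2 h')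
    have h2 : (c :: a :: b :: S₀).Nodup := List.nodup_cons.2 ⟨hc, h1⟩
    have h3 : (c :: b :: S₀).Nodup := by simp_all
    have h4 : (a :: b :: c :: S₀).Nodup := by simp_all [hca.symm, hcb.symm]
    rw [opM_apply _ h1, opC_apply_third _ h2, opM_apply _ h4, opC_apply_second _ h3]
    exact ((reassoc_of% X.br_nat (X.emit S₀)) _).symm
  · rw [opM_eq_zero _ fun S₀ h0 => ?_, opC_eq_zero _ fun hc => ?_]
    · exact opM_of_notMem _ fun h' => h ⟨⟨(List.mem_cons.1 h'.1).resolve_left hca.symm,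
        (List.mem_cons.1 h'.2).resolve_left hcb.symm⟩, hc⟩
    · refine opC_of_mem _ ?_
      have h1 : c ∈ S := by
        by_contra hc
        exact h ⟨⟨h0.mem_iff.2 (by simp), h0.mem_iff.2 (by simp)⟩, hc⟩
      exact (List.mem_cons.1 (h0.mem_iff.1 h1)).resolve_left hca

theorem commute_opD_opC (hca : c ≠ a) (hcb : c ≠ b) :
    Commute (X.opD a b) (X.opC c) := by
  refine end_ext fun φ S hS => ?_
  simp only [end_mul_apply]
  by_cases h : a ∈ S ∧ b ∉ S ∧ c ∉ S
  · obtain ⟨S₀, h0⟩ := exists_perm_cons h.1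
    refine families_eq_of_perm hS h0 ?_
    have h1 := h0.nodup_iff.1 hS
    have hb : b ∉ a :: S₀ := fun h' => h.2.1 (h0.mem_iff.2 h')
    have hc : c ∉ a :: S₀ := fun h' => h.2.2 (h0.mem_iff.2 h')
    have h2 : (c :: b :: a :: S₀).Nodup := by simp_all
    have h3 : (c :: a :: S₀).Nodup := by simp_all
    have h4 : (b :: a :: c :: S₀).Nodup := by simp_all [hca.symm, hcb.symm]
    rw [opD_apply _ h2.of_cons, opC_apply_third _ h2, opC_apply_second _ h3, opD_apply _ h4]
    exact ((reassoc_of% X.cobr_nat (X.emit S₀)) _).symm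
  · rw [opD_eq_zero _ fun S₀ h0 hb => ?_, opC_eq_zero _ fun hc => ?_]
    · exact opD_of_notMem _ fun h' => h ⟨(List.mem_cons.1 h'.1).resolve_left hca.symm,
        fun hb => h'.2 (List.mem_cons_of_mem _ hb), hc⟩
    · refine opC_of_mem _ ?_
      have h1 : c ∈ S := by
        by_contra hc
        exact h ⟨h0.mem_iff.2 (by simp), hb, hc⟩
      exact List.mem_cons_of_mem _ (h0.mem_iff.1 h1)

theorem commute_opM_opA (hab : a ≠ b) (hca : c ≠ a) (hcb : c ≠ b) :
    Commute (X.opM a b) (X.opA c) := by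
  refine end_ext fun φ S hS => ?_
  simp only [end_mul_apply]
  by_cases h : a ∈ S ∧ b ∈ S ∧ c ∈ S
  · obtain ⟨S₀, h0⟩ := exists_perm_cons_cons_cons hab hca.symm hcb.symm h.1 h.2.1 h.2.2
    refine families_eq_of_perm hS h0 ?_
    have h1 := h0.nodup_iff.1 hS
    have h2 : (a :: b :: S₀).Nodup := by simp_all
    rw [opM_apply _ h1, opA_apply_third _ h1, opM_apply _ h2, opA_apply_second _ h1.of_cons]
    exact ((reassoc_of% X.br_nat (X.absorb S₀)) _).symm
  · rw [opM_eq_zero _ fun S₀ h0 => ?_, opA_eq_zero _ fun S₀ h0 => ?_]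
    · exact opM_of_notMem _ fun h' => h ⟨h0.mem_iff.2 (by simp [h'.1]), h0.mem_iff.2 (by simp [h'.2]),
        h0.mem_iff.2 (by simp)⟩
    · refine opA_of_notMem _ fun hc => h ⟨h0.mem_iff.2 (by simp), h0.mem_iff.2 (by simp),
        h0.mem_iff.2 (List.mem_cons_of_mem _ hc)⟩

theorem commute_opD_opA (hca : c ≠ a) (hcb : c ≠ b) :
    Commute (X.opD a b) (X.opA c) := by
  refine end_ext fun φ S hS => ?_
  simp only [end_mul_apply]
  by_cases h : a ∈ S ∧ b ∉ S ∧ c ∈ S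
  · obtain ⟨S₀, h0⟩ := exists_perm_cons_cons hca.symm h.1 h.2.2
    refine families_eq_of_perm hS h0 ?_
    have h1 := h0.nodup_iff.1 hS
    have hb : b ∉ a :: c :: S₀ := fun h' => h.2.1 (h0.mem_iff.2 h')
    have h2 : (b :: a :: c :: S₀).Nodup := List.nodup_cons.2 ⟨hb, h1⟩
    have h3 : (b :: a :: S₀).Nodup := by simp_all
    rw [opD_apply _ h2, opA_apply_third _ h2, opA_apply_second _ h1, opD_apply _ h3]
    exact ((reassoc_of% X.cobr_nat (X.absorb S₀)) _).symm
  · rw [opD_eq_zero _ fun S₀ h0 hb => ?_, opA_eq_zero _ fun S₀ h0 => ?_]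
    · exact opD_of_notMem _ fun h' => h ⟨h0.mem_iff.2 (by simp [h'.1]),
        fun hb => h'.2 ((List.mem_cons.1 (h0.mem_iff.1 hb)).resolve_left hcb.symm),
        h0.mem_iff.2 (by simp)⟩
    · refine opA_of_notMem _ fun hc => h ⟨h0.mem_iff.2 (by simp), hb, h0.mem_iff.2
        ((List.mem_cons.1 hc).resolve_left hcb)⟩

/-! ### Iterated actions and coactions -/

variable (X)

/-- The iterated coaction. -/
def coactL : ∀ l : List ℓ, X.V ⟶ X.ob l
  | [] => 𝟙 X.V
  | _ :: l => X.coact ≫ X.U.map (coactL l)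

/-- The iterated action. -/
def actL : ∀ l : List ℓ, X.ob l ⟶ X.V
  | [] => 𝟙 X.V
  | _ :: l => X.U.map (actL l) ≫ X.act

/-- The family given by the identity of the module. -/
def unitFamily : X.families := ⟨fun S => match S with
    | [] => 𝟙 X.V
    | _ :: _ => 0, by
  refine ⟨fun S hS => ?_, fun S S' hS h => ?_⟩
  · cases S with
    | nil => exact absurd List.nodup_nil hS
    | cons a S => rfl
  · cases S with
    | nil =>
      obtain rfl := h.nil_eq
      exact ((congrArg (· ≫ _) (X.pm_refl hS)).trans (Category.id_comp _)).symm
    | cons a S =>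
      cases S' with
      | nil => exact absurd h.eq_nil (List.cons_ne_nil _ _)
      | cons a' S' => exact Limits.comp_zero.symm⟩

/-- The product of the operators emitting the strands of a list, the first one being emitted
first. -/
noncomputable def prodC (l : List ℓ) : AddMonoid.End X.families := (l.map X.opC).prod

/-- The product of the operators absorbing the strands of a list, the last one being absorbed
first. -/
noncomputable def prodA (l : List ℓ) : AddMonoid.End X.families := (l.reverse.map X.opA).prod

/-- The recursion of `coactL` splits off the strand emitted first, whereas a product of operators
has to be extended at the other end. The last emission takes place at the module, below all of `l`,
and its strand is then brought from the front to the last position. -/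
theorem coactL_append (l : List ℓ) (hl : (c :: l).Nodup) :
    X.coactL (l ++ [c]) = X.coactL l ≫ X.emit l ≫ X.pm (c :: l) (l ++ [c]) := by
  induction l with
  | nil =>
    change X.coact ≫ X.U.map (𝟙 X.V) = 𝟙 X.V ≫ X.coact ≫ X.pm [c] [c]
    rw [X.pm_refl hl, X.U.map_id]
    exact (Category.id_comp _).symm
  | cons x l ih =>
    have h1 : (c :: l).Nodup := by simp_all
    have h2 : (x :: c :: l).Nodup := (List.Perm.swap x c l).nodup_iff.1 hl
    have h3 : (c :: l).Perm (l ++ [c]) := (List.perm_append_singleton c l).symm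
    have h4 : X.sw (X.ob l) ≫ X.pm (c :: x :: l) (x :: (l ++ [c])) =
        X.U.map (X.pm (c :: l) (l ++ [c])) := by
      refine (congrArg (· ≫ _) (X.pm_swap h2).symm).trans ?_
      exact (X.pm_trans h2 (List.Perm.swap c x l) ((List.Perm.swap x c l).trans (h3.cons x))).trans
        (X.pm_cons h2 h3)
    exact X.coactL_append_step (ih h1) h4

theorem actL_append (l : List ℓ) (hl : (c :: l).Nodup) :
    X.actL (l ++ [c]) = X.pm (l ++ [c]) (c :: l) ≫ X.absorb l ≫ X.actL l := by
  induction l with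
  | nil =>
    change X.U.map (𝟙 X.V) ≫ X.act = X.pm [c] [c] ≫ X.act ≫ 𝟙 X.V
    rw [X.pm_refl hl, X.U.map_id]
    exact congrArg (_ ≫ ·) (Category.comp_id _).symm
  | cons x l ih =>
    have h1 : (c :: l).Nodup := by simp_all
    have h2 : (x :: c :: l).Nodup := (List.Perm.swap x c l).nodup_iff.1 hl
    have h3 : (l ++ [c]).Perm (c :: l) := List.perm_append_singleton c l
    have h6 : (x :: (l ++ [c])).Nodup := (h3.cons x).nodup_iff.2 h2
    have h4 : X.pm (x :: (l ++ [c])) (c :: x :: l) ≫ X.sw (X.ob l) =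
        X.U.map (X.pm (l ++ [c]) (c :: l)) := by
      refine (congrArg (_ ≫ ·) (X.pm_swap hl).symm).trans ?_
      exact (X.pm_trans h6 ((h3.cons x).trans (List.Perm.swap c x l)) (List.Perm.swap x c l)).trans
        (X.pm_cons h6 h3)
    exact X.actL_append_step (ih h1) h4

variable {X}

/-- The rightmost factor acts on `φ` first, hence the induction from the end of the list. -/
theorem prodC_apply (l : List ℓ) (hl : l.Nodup) :
    (X.prodC l φ).1 [] = X.coactL l ≫ φ.1 l := by
  induction l using List.reverseRecOn generalizing φ with
  | nil => exact (Category.id_comp _).symm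
  | append_singleton l c ih =>
    have h1 : (c :: l).Nodup := (List.perm_append_singleton c l).nodup_iff.1 hl
    have h2 : X.prodC (l ++ [c]) = X.prodC l * X.opC c := by simp [prodC]
    rw [h2, end_mul_apply, ih _ h1.of_cons, opC_apply _ h1, X.coactL_append l h1,
      families_perm φ h1 (List.perm_append_singleton c l).symm]
    exact comp_comp_assoc _ _ _ _

theorem prodA_apply (l : List ℓ) (hl : l.Nodup) :
    (X.prodA l φ).1 l = X.actL l ≫ φ.1 [] := by
  induction l using List.reverseRecOn with
  | nil => exact (Category.id_comp _).symm
  | append_singleton l c ih =>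
    have h1 : (c :: l).Nodup := (List.perm_append_singleton c l).nodup_iff.1 hl
    have h2 : X.prodA (l ++ [c]) = X.opA c * X.prodA l := by simp [prodA]
    rw [h2, end_mul_apply, families_perm _ hl (List.perm_append_singleton c l), opA_apply _ h1,
      ih h1.of_cons, X.actL_append l h1]
    exact comp_comp_assoc _ _ _ _

/-- The dictionary between operators and morphisms. Leaving `φ` arbitrary allows the product for a
second basis element to be fed in, so that products of operators correspond to composites. -/
theorem prodC_mul_prodA_apply {e p : List ℓ} (he : e.Nodup) (h : e.Perm p) :
    ((X.prodC e * X.prodA p) φ).1 [] = (X.coactL e ≫ X.pm e p ≫ X.actL p) ≫ φ.1 [] := by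
  rw [end_mul_apply, prodC_apply _ e he, families_perm _ he h, prodA_apply _ p (h.nodup_iff.1 he)]
  exact comp_comp_assoc _ _ _ _

end StrandCalculus

/-! ## The strand calculus of the Drinfeld–Yetter PROP -/

open ColoredProp ColoredProp.Diagram Color

/-! ### Bijections of positions determined by labels. -/

section Positions

variable {C : Type} {A B A' B' : List C}

theorem appendPos_inl (i : Fin A.length) : ((appendPos A B (Sum.inl i) : Fin _) : ℕ) = i := rfl

theorem appendPos_inr (i : Fin B.length) :
    ((appendPos A B (Sum.inr i) : Fin _) : ℕ) = A.length + i := rfl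

theorem posSum_appendPos (σ : Fin A.length ≃ Fin B.length) (τ : Fin A'.length ≃ Fin B'.length)
    (x) : posSum σ τ (appendPos A A' x) = appendPos B B' (Sum.map σ τ x) := by
  simp [posSum]

/-- A bijection of positions of two words respects the labels given by two lists. -/
def RespectsLabels {α : Type*} (l l' : List α) (e : Fin A.length ≃ Fin B.length) : Prop :=
  ∀ i : Fin A.length, l'[(e i : ℕ)]? = l[(i : ℕ)]?

theorem RespectsLabels.posSum {α : Type*} {l₁ l₂ l₁' l₂' : List α} {σ : Fin A.length ≃ Fin B.length}
    {τ : Fin A'.length ≃ Fin B'.length} (h : RespectsLabels l₁ l₂ σ)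
    (h' : RespectsLabels l₁' l₂' τ) (hA : l₁.length = A.length) (hB : l₂.length = B.length) :
    RespectsLabels (l₁ ++ l₁') (l₂ ++ l₂') (posSum σ τ) := by
  intro i
  obtain ⟨x, rfl⟩ := (appendPos A A').surjective i
  rw [posSum_appendPos]
  cases x with
  | inl x =>
    rw [Sum.map_inl, appendPos_inl, appendPos_inl, List.getElem?_append_left (by omega),
      List.getElem?_append_left (by omega), h x]
  | inr x =>
    rw [Sum.map_inr, appendPos_inr, appendPos_inr, ← hA, ← hB, List.getElem?_append_right (by omega),
      List.getElem?_append_right (by omega), Nat.add_sub_cancel_left, Nat.add_sub_cancel_left, h' x]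

theorem RespectsLabels.trans {D : List C} {α : Type*} {l l' l'' : List α}
    {σ : Fin A.length ≃ Fin B.length} {τ : Fin B.length ≃ Fin D.length}
    (h : RespectsLabels l l' σ) (h' : RespectsLabels l' l'' τ) :
    RespectsLabels l l'' (σ.trans τ) :=
  fun i => (h' (σ i)).trans (h i)

theorem RespectsLabels.unique {α : Type*} {l l' : List α} {σ τ : Fin A.length ≃ Fin B.length}
    (h : RespectsLabels l l' σ) (h' : RespectsLabels l l' τ) (hl : l'.Nodup)
    (hB : l'.length = B.length) : σ = τ := by
  refine Equiv.ext fun i => Fin.ext ?_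
  have h0 : (σ i : ℕ) < l'.length := by
    have := (σ i).2
    omega
  exact (List.getElem?_inj h0 hl).1 ((h i).trans (h' i).symm)

theorem RespectsLabels.respectsColors {α : Type*} {l l' : List α} {σ : Fin A.length ≃ Fin B.length}
    (h : RespectsLabels l l' σ) {c : α → C} (hA : A = l.map c) (hB : B = l'.map c) :
    RespectsColors σ := by
  intro i
  have h1 := congrArg (Option.map c) (h i)
  rw [← List.getElem?_map, ← List.getElem?_map, ← hA, ← hB] at h1
  simpa using h1

end Positions

/-! ### The presented PROP satisfies the axioms of a strand calculus. -/

section Concrete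

variable (K : Type u) [Field K]

theorem toHom_eq {A B : List Color} {f g : Diagram K Gen A B} (h : Eqv (Rel K) f g) :
    toHom (Rel K) f = toHom (Rel K) g :=
  Quotient.sound h

theorem toHom_sub {A B : List Color} (f g : Diagram K Gen A B) :
    toHom (Rel K) (f -ₑ g) = toHom (Rel K) f - toHom (Rel K) g := by
  rw [sub_eq_add_neg]
  rfl

/-- For explicit words on the left the two bracketings are definitionally the same word, so the
transport in `tensor_assoc` disappears. The same holds wherever associativity is used below. -/
theorem underB_underB {A B : List Color} (f : Diagram K Gen A B) :
    Eqv (Rel K) (underB K (underB K f)) (ident [b, b] ⊗ₑ f) :=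
  (Eqv.tensor_assoc (idB K) (idB K) f).symm.trans
    (Eqv.tensor_congr (Eqv.tensor_id [b] [b]) (Eqv.refl f))

theorem tensor_exchange {A B D D' : List Color} (f : Diagram K Gen A B) (g : Diagram K Gen D D') :
    Eqv (Rel K) ((ident D ⊗ₑ f) ≫ₑ (g ⊗ₑ ident B)) ((g ⊗ₑ ident A) ≫ₑ (ident D' ⊗ₑ f)) :=
  (Eqv.interchange _ _ _ _).trans ((Eqv.tensor_congr ((Eqv.id_comp g).trans (Eqv.comp_id g).symm)
    ((Eqv.comp_id f).trans (Eqv.id_comp f).symm)).trans (Eqv.interchange _ _ _ _).symm)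

theorem comp_tensor_ident {A B D : List Color} (f : Diagram K Gen A B) (g : Diagram K Gen B D)
    (E : List Color) :
    Eqv (Rel K) ((f ≫ₑ g) ⊗ₑ ident E) ((f ⊗ₑ ident E) ≫ₑ (g ⊗ₑ ident E)) :=
  (Eqv.tensor_congr (Eqv.refl _) (Eqv.id_comp _).symm).trans (Eqv.interchange _ _ _ _).symm

theorem ident_tensor_comp {A B D : List Color} (f : Diagram K Gen A B) (g : Diagram K Gen B D)
    (E : List Color) :
    Eqv (Rel K) (ident E ⊗ₑ (f ≫ₑ g)) ((ident E ⊗ₑ f) ≫ₑ (ident E ⊗ₑ g)) :=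
  (Eqv.tensor_congr (Eqv.id_comp _).symm (Eqv.refl _)).trans (Eqv.interchange _ _ _ _).symm

theorem respectsColors_b {A B : List Color} {σ : Fin A.length ≃ Fin B.length}
    (hA : ∀ x ∈ A, x = b) (hB : ∀ x ∈ B, x = b) : RespectsColors σ := fun _ =>
  (hB _ (List.get_mem _ _)).trans (hA _ (List.get_mem _ _)).symm

omit [Field K] in
-- As a block exchange the transposition is accessible to `flip_natural`.
theorem swapB_eq : swapB K = perm (posFlip [b] [b]) (respectsColors_b (by simp) (by simp)) := by
  have : bsPerm (n := 2) (Equiv.swap 0 1) = posFlip [b] [b] := by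
    refine Equiv.ext fun i => ?_
    revert i
    decide
  simp only [swapB, permB]
  congr 1

theorem idB_eqv_perm :
    Eqv (Rel K) (idB K) (perm (Equiv.refl _) (respectsColors_b (by simp) (by simp))) :=
  (Eqv.perm_id _ _).symm

/-- The exchange of the first two of three strands. -/
def swapLeft : Diagram K Gen [b, b, b] [b, b, b] := swapB K ⊗ₑ idB K

/-- The exchange of the last two of three strands. -/
def swapRight : Diagram K Gen [b, b, b] [b, b, b] := underB K (swapB K)

/-- The bracket of the first two of three strands. -/
def muLeft : Diagram K Gen [b, b, b] [b, b] := mu K ⊗ₑ idB K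

/-- The cobracket of the first of two strands. -/
def deltaLeft : Diagram K Gen [b, b] [b, b, b] := delta K ⊗ₑ idB K

theorem swapLeft_eqv_perm : Eqv (Rel K) (swapLeft K)
    (perm (posSum (posFlip [b] [b]) (Equiv.refl (Fin [b].length)))
      (respectsColors_b (by simp) (by simp))) := by
  rw [swapLeft, swapB_eq]
  exact (Eqv.tensor_congr (Eqv.refl _) (idB_eqv_perm K)).trans (Eqv.perm_tensor _ _ _ _ _)

theorem swapRight_eqv_perm : Eqv (Rel K) (swapRight K)
    (perm (posSum (Equiv.refl (Fin [b].length)) (posFlip [b] [b]))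
      (respectsColors_b (by simp) (by simp))) := by
  rw [swapRight, underB, swapB_eq]
  exact (Eqv.tensor_congr (idB_eqv_perm K) (Eqv.refl _)).trans (Eqv.perm_tensor _ _ _ _ _)

theorem swapB_comp_swapB : Eqv (Rel K) (swapB K ≫ₑ swapB K) (ident [b, b]) := by
  have h : (posFlip [b] [b]).trans (posFlip [b] [b]) = Equiv.refl _ := by
    refine Equiv.ext fun i => ?_
    revert i
    decide
  rw [swapB_eq]
  refine (Eqv.perm_comp _ _ _ _ (respectsColors_b (by simp) (by simp))).trans ?_
  simp only [h]
  exact Eqv.perm_id _ _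

theorem perm_eqv {A B : List Color} {σ τ : Fin A.length ≃ Fin B.length} (h : σ = τ)
    (hσ : RespectsColors σ) (hτ : RespectsColors τ) :
    Eqv (Rel K) (perm σ hσ) (perm τ hτ) := by
  subst h
  exact Eqv.refl _

/-- Factoring the exchange of a block of two with one strand into adjacent swaps lets naturality of
block exchanges be read as a relation between swaps and generators. -/
theorem perm_posFlip_two_one : Eqv (Rel K)
    (perm (posFlip [b, b] [b]) (respectsColors_b (by simp) (by simp)))
    (swapRight K ≫ₑ swapLeft K) := by
  refine Eqv.trans ?_ (Eqv.comp_congr (swapRight_eqv_perm K) (swapLeft_eqv_perm K)).symm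
  refine Eqv.trans ?_ (Eqv.perm_comp _ _ _ _ (respectsColors_b (by simp) (by simp))).symm
  refine perm_eqv K (Equiv.ext fun i => ?_) _ _
  revert i
  decide

theorem perm_posFlip_one_two : Eqv (Rel K)
    (perm (posFlip [b] [b, b]) (respectsColors_b (by simp) (by simp)))
    (swapLeft K ≫ₑ swapRight K) := by
  refine Eqv.trans ?_ (Eqv.comp_congr (swapLeft_eqv_perm K) (swapRight_eqv_perm K)).symm
  refine Eqv.trans ?_ (Eqv.perm_comp _ _ _ _ (respectsColors_b (by simp) (by simp))).symm
  refine perm_eqv K (Equiv.ext fun i => ?_) _ _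
  revert i
  decide

/-- Naturality of the block exchange for `mu ⊗ id`. -/
theorem mu_swapB : Eqv (Rel K) (muLeft K ≫ₑ swapB K)
    (swapRight K ≫ₑ swapLeft K ≫ₑ underB K (mu K)) := by
  have h := Eqv.flip_natural (R := Rel K) (mu K) (idB K)
    (respectsColors_b (by simp) (by simp)) (respectsColors_b (by simp) (by simp))
  rw [← swapB_eq] at h
  exact h.trans ((Eqv.comp_congr (perm_posFlip_two_one K) (Eqv.refl _)).trans (Eqv.comp_assoc (swapRight K) (swapLeft K) (underB K (mu K))))

theorem swapB_delta : Eqv (Rel K) (swapB K ≫ₑ deltaLeft K)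
    (underB K (delta K) ≫ₑ swapLeft K ≫ₑ swapRight K) := by
  have h := Eqv.flip_natural (R := Rel K) (idB K) (delta K)
    (respectsColors_b (by simp) (by simp)) (respectsColors_b (by simp) (by simp))
  rw [← swapB_eq] at h
  exact h.symm.trans (Eqv.comp_congr (Eqv.refl _) (perm_posFlip_one_two K))

/-- The Yang–Baxter relation is naturality of the exchange of one strand with two, applied to the
swap itself. -/
theorem swapB_braid : Eqv (Rel K) (swapLeft K ≫ₑ swapRight K ≫ₑ swapLeft K)
    (swapRight K ≫ₑ swapLeft K ≫ₑ swapRight K) := by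
  have h := Eqv.flip_natural (R := Rel K) (idB K) (swapB K)
    (respectsColors_b (by simp) (by simp)) (respectsColors_b (by simp) (by simp))
  refine (Eqv.comp_assoc (swapLeft K) (swapRight K) (swapLeft K)).symm.trans ?_
  exact ((Eqv.comp_congr (perm_posFlip_one_two K).symm (Eqv.refl _)).trans h.symm).trans
    (Eqv.comp_congr (Eqv.refl _) (perm_posFlip_one_two K))

/-- Adding one strand on the left, as an endofunctor. -/
def addStrand : DY1 K ⥤ DY1 K where
  obj A := (b :: A : List Color)
  map {A B} := Quotient.map (sa := diagramSetoid (Rel K) A B)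
    (sb := diagramSetoid (Rel K) (b :: A) (b :: B)) (underB K)
    fun _ _ h => Eqv.tensor_congr (Eqv.refl _) h
  map_id A := toHom_eq K (Eqv.tensor_id [b] A)
  map_comp {A B D} := by
    rintro ⟨f⟩ ⟨g⟩
    exact toHom_eq K (ident_tensor_comp K f g [b])

/-- The word with one strand `b` for every label, followed by the module. -/
abbrev wordOf {ℓ : Type} (S : List ℓ) : List Color := (strands (addStrand K) (V K) S : DY1 K)

/-- The labels of the letters of `wordOf`. -/
def labelsOf {ℓ : Type} (S : List ℓ) : List (Option ℓ) := S.map some ++ [none]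

/-- The color of a label. -/
def labelColor {ℓ : Type} : Option ℓ → Color
  | some _ => b
  | none => v

variable {ℓ : Type}

theorem wordOf_eq (S : List ℓ) : wordOf K S = (labelsOf S).map labelColor := by
  induction S with
  | nil => rfl
  | cons a S ih => exact congrArg (List.cons b) ih

theorem length_wordOf (S : List ℓ) : (labelsOf S).length = (wordOf K S).length := by
  rw [wordOf_eq, List.length_map]

theorem nodup_labelsOf {S : List ℓ} (h : S.Nodup) : (labelsOf S).Nodup := by
  refine List.nodup_append.2 ⟨h.map (Option.some_injective _), by simp, ?_⟩
  simp

theorem colors_of_labels {S S' : List ℓ} {e : Fin (wordOf K S).length ≃ Fin (wordOf K S').length}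
    (h : RespectsLabels (labelsOf S) (labelsOf S') e) : RespectsColors e :=
  h.respectsColors (wordOf_eq K S) (wordOf_eq K S')

open Classical in
/-- The morphism permuting the strands according to their labels. -/
noncomputable def labelPerm (S S' : List ℓ) :
    strands (addStrand K) (V K) S ⟶ strands (addStrand K) (V K) S' :=
  if h : ∃ e : Fin (wordOf K S).length ≃ Fin (wordOf K S').length,
      RespectsLabels (labelsOf S) (labelsOf S') e then
    toHom (Rel K) (perm h.choose (colors_of_labels K h.choose_spec)) else 0

/-- Since the target labels are distinct, a label-preserving bijection is unique, and the choice
made in `labelPerm` does not matter. -/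
theorem labelPerm_eq {S S' : List ℓ} (hS : S'.Nodup)
    {e : Fin (wordOf K S).length ≃ Fin (wordOf K S').length}
    (h : RespectsLabels (labelsOf S) (labelsOf S') e) :
    labelPerm K S S' = toHom (Rel K) (perm e (colors_of_labels K h)) := by
  have h' : ∃ e : Fin (wordOf K S).length ≃ Fin (wordOf K S').length,
      RespectsLabels (labelsOf S) (labelsOf S') e := ⟨e, h⟩
  refine (dif_pos h').trans ?_
  congr 2
  exact h'.choose_spec.unique h (nodup_labelsOf hS) (length_wordOf K S')

theorem respectsLabels_cons {S S' : List ℓ}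
    {e : Fin (wordOf K S).length ≃ Fin (wordOf K S').length}
    (h : RespectsLabels (labelsOf S) (labelsOf S') e) (a : ℓ) :
    RespectsLabels (A := wordOf K (a :: S)) (B := wordOf K (a :: S')) (labelsOf (a :: S))
      (labelsOf (a :: S')) (posSum (Equiv.refl (Fin [b].length)) e) :=
  RespectsLabels.posSum (l₁ := [some a]) (l₂ := [some a]) (A := [b]) (B := [b])
    (fun _ => rfl) h rfl rfl

theorem respectsLabels_swap (a c : ℓ) (S : List ℓ) :
    RespectsLabels (A := wordOf K (a :: c :: S)) (B := wordOf K (c :: a :: S))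
      (labelsOf (a :: c :: S)) (labelsOf (c :: a :: S))
      (posSum (posFlip [b] [b]) (Equiv.refl (Fin (wordOf K S).length))) :=
  RespectsLabels.posSum (l₁ := [some a, some c]) (l₂ := [some c, some a]) (A := [b, b])
    (B := [b, b]) (fun i => by
      have h : ((posFlip [b] [b] i : Fin 2) : ℕ) = 1 - (i : ℕ) := by
        revert i
        decide
      rw [h]
      obtain ⟨i, hi⟩ := i
      have hi : i < 2 := hi
      interval_cases i <;> rfl) (fun _ => rfl) rfl rfl

theorem exists_respectsLabels {S S' : List ℓ} (h : S.Perm S') :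
    ∃ e : Fin (wordOf K S).length ≃ Fin (wordOf K S').length,
      RespectsLabels (labelsOf S) (labelsOf S') e := by
  induction h with
  | nil => exact ⟨Equiv.refl _, fun _ => rfl⟩
  | cons a h ih => exact ⟨_, respectsLabels_cons K ih.choose_spec a⟩
  | swap a c S => exact ⟨_, respectsLabels_swap K c a S⟩
  | trans h h' ih ih' => exact ⟨_, ih.choose_spec.trans ih'.choose_spec⟩

/-- Morphisms on strands `b`, extended by the identity on the left. -/
theorem comp_tensor_ident_eq {A B D : List Color} {f : Diagram K Gen A B} {g : Diagram K Gen B D}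
    {h : Diagram K Gen A D} (H : Eqv (Rel K) (f ≫ₑ g) h) (E : List Color) :
    Eqv (Rel K) ((f ⊗ₑ ident E) ≫ₑ (g ⊗ₑ ident E)) (h ⊗ₑ ident E) :=
  (comp_tensor_ident K f g E).symm.trans (Eqv.tensor_congr H (Eqv.refl _))

theorem comp_comp_tensor_ident {A B D F : List Color} (f : Diagram K Gen A B)
    (g : Diagram K Gen B D) (h : Diagram K Gen D F) (E : List Color) :
    Eqv (Rel K) ((f ≫ₑ g ≫ₑ h) ⊗ₑ ident E)
      ((f ⊗ₑ ident E) ≫ₑ (g ⊗ₑ ident E) ≫ₑ (h ⊗ₑ ident E)) :=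
  (comp_tensor_ident K f _ E).trans (Eqv.comp_congr (Eqv.refl _) (comp_tensor_ident K g h E))

theorem swapLeft_tensor (E : List Color) :
    Eqv (Rel K) (swapLeft K ⊗ₑ ident E)
      (Diagram.tensor (A := [b, b]) (B := [b, b]) (A' := b :: E) (B' := b :: E) (swapB K) (ident _)) :=
  (Eqv.tensor_assoc (swapB K) (idB K) (ident E)).trans
    (Eqv.tensor_congr (Eqv.refl _) (Eqv.tensor_id [b] E))

theorem muLeft_tensor (E : List Color) :
    Eqv (Rel K) (muLeft K ⊗ₑ ident E)
      (Diagram.tensor (A := [b, b]) (B := [b]) (A' := b :: E) (B' := b :: E) (mu K) (ident _)) :=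
  (Eqv.tensor_assoc (mu K) (idB K) (ident E)).trans
    (Eqv.tensor_congr (Eqv.refl _) (Eqv.tensor_id [b] E))

theorem deltaLeft_tensor (E : List Color) :
    Eqv (Rel K) (deltaLeft K ⊗ₑ ident E)
      (Diagram.tensor (A := [b]) (B := [b, b]) (A' := b :: E) (B' := b :: E) (delta K) (ident _)) :=
  (Eqv.tensor_assoc (delta K) (idB K) (ident E)).trans
    (Eqv.tensor_congr (Eqv.refl _) (Eqv.tensor_id [b] E))

theorem swapRight_tensor (E : List Color) :
    Eqv (Rel K) (swapRight K ⊗ₑ ident E) (underB K (swapB K ⊗ₑ ident E)) :=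
  Eqv.tensor_assoc (idB K) (swapB K) (ident E)

theorem underB_mu_tensor (E : List Color) :
    Eqv (Rel K) (underB K (mu K) ⊗ₑ ident E) (underB K (mu K ⊗ₑ ident E)) :=
  Eqv.tensor_assoc (idB K) (mu K) (ident E)

theorem underB_delta_tensor (E : List Color) :
    Eqv (Rel K) (underB K (delta K) ⊗ₑ ident E) (underB K (delta K ⊗ₑ ident E)) :=
  Eqv.tensor_assoc (idB K) (delta K) (ident E)

variable (ℓ) in
/-- The strand calculus of the Drinfeld–Yetter PROP. -/
noncomputable def strandCalculus : StrandCalculus (DY1 K) ℓ where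
  U := addStrand K
  map_add {A B} := by
    rintro ⟨f⟩ ⟨g⟩
    exact toHom_eq K (Eqv.tensor_add (idB K) f g)
  V := V K
  sw A := toHom (Rel K) (swapB K ⊗ₑ ident (A : List Color))
  br A := toHom (Rel K) (mu K ⊗ₑ ident (A : List Color))
  cobr A := toHom (Rel K) (delta K ⊗ₑ ident (A : List Color))
  act := toHom (Rel K) (act K)
  coact := toHom (Rel K) (coact K)
  sw_nat {A B} := by
    rintro ⟨f⟩
    exact toHom_eq K ((Eqv.comp_congr (underB_underB K f) (Eqv.refl _)).trans
      ((tensor_exchange K f (swapB K)).trans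
        (Eqv.comp_congr (Eqv.refl _) (underB_underB K f).symm)))
  br_nat {A B} := by
    rintro ⟨f⟩
    exact toHom_eq K ((Eqv.comp_congr (underB_underB K f) (Eqv.refl _)).trans
      (tensor_exchange K f (mu K)))
  cobr_nat {A B} := by
    rintro ⟨f⟩
    exact toHom_eq K ((tensor_exchange K f (delta K)).trans
        (Eqv.comp_congr (Eqv.refl _) (underB_underB K f).symm))
  sw_sw A := toHom_eq K ((comp_tensor_ident_eq K (swapB_comp_swapB K) A).trans
    (Eqv.tensor_id [b, b] A))
  braid A := by
    have h := (comp_comp_tensor_ident K (swapLeft K) (swapRight K) (swapLeft K) A).symm.trans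
      ((Eqv.tensor_congr (swapB_braid K) (Eqv.refl _)).trans
        (comp_comp_tensor_ident K (swapRight K) (swapLeft K) (swapRight K) A))
    exact toHom_eq K ((Eqv.comp_congr (swapLeft_tensor K A) (Eqv.comp_congr
      (swapRight_tensor K A) (swapLeft_tensor K A))).symm.trans (h.trans
        (Eqv.comp_congr (swapRight_tensor K A) (Eqv.comp_congr
          (swapLeft_tensor K A) (swapRight_tensor K A)))))
  br_sw A := by
    have h := (comp_tensor_ident K (muLeft K) (swapB K) A).symm.trans
      ((Eqv.tensor_congr (mu_swapB K) (Eqv.refl _)).trans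
        (comp_comp_tensor_ident K (swapRight K) (swapLeft K) (underB K (mu K)) A))
    exact toHom_eq K ((Eqv.comp_congr (muLeft_tensor K A) (Eqv.refl _)).symm.trans (h.trans
        (Eqv.comp_congr (swapRight_tensor K A) (Eqv.comp_congr
          (swapLeft_tensor K A) (underB_mu_tensor K A)))))
  cobr_sw A := by
    have h := (comp_tensor_ident K (swapB K) (deltaLeft K) A).symm.trans
      ((Eqv.tensor_congr (swapB_delta K) (Eqv.refl _)).trans
        (comp_comp_tensor_ident K (underB K (delta K)) (swapLeft K) (swapRight K) A))
    exact toHom_eq K ((Eqv.comp_congr (Eqv.refl _) (deltaLeft_tensor K A)).symm.trans (h.trans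
        (Eqv.comp_congr (underB_delta_tensor K A) (Eqv.comp_congr
          (swapLeft_tensor K A) (swapRight_tensor K A)))))
  br_act := (toHom_eq K (Eqv.rel Rel.action)).trans (toHom_sub K _ _)
  coact_cobr := (toHom_eq K (Eqv.rel Rel.coaction)).trans (toHom_sub K _ _)
  act_coact := by
    refine (toHom_eq K (Eqv.rel Rel.drinfeldYetter)).trans ?_
    refine (toHom_sub K _ _).trans (congrArg₂ (· - ·) ?_ rfl)
    exact toHom_eq K (Eqv.comp_add _ _ _)
  pm := labelPerm K
  pm_refl hS := (labelPerm_eq K hS (e := Equiv.refl _) fun _ => rfl).trans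
    (toHom_eq K (Eqv.perm_id _ _))
  pm_trans hS h h' := by
    obtain ⟨e, he⟩ := exists_respectsLabels K h
    obtain ⟨e', he'⟩ := exists_respectsLabels K h'
    have hS' := h.nodup_iff.1 hS
    have hS'' := h'.nodup_iff.1 hS'
    rw [labelPerm_eq K hS' he, labelPerm_eq K hS'' he', labelPerm_eq K hS'' (he.trans he')]
    exact toHom_eq K (Eqv.perm_comp _ _ _ _ _)
  pm_cons hS h := by
    obtain ⟨e, he⟩ := exists_respectsLabels K h
    rw [labelPerm_eq K (h.nodup_iff.1 hS.of_cons) he,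
      labelPerm_eq K ((h.cons _).nodup_iff.1 hS) (respectsLabels_cons K he _)]
    exact (toHom_eq K ((Eqv.tensor_congr (idB_eqv_perm K) (Eqv.refl _)).trans
      (Eqv.perm_tensor _ _ _ _ _))).symm
  pm_swap hS := by
    rw [labelPerm_eq K ((List.Perm.swap _ _ _).nodup_iff.1 hS) (respectsLabels_swap K _ _ _)]
    exact (toHom_eq K (by
      rw [swapB_eq]
      exact ((Eqv.tensor_congr (Eqv.refl _) (Eqv.perm_id _ fun _ => rfl).symm).trans
        (Eqv.perm_tensor _ _ _ _ _)))).symm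

/-- The iterated coaction, with target the word of a list of labels. -/
def coactDiagram : ∀ l : List ℓ, Diagram K Gen [v] (wordOf K l)
  | [] => idV K
  | _ :: l => coact K ≫ₑ underB K (coactDiagram l)

/-- The iterated action, with source the word of a list of labels. -/
def actDiagram : ∀ l : List ℓ, Diagram K Gen (wordOf K l) [v]
  | [] => idV K
  | _ :: l => underB K (actDiagram l) ≫ₑ act K

theorem coactL_eq (l : List ℓ) :
    (strandCalculus K ℓ).coactL l = toHom (Rel K) (coactDiagram K l) := by
  induction l with
  | nil => rfl
  | cons a l ih =>
    exact congrArg (fun f => toHom (Rel K) (coact K) ≫ (addStrand K).map f) ih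

theorem actL_eq (l : List ℓ) :
    (strandCalculus K ℓ).actL l = toHom (Rel K) (actDiagram K l) := by
  induction l with
  | nil => rfl
  | cons a l ih =>
    exact congrArg (fun f => (addStrand K).map f ≫ toHom (Rel K) (act K)) ih

/-- The word of a list of labels equals `bs n ++ [v]` only propositionally, which is the origin of
the transports in the lemmas that follow. -/
theorem wordOf_eq_bs (l : List ℓ) : wordOf K l = bs l.length ++ [v] := by
  induction l with
  | nil => rfl
  | cons a l ih => exact congrArg (List.cons b) ih

omit [Field K] in
theorem cast_coact {A B : List Color} (h : A = B) (f : Diagram K Gen [v] A) :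
    coact K ≫ₑ underB K (h ▸ f) = (congrArg (List.cons b) h ▸ (coact K ≫ₑ underB K f)) := by
  subst h
  rfl

omit [Field K] in
theorem cast_act {A B : List Color} (h : A = B) (f : Diagram K Gen A [v]) :
    underB K (h ▸ f) ≫ₑ act K = (congrArg (List.cons b) h ▸ (underB K f ≫ₑ act K)) := by
  subst h
  rfl

theorem coactN_eq (l : List ℓ) : coactN K l.length = wordOf_eq_bs K l ▸ coactDiagram K l := by
  induction l with
  | nil => rfl
  | cons a l ih =>
    refine Eq.trans ?_ (cast_coact K (wordOf_eq_bs K l) (coactDiagram K l))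
    rw [← ih]
    rfl

theorem actN_eq (l : List ℓ) : actN K l.length = wordOf_eq_bs K l ▸ actDiagram K l := by
  induction l with
  | nil => rfl
  | cons a l ih =>
    refine Eq.trans ?_ (cast_act K (wordOf_eq_bs K l) (actDiagram K l))
    rw [← ih]
    rfl

omit [Field K] in
-- The transported words occur only in the middle of an endomorphism of `[v]`, where the transports
-- cancel as soon as the two bijections have the same numerical values.
theorem comp_perm_comp_cast {A A' B B' : List Color} (h : A = B) (h' : A' = B')
    (f : Diagram K Gen [v] A) (g : Diagram K Gen A' [v]) (e : Fin A.length ≃ Fin A'.length)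
    (he : RespectsColors e) (e' : Fin B.length ≃ Fin B'.length) (he' : RespectsColors e')
    (H : ∀ i : Fin A.length, (e i : ℕ) = e' (i.cast (congrArg List.length h))) :
    ((h ▸ f) ≫ₑ perm e' he' ≫ₑ (h' ▸ g) : Diagram K Gen [v] [v]) = f ≫ₑ perm e he ≫ₑ g := by
  subst h h'
  obtain rfl : e = e' := Equiv.ext fun i => Fin.ext (H i)
  rfl

theorem permB_tensor_idV {n : ℕ} (σ : Equiv.Perm (Fin n))
    (h : RespectsColors (posSum (bsPerm σ) (Equiv.refl (Fin [v].length)))) :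
    Eqv (Rel K) (permB K σ ⊗ₑ idV K) (perm (posSum (bsPerm σ) (Equiv.refl (Fin [v].length))) h) :=
  (Eqv.tensor_congr (Eqv.refl _) (Eqv.perm_id [v] fun _ => rfl).symm).trans
    (Eqv.perm_tensor _ _ _ _ _)

/-- The basis element of a permutation, in terms of the labels of the strands after the coactions
and before the actions. -/
theorem r_eq {n : ℕ} (σ : Equiv.Perm (Fin n)) {e p : List ℓ} (he : e.length = n)
    (hp : p.length = n) (hpn : p.Nodup) (h : ∀ i : Fin n, p[(σ i : ℕ)]? = e[(i : ℕ)]?) :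
    r K σ = (strandCalculus K ℓ).coactL e ≫ (strandCalculus K ℓ).pm e p ≫
      (strandCalculus K ℓ).actL p := by
  have hl : RespectsLabels (A := bs n ++ [v]) (B := bs n ++ [v]) (labelsOf e) (labelsOf p)
      (posSum (bsPerm σ) (Equiv.refl (Fin [v].length))) := by
    refine RespectsLabels.posSum (A := bs n) (B := bs n) (fun i => ?_) (fun _ => rfl)
      (by simp [he]) (by simp [hp])
    rw [List.getElem?_map, List.getElem?_map]
    exact congrArg _ (h (i.cast (by simp)))
  have hwe : wordOf K e = bs n ++ [v] := he ▸ wordOf_eq_bs K e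
  have hwp : wordOf K p = bs n ++ [v] := hp ▸ wordOf_eq_bs K p
  have hc : RespectsColors (posSum (bsPerm σ) (Equiv.refl (Fin [v].length))) :=
    hl.respectsColors (c := labelColor) (by rw [← hwe, wordOf_eq]) (by rw [← hwp, wordOf_eq])
  have hl' : RespectsLabels (A := wordOf K e) (B := wordOf K p) (labelsOf e) (labelsOf p)
      ((finCongr (congrArg List.length hwe)).trans
        ((posSum (bsPerm σ) (Equiv.refl (Fin [v].length))).trans
          (finCongr (congrArg List.length hwp).symm))) :=
    fun i => hl (i.cast (congrArg List.length hwe))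
  have h1 : coactN K n = hwe ▸ coactDiagram K e := by subst he; exact coactN_eq K e
  have h2 : actN K n = hwp ▸ actDiagram K p := by subst hp; exact actN_eq K p
  rw [coactL_eq, actL_eq]
  refine (toHom_eq K (Eqv.comp_congr (Eqv.refl _)
    (Eqv.comp_congr (permB_tensor_idV K σ hc) (Eqv.refl _)))).trans ?_
  rw [h1, h2]
  refine (congrArg (toHom (Rel K)) (comp_perm_comp_cast K hwe hwp (coactDiagram K e)
    (actDiagram K p) _ (colors_of_labels K hl') _ hc fun _ => rfl)).trans ?_
  exact congrArg (fun f => toHom (Rel K) (coactDiagram K e) ≫ f ≫ toHom (Rel K) (actDiagram K p))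
    (labelPerm_eq K hpn hl').symm

end Concrete

end DrinfeldYetter

namespace DrinfeldYetter

/-! ## Reordering actions and coactions -/

/-- The tiles of looms without the numbers of parallel strings. -/
inductive RTile
  | cross
  | br
  | brX
  | cobr
  | cobrX
  | hor
  | ver
  | empty
  deriving DecidableEq

namespace RTile

instance : Fintype RTile where
  elems := {cross, br, brX, cobr, cobrX, hor, ver, empty}
  complete x := by cases x <;> decide

/-- Whether strings enter through the left edge. -/
def left : RTile → Bool
  | ver => false
  | empty => false
  | _ => true

/-- Whether strings leave through the right edge. -/
def right : RTile → Bool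
  | cross => true
  | cobr => true
  | cobrX => true
  | hor => true
  | _ => false

/-- Whether strings leave through the top edge. -/
def top : RTile → Bool
  | hor => false
  | empty => false
  | _ => true

/-- Whether strings enter through the bottom edge. -/
def bottom : RTile → Bool
  | cross => true
  | br => true
  | brX => true
  | ver => true
  | _ => false

/-- The sign of a tile. -/
def sign : RTile → ℤ
  | brX => -1
  | cobrX => -1
  | _ => 1

variable {ℓ : Type*}

/-- The labels of the strings entering a row through a tile in column `c`, given the labels of those
which leave the tile to the right. -/
def rowStep (t : RTile) (c : ℓ) (l : List ℓ) : List ℓ :=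
  match t with
  | cobr => c :: l
  | cobrX => l ++ [c]
  | _ => l

/-- The labels of the strings leaving a column through a tile in row `a`, given the labels of those
which enter the tile from below. -/
def colStep (t : RTile) (a : ℓ) (l : List ℓ) : List ℓ :=
  match t with
  | br => a :: l
  | brX => l ++ [a]
  | _ => l

end RTile

open RTile

section Blocks

variable {ℓ : Type*}

/-- The labels of the strings that enter a row. -/
def rowBlock : ∀ {m : ℕ}, ℓ → (Fin m → ℓ) → (Fin m → RTile) → List ℓ
  | 0, a, _, _ => [a]
  | _ + 1, a, cl, g =>
    (g 0).rowStep (cl 0) (rowBlock a (fun j => cl j.succ) fun j => g j.succ)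

/-- The labels of the strings that leave a column with label `c`. -/
def colBlock : ∀ {n : ℕ}, (Fin n → ℓ) → ℓ → (Fin n → RTile) → List ℓ
  | 0, _, c, _ => [c]
  | _ + 1, rl, c, g =>
    (g 0).colStep (rl 0) (colBlock (fun i => rl i.succ) c fun i => g i.succ)

/-- Whether the tiles of a row fit together, strings entering from the left if `h` and leaving
column `j` through the top if `v j`. -/
def RowFits : ∀ {m : ℕ}, Bool → (Fin m → Bool) → (Fin m → RTile) → Prop
  | 0, _, _, _ => True
  | _ + 1, h, v, g => (g 0).left = h ∧ (g 0).top = v 0 ∧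
    RowFits (g 0).right (fun j => v j.succ) fun j => g j.succ

/-- Whether strings leave a row to the right. -/
def rightBit : ∀ {m : ℕ}, Bool → (Fin m → RTile) → Bool
  | 0, h, _ => h
  | _ + 1, _, g => rightBit (g 0).right fun j => g j.succ

/-- Whether the tiles of a grid fit together. -/
def Fits : ∀ {n m : ℕ}, (Fin m → Bool) → (Fin n → Fin m → RTile) → Prop
  | 0, _, _, _ => True
  | _ + 1, _, v, f => RowFits true v (f 0) ∧ Fits (fun j => (f 0 j).bottom) fun i => f i.succ

/-- Whether strings enter a column from the bottom. -/
def bottomBit : ∀ {n : ℕ}, Bool → (Fin n → RTile) → Bool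
  | 0, h, _ => h
  | _ + 1, _, g => bottomBit (g 0).bottom fun i => g i.succ

/-- The labels selected by a vector of truth values. -/
def selected {m : ℕ} (v : Fin m → Bool) (cl : Fin m → ℓ) : List ℓ :=
  (List.finRange m).flatMap fun j => if v j then [cl j] else []

theorem selected_succ {m : ℕ} (v : Fin (m + 1) → Bool) (cl : Fin (m + 1) → ℓ) :
    selected v cl = (if v 0 then [cl 0] else []) ++
      selected (fun j => v j.succ) fun j => cl j.succ := by
  simp [selected, List.finRange_succ, List.flatMap_map]

theorem selected_true {m : ℕ} (cl : Fin m → ℓ) : selected (fun _ => true) cl = List.ofFn cl := by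
  simp [selected, List.ofFn_eq_map, ← List.map_eq_flatMap]

theorem extend_succ {m : ℕ} {cl : Fin (m + 1) → ℓ} (hcl : Function.Injective cl) {β : Type*}
    (T : Fin (m + 1) → β) (d : ℓ → β) {x : ℓ} (hx : x ≠ cl 0) :
    Function.extend cl T d x =
      Function.extend (fun j : Fin m => cl j.succ) (fun j : Fin m => T j.succ) d x := by
  by_cases h : ∃ j, cl j = x
  · obtain ⟨j, rfl⟩ := h
    obtain ⟨j, rfl⟩ := Fin.exists_succ_eq.2 fun h : j = 0 => hx (h ▸ rfl)
    rw [hcl.extend_apply]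
    have hcl' : Function.Injective fun j : Fin m => cl j.succ := hcl.comp (Fin.succ_injective m)
    exact (hcl'.extend_apply (fun j => T j.succ) d j).symm
  · rw [Function.extend_apply' _ _ _ h, Function.extend_apply']
    rintro ⟨j, rfl⟩
    exact h ⟨_, rfl⟩

theorem sum_fin_succ {α β : Type*} [Fintype α] [AddCommMonoid β] {m : ℕ}
    (F : (Fin (m + 1) → α) → β) :
    ∑ g, F g = ∑ t, ∑ g : Fin m → α, F (Fin.cons t g) := by
  rw [← (Fin.consEquiv fun _ => α).sum_comp, Fintype.sum_prod_type]
  rfl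

theorem sum_rTile {β : Type*} [AddCommMonoid β] (F : RTile → β) :
    ∑ t, F t = F cross + (F br + (F brX + (F cobr + (F cobrX + (F hor + (F ver + F empty)))))) := by
  have h : (Finset.univ : Finset RTile) = {cross, br, brX, cobr, cobrX, hor, ver, empty} := rfl
  rw [h]
  simp

theorem mem_rowBlock {m : ℕ} {a x : ℓ} {cl : Fin m → ℓ} {g : Fin m → RTile} :
    x ∈ rowBlock a cl g ↔ x = a ∨ ∃ j, (g j = cobr ∨ g j = cobrX) ∧ x = cl j := by
  induction m with
  | zero => simp [rowBlock]
  | succ m ih =>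
    rw [rowBlock, Fin.exists_fin_succ]
    cases h : g 0 <;> simp [rowStep, ih] <;> grind

end Blocks

/-- The relations between operators `C a`, `A a`, `M a b`, `D a b` that emit a strand `a`, absorb a
strand `a`, merge `a` into `b` and split `b` off `a`. -/
structure ArrowRelations {ℓ R : Type*} [Ring R] (C A : ℓ → R) (M D : ℓ → ℓ → R) : Prop where
  A_C : ∀ {a b}, a ≠ b → A a * C b = C b * A a + C b * M a b - D a b * A a
  M_A : ∀ {a b}, a ≠ b → M a b * A b = A b * A a - A a * A b
  C_D : ∀ {a b}, a ≠ b → C a * D a b = C a * C b - C b * C a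
  commute_M_C : ∀ {a b c}, a ≠ b → c ≠ a → c ≠ b → Commute (M a b) (C c)
  commute_M_A : ∀ {a b c}, a ≠ b → c ≠ a → c ≠ b → Commute (M a b) (A c)
  commute_D_C : ∀ {a b c}, c ≠ a → c ≠ b → Commute (D a b) (C c)
  commute_D_A : ∀ {a b c}, c ≠ a → c ≠ b → Commute (D a b) (A c)

theorem StrandCalculus.arrowRelations {𝒞 : Type*} [Category 𝒞] [Preadditive 𝒞] {ℓ : Type*}
    (X : StrandCalculus 𝒞 ℓ) : ArrowRelations X.opC X.opA X.opM X.opD where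
  A_C := opA_mul_opC
  M_A := opM_mul_opA
  C_D := opC_mul_opD
  commute_M_C := commute_opM_opC
  commute_M_A := commute_opM_opA
  commute_D_C := commute_opD_opC
  commute_D_A := commute_opD_opA

/-- The product of the values of `C` on a list. -/
def mulC {ℓ R : Type*} [Ring R] (C : ℓ → R) (l : List ℓ) : R := (l.map C).prod

/-- The product of the values of `A` on a list, in reverse order. -/
def mulA {ℓ R : Type*} [Ring R] (A : ℓ → R) (l : List ℓ) : R := (l.reverse.map A).prod

/-! ### Moving one absorption past a row of emissions. -/

section Products

variable {ℓ R : Type*} [Ring R]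

theorem mulC_append (C : ℓ → R) (l l' : List ℓ) : mulC C (l ++ l') = mulC C l * mulC C l' := by
  simp [mulC]

theorem mulC_cons (C : ℓ → R) (a : ℓ) (l : List ℓ) : mulC C (a :: l) = C a * mulC C l := by
  simp [mulC]

theorem mulA_append (A : ℓ → R) (l l' : List ℓ) : mulA A (l ++ l') = mulA A l' * mulA A l := by
  simp [mulA]

theorem mulA_cons (A : ℓ → R) (a : ℓ) (l : List ℓ) : mulA A (a :: l) = mulA A l * A a := by
  simp [mulA]

theorem commute_mulC {C : ℓ → R} {x : R} {l : List ℓ} (h : ∀ a ∈ l, Commute x (C a)) :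
    Commute x (mulC C l) :=
  Commute.list_prod_right _ _ fun y hy => by
    obtain ⟨a, ha, rfl⟩ := List.mem_map.1 hy
    exact h a ha

theorem commute_mulA {A : ℓ → R} {x : R} {l : List ℓ} (h : ∀ a ∈ l, Commute x (A a)) :
    Commute x (mulA A l) :=
  Commute.list_prod_right _ _ fun y hy => by
    obtain ⟨a, ha, rfl⟩ := List.mem_map.1 hy
    exact h a (List.mem_reverse.1 ha)

theorem flatMap_extend_of_notMem {m : ℕ} {cl : Fin m → ℓ} {T : Fin m → List ℓ} {l : List ℓ}
    (h : ∀ x ∈ l, ∀ j, cl j ≠ x) :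
    l.flatMap (Function.extend cl T fun x => [x]) = l := by
  rw [List.flatMap_congr (g := fun x => [x]) fun x hx => ?_]
  · simp
  · exact Function.extend_apply' _ _ _ fun ⟨j, hj⟩ => h x hx j hj

/-- The labels of the strings leaving a column through a row. -/
def colCell {ℓ : Type*} {m : ℕ} (a : ℓ) (cl : Fin m → ℓ) (g : Fin m → RTile) (j : Fin m) : List ℓ :=
  (g j).colStep a [cl j]

/-- The sign of a row. -/
def rowSign {m : ℕ} (g : Fin m → RTile) : ℤ := ∏ j, (g j).sign

/-- Once the strand of a row has turned upwards, the rest of the row is forced: each remaining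
column either continues vertically or is already empty. -/
theorem rowFits_false {m : ℕ} {v : Fin m → Bool} {g : Fin m → RTile} :
    RowFits false v g ↔ g = fun j => if v j then ver else empty := by
  induction m with
  | zero => exact ⟨fun _ => Subsingleton.elim _ _, fun _ => trivial⟩
  | succ m ih =>
    have h0 : ∀ t : RTile, (t.left = false ∧ t.top = v 0) ↔ t = if v 0 then ver else empty := by
      intro t
      cases v 0 <;> cases t <;> decide
    have h1 : ∀ b : Bool, (if b then ver else empty).right = false := by decide
    rw [RowFits, ← and_assoc, h0]
    constructor
    · rintro ⟨h, h'⟩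
      rw [h, h1, ih] at h'
      funext j
      refine Fin.cases h (fun j => congrFun h' j) j
    · rintro rfl
      refine ⟨rfl, ?_⟩
      dsimp only
      rw [h1, ih]

theorem rowBlock_of_left_false {m : ℕ} {a : ℓ} {v : Fin m → Bool} {cl : Fin m → ℓ} :
    rowBlock a cl (fun j => if v j then ver else empty) = [a] := by
  induction m with
  | zero => rfl
  | succ m ih =>
    rw [rowBlock, ih]
    cases v 0 <;> rfl

theorem rightBit_of_left_false {m : ℕ} {v : Fin m → Bool} :
    rightBit false (fun j => if v j then ver else empty) = false := by
  induction m with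
  | zero => rfl
  | succ m ih =>
    have h1 : ∀ b : Bool, (if b then ver else empty).right = false := by decide
    rw [rightBit, h1, ih]

variable {C A : ℓ → R} {M D : ℓ → ℓ → R}

theorem flatMap_extend_cons {m : ℕ} {cl : Fin (m + 1) → ℓ} (hcl : Function.Injective cl) {a : ℓ}
    {t : RTile} (ht : t.colStep a [cl 0] = [cl 0]) (g : Fin m → RTile) (p : List ℓ) :
    p.flatMap (Function.extend cl (colCell a cl (Fin.cons t g)) fun x => [x]) =
      p.flatMap (Function.extend (fun j => cl j.succ) (colCell a (fun j => cl j.succ) g)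
        fun x => [x]) := by
  refine List.flatMap_congr fun x _ => ?_
  by_cases hx : x = cl 0
  · subst hx
    rw [hcl.extend_apply, Function.extend_apply']
    · exact ht
    · rintro ⟨j, hj⟩
      exact Fin.succ_ne_zero j (hcl hj)
  · rw [extend_succ hcl _ _ hx]
    rfl

theorem flatMap_extend_single {m : ℕ} {cl : Fin (m + 1) → ℓ} (hcl : Function.Injective cl) {a : ℓ}
    {t : RTile} {g : Fin m → RTile} (hg : ∀ j, (g j).colStep a [cl j.succ] = [cl j.succ])
    {p₁ p₂ : List ℓ} (h₁ : cl 0 ∉ p₁) (h₂ : cl 0 ∉ p₂) :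
    (p₁ ++ cl 0 :: p₂).flatMap (Function.extend cl (colCell a cl (Fin.cons t g)) fun x => [x]) =
      p₁ ++ t.colStep a [cl 0] ++ p₂ := by
  have h : ∀ p : List ℓ, cl 0 ∉ p →
      p.flatMap (Function.extend cl (colCell a cl (Fin.cons t g)) fun x => [x]) = p := by
    intro p hp
    rw [List.flatMap_congr (g := fun x => [x]) fun x hx => ?_]
    · simp
    · by_cases h : ∃ j, cl j = x
      · obtain ⟨j, rfl⟩ := h
        obtain ⟨j, rfl⟩ := Fin.exists_succ_eq.2 fun h : j = 0 => hp (h ▸ hx)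
        rw [hcl.extend_apply]
        exact hg j
      · exact Function.extend_apply' _ _ _ h
  rw [List.flatMap_append, List.flatMap_cons, h _ h₁, h _ h₂, hcl.extend_apply, List.append_assoc]
  rfl

/-- `M a b` moves right past the absorptions of `p₂` until it meets `A b`, where the Lie action
relation applies. The two resulting orders are those of the bracket and of the crossing bracket
tile, with their signs. -/
theorem ArrowRelations.mul_mulA (H : ArrowRelations C A M D) {a b : ℓ} (hab : a ≠ b)
    {p₁ p₂ : List ℓ} (hp : ∀ x ∈ p₂, x ≠ a ∧ x ≠ b) :
    M a b * mulA A (p₁ ++ b :: p₂) =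
      mulA A (p₁ ++ [a, b] ++ p₂) - mulA A (p₁ ++ [b, a] ++ p₂) := by
  have h := commute_mulA (A := A) (l := p₂) fun x hx => H.commute_M_A hab (hp x hx).1 (hp x hx).2
  simp only [mulA_append, mulA_cons]
  rw [← mul_assoc, ← mul_assoc, h.eq, mul_assoc (mulA A p₂), H.M_A hab]
  simp only [mulA, List.reverse_nil, List.map_nil, List.prod_nil]
  noncomm_ring

/-- The mirror image: `D a b` moves left past the emissions of `u₂` until it meets `C a`, where the
Lie coaction relation applies. -/
theorem ArrowRelations.mulC_mul (H : ArrowRelations C A M D) {a b : ℓ} (hab : a ≠ b)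
    {u₁ u₂ : List ℓ} (hu : ∀ x ∈ u₂, x ≠ a ∧ x ≠ b) :
    mulC C (u₁ ++ a :: u₂) * D a b =
      mulC C (u₁ ++ [a, b] ++ u₂) - mulC C (u₁ ++ [b, a] ++ u₂) := by
  have h := commute_mulC (C := C) (l := u₂) fun x hx => H.commute_D_C (hu x hx).1 (hu x hx).2
  simp only [mulC_append, mulC_cons]
  rw [mul_assoc, mul_assoc, ← h.eq, ← mul_assoc (C a), H.C_D hab]
  simp only [mulC, List.map_nil, List.prod_nil]
  noncomm_ring

theorem count_one_split {α : Type*} [DecidableEq α] {p : List α} {c : α} (h : p.count c = 1) :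
    ∃ p₁ p₂, p = p₁ ++ c :: p₂ ∧ c ∉ p₁ ∧ c ∉ p₂ := by
  obtain ⟨s, t, rfl⟩ := List.append_of_mem (List.count_pos_iff.1 (by omega : 0 < p.count c))
  rw [List.count_append, List.count_cons_self] at h
  exact ⟨s, t, rfl, List.count_eq_zero.1 (by omega), List.count_eq_zero.1 (by omega)⟩

-- Induction on the columns, following `A a` to the right. Here `v` marks the columns whose emission
-- is still in place, and `Y` collects what stands between the emissions of `u₁ ++ a :: u₂` and `A
-- a`. An absent emission forces a horizontal tile. At an emission `C b`, the exchange term makes `C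
-- b` part of `Y` (cross). The term with `M` moves right into the absorptions and ends the row
-- (bracket, crossing bracket). The term with `D` moves left through `Y` and inserts `b` before or
-- after `a` among the emissions (cobracket, crossing cobracket). Labels of later columns are
-- inserted next to `a`, inside the earlier ones; hence the splitting of the list at `a`.
open Classical in
theorem ArrowRelations.row_expansion (H : ArrowRelations C A M D) {m : ℕ} {a : ℓ}
    {cl : Fin m → ℓ} (hcl : Function.Injective cl) (ha : ∀ j, cl j ≠ a) (v : Fin m → Bool)
    {u₁ u₂ p : List ℓ} (hu : a ∉ u₂) (hu' : ∀ j, v j → cl j ∉ u₂) (hp : a ∉ p)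
    (hp' : ∀ j, v j → p.count (cl j) = 1) {Y : R} (hY : ∀ j, Commute (D a (cl j)) Y) :
    mulC C (u₁ ++ a :: u₂) * Y * A a * mulC C (selected v cl) * mulA A p =
      ∑ g, if RowFits true v g then rowSign g •
        (mulC C (u₁ ++ rowBlock a cl g ++ u₂) * Y *
          mulC C (selected (fun j => (g j).bottom) cl) *
          mulA A (p.flatMap (Function.extend cl (colCell a cl g) fun x => [x]) ++
            if rightBit true g then [a] else [])) else 0 := by
  induction m generalizing u₁ u₂ p Y with
  | zero =>
    rw [Fintype.sum_unique]
    have h : p.flatMap (Function.extend cl (colCell a cl default) fun x => [x]) = p :=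
      flatMap_extend_of_notMem fun x _ j => j.elim0
    rw [h]
    simp [RowFits, rowSign, rowBlock, rightBit, selected, mulC, mulA, mul_assoc]
  | succ m ih =>
    have hcl' : Function.Injective fun j : Fin m => cl j.succ := hcl.comp (Fin.succ_injective m)
    have ha' : ∀ j : Fin m, cl j.succ ≠ a := fun j => ha _
    have hne : ∀ j : Fin m, cl j.succ ≠ cl 0 := fun j h => Fin.succ_ne_zero j (hcl h)
    set b := cl 0 with hb
    set F : (Fin (m + 1) → RTile) → R := fun g => if RowFits true v g then rowSign g •
        (mulC C (u₁ ++ rowBlock a cl g ++ u₂) * Y *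
          mulC C (selected (fun j => (g j).bottom) cl) *
          mulA A (p.flatMap (Function.extend cl (colCell a cl g) fun x => [x]) ++
            if rightBit true g then [a] else [])) else 0 with hF
    rw [sum_fin_succ, sum_rTile]
    have hzero : ∀ t : RTile, ¬ (t.left = true ∧ t.top = v 0) → ∑ g, F (Fin.cons t g) = 0 := by
      intro t ht
      refine Finset.sum_eq_zero fun g _ => if_neg fun h => ht ⟨h.1, h.2.1⟩
    -- Tiles that let `a` continue to the right reduce to a sum over the remaining columns, to which
    -- the induction hypothesis applies.
    have hpass : ∀ t : RTile, t.left = true → t.top = v 0 → t.right = true →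
        t.colStep a [b] = [b] → ∑ g, F (Fin.cons t g) = t.sign •
          ∑ g : Fin m → RTile, if RowFits true (fun j => v j.succ) g then rowSign g •
            (mulC C (u₁ ++ t.rowStep b (rowBlock a (fun j => cl j.succ) g) ++ u₂) *
              (Y * if t.bottom then C b else 1) *
              mulC C (selected (fun j => (g j).bottom) fun j => cl j.succ) *
              mulA A (p.flatMap (Function.extend (fun j => cl j.succ)
                (colCell a (fun j => cl j.succ) g) fun x => [x]) ++
                if rightBit true g then [a] else [])) else 0 := by
      intro t h1 h2 h3 h4
      rw [Finset.smul_sum]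
      refine Finset.sum_congr rfl fun g _ => ?_
      have e1 : RowFits true v (Fin.cons t g) ↔ RowFits true (fun j => v j.succ) g := by
        simp [RowFits, h1, h2, h3]
      have e2 : rightBit true (Fin.cons t g : Fin (m + 1) → RTile) = rightBit true g := by
        simp [rightBit, h3]
      have e3 : mulC C (selected (fun j => ((Fin.cons t g : Fin (m + 1) → RTile) j).bottom) cl) =
          (if t.bottom then C b else 1) *
            mulC C (selected (fun j => (g j).bottom) fun j => cl j.succ) := by
        rw [selected_succ, mulC_append]
        cases h : t.bottom <;> simp [mulC, h, hb]
      have e4 : rowSign (Fin.cons t g : Fin (m + 1) → RTile) = t.sign * rowSign g := by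
        simp [rowSign, Fin.prod_univ_succ]
      have e5 : rowBlock a cl (Fin.cons t g) =
          t.rowStep b (rowBlock a (fun j => cl j.succ) g) := rfl
      simp only [hF, e1, e2, e3, e4, e5, flatMap_extend_cons hcl h4]
      by_cases h : RowFits true (fun j => v j.succ) g
      · rw [if_pos h, if_pos h, mul_smul]
        simp only [mul_assoc]
      · rw [if_neg h, if_neg h, smul_zero]
    cases hv : v 0 with
    | false =>
      have hs : selected v cl = selected (fun j => v j.succ) fun j => cl j.succ := by
        rw [selected_succ, hv]
        rfl
      rw [hpass hor rfl hv.symm rfl rfl, hzero, hzero, hzero, hzero, hzero, hzero, hzero, hs,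
        ih hcl' ha' _ hu (fun j => hu' _) hp (fun j => hp' _) fun j => hY _]
      · simp [RTile.sign, RTile.rowStep, RTile.bottom]
      all_goals rw [hv]; decide
    | true =>
      have hba : b ≠ a := ha 0
      obtain ⟨p₁, p₂, hp12, hp1, hp2⟩ := count_one_split (hp' 0 hv)
      have hs : selected v cl = b :: selected (fun j => v j.succ) fun j => cl j.succ := by
        rw [selected_succ, hv]
        rfl
      -- Tiles at which `a` turns upwards leave one single filling of the remaining columns.
      have hturn : ∀ t : RTile, t.left = true → t.top = true → t.right = false →
          t.bottom = true → (∀ l : List ℓ, t.rowStep b l = l) →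
          ∑ g, F (Fin.cons t g) = t.sign • (mulC C (u₁ ++ a :: u₂) * Y * (C b *
            mulC C (selected (fun j => v j.succ) fun j => cl j.succ)) *
            mulA A (p₁ ++ t.colStep a [b] ++ p₂)) := by
        intro t h1 h2 h3 h4 h5
        rw [Finset.sum_eq_single fun j => if v j.succ then ver else empty]
        · have e1 : RowFits true v (Fin.cons t fun j => if v j.succ then ver else empty) :=
            ⟨h1, h2.trans hv.symm, by
              change RowFits t.right _ _
              rw [h3]
              exact rowFits_false.2 rfl⟩
          have e2 : rightBit true (Fin.cons t (fun j => if v j.succ then ver else empty) :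
              Fin (m + 1) → RTile) = false := by
            change rightBit t.right _ = _
            rw [h3]
            exact rightBit_of_left_false
          have e3 : selected (fun j => ((Fin.cons t fun j => if v j.succ then ver else empty :
              Fin (m + 1) → RTile) j).bottom) cl =
              b :: selected (fun j => v j.succ) fun j => cl j.succ := by
            rw [selected_succ, Fin.cons_zero, h4, if_pos rfl]
            refine congrArg (fun w => [cl 0] ++ selected w _) (funext fun j => ?_)
            rw [Fin.cons_succ]
            cases v j.succ <;> rfl
          have e4 : rowSign (Fin.cons t fun j => if v j.succ then ver else empty :
              Fin (m + 1) → RTile) = t.sign := by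
            rw [rowSign, Fin.prod_univ_succ, Fin.cons_zero, Finset.prod_eq_one, mul_one]
            intro j _
            rw [Fin.cons_succ]
            cases v j.succ <;> rfl
          have e5 : rowBlock a cl (Fin.cons t fun j => if v j.succ then ver else empty) = [a] := by
            change t.rowStep b (rowBlock a _ fun j => if v j.succ then ver else empty) = _
            rw [rowBlock_of_left_false, h5]
          rw [hF]
          dsimp only
          rw [if_pos e1, e2, e3, e4, e5, hp12, flatMap_extend_single hcl _ hp1 hp2, mulC_cons]
          · simp [← hb]
          · intro j
            cases v j.succ <;> rfl
        · intro g _ hg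
          refine if_neg fun h => hg (rowFits_false.1 ?_)
          have := h.2.2
          rwa [Fin.cons_zero, h3] at this
        · simp
      have hY' : ∀ j : Fin m, Commute (D a (cl j.succ)) (Y * C b) := fun j =>
        (hY _).mul_right (H.commute_D_C hba (hne j).symm)
      have hM : ∀ x ∈ p₂, x ≠ a ∧ x ≠ b := fun x hx =>
        ⟨fun h => hp (by rw [hp12, ← h]; simp [hx]), fun h => hp2 (by rw [← hb, ← h]; exact hx)⟩
      have hD : ∀ x ∈ u₂, x ≠ a ∧ x ≠ b := fun x hx =>
        ⟨fun h => hu (h ▸ hx), fun h => hu' 0 hv (by rw [← hb, ← h]; exact hx)⟩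
      have hMC : Commute (M a b) (mulC C (selected (fun j => v j.succ) fun j => cl j.succ)) := by
        refine commute_mulC fun x hx => ?_
        obtain ⟨j, -, hj⟩ := List.mem_flatMap.1 hx
        have hj' : x = cl j.succ := by
          cases h : v j.succ <;> simp [h] at hj
          exact hj
        subst hj'
        exact H.commute_M_C hba.symm (ha' j) (hne j)
      rw [hpass cross rfl hv.symm rfl rfl, hpass cobr rfl hv.symm rfl rfl,
        hpass cobrX rfl hv.symm rfl rfl, hturn br rfl rfl rfl rfl fun _ => rfl,
        hturn brX rfl rfl rfl rfl fun _ => rfl, hzero hor (by rw [hv]; decide),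
        hzero ver (by rw [hv]; decide), hzero empty (by rw [hv]; decide)]
      -- The induction hypothesis for the cross, cobracket and crossing cobracket tiles: `C b` is
      -- appended to `Y`, or `b` is placed just before `a`, or just after `a`.
      have i1 := ih (u₁ := u₁) (u₂ := u₂) hcl' ha' (fun j => v j.succ) hu (fun j => hu' _) hp
        (fun j => hp' _) hY'
      have i2 := ih (u₁ := u₁ ++ [b]) (u₂ := u₂) hcl' ha' (fun j => v j.succ) hu (fun j => hu' _) hp
        (fun j => hp' _) (fun j => hY j.succ)
      have i3 := ih (u₁ := u₁) (u₂ := b :: u₂) hcl' ha' (fun j => v j.succ) (by simp [hu, hba.symm])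
        (fun j hj => by simp [hne j, hu' _ hj]) hp (fun j => hp' _) (fun j => hY j.succ)
      simp only [RTile.sign, RTile.rowStep, RTile.bottom, if_true, Bool.false_eq_true, if_false,
        mul_one, one_smul, neg_smul, RTile.colStep] at i1 i2 i3 ⊢
      simp only [List.append_assoc, List.cons_append, List.nil_append] at i1 i2 i3 ⊢
      rw [← i1, ← i2, ← i3, hs, mulC_cons]
      have k1 := H.mul_mulA hba.symm (p₁ := p₁) hM
      have k2 := H.mulC_mul hba.symm (u₁ := u₁) hD
      rw [← hb, ← hp12] at *
      simp only [List.append_assoc, List.cons_append, List.nil_append] at k1 k2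
      generalize mulC C (selected (fun j => v j.succ) fun j => cl j.succ) = S at *
      -- After `A_C`, the operator `M a b` is carried right past the later emissions and `D a b`
      -- left past `Y`; then `k1` and `k2` resolve them.
      calc _ = mulC C (u₁ ++ a :: u₂) * Y * (A a * C b) * S * mulA A p := by noncomm_ring
        _ = mulC C (u₁ ++ a :: u₂) * Y * C b * A a * S * mulA A p +
            mulC C (u₁ ++ a :: u₂) * Y * C b * (M a b * S) * mulA A p -
            mulC C (u₁ ++ a :: u₂) * (Y * D a b) * A a * S * mulA A p := by
          rw [H.A_C hba.symm]
          noncomm_ring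
        _ = mulC C (u₁ ++ a :: u₂) * Y * C b * A a * S * mulA A p +
            mulC C (u₁ ++ a :: u₂) * Y * C b * S * (M a b * mulA A p) -
            mulC C (u₁ ++ a :: u₂) * D a b * Y * A a * S * mulA A p := by
          rw [hMC.eq, ← (hY 0).eq]
          noncomm_ring
        _ = _ := by
          rw [k1, k2]
          noncomm_ring

end Products

/-! ### Moving all absorptions past all emissions. -/

section Filling

variable {ℓ R : Type*} [Ring R]

theorem RowFits.top_eq {m : ℕ} {h : Bool} {v : Fin m → Bool} {g : Fin m → RTile}
    (H : RowFits h v g) (j : Fin m) : (g j).top = v j := by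
  induction m generalizing h with
  | zero => exact j.elim0
  | succ m ih => exact Fin.cases H.2.1 (fun j => ih H.2.2 j) j

theorem mem_colStep {t : RTile} {a b x : ℓ} (hx : x ∈ t.colStep a [b]) : x = a ∨ x = b := by
  cases t <;> simp [colStep] at hx <;> tauto

open Classical in
theorem count_colStep {t : RTile} {a b x : ℓ} (hx : x ≠ a) :
    (t.colStep a [b]).count x = [b].count x := by
  cases t <;> simp [colStep, List.count_cons, hx.symm]

theorem mem_flatMap_colCell {m : ℕ} {a x : ℓ} {cl : Fin m → ℓ} (hcl : Function.Injective cl)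
    {g : Fin m → RTile} {p : List ℓ}
    (hx : x ∈ p.flatMap (Function.extend cl (colCell a cl g) fun x => [x])) :
    x ∈ p ∨ x = a := by
  obtain ⟨y, hy, hx⟩ := List.mem_flatMap.1 hx
  by_cases h : ∃ j, cl j = y
  · obtain ⟨j, rfl⟩ := h
    rw [hcl.extend_apply] at hx
    obtain rfl | rfl := mem_colStep hx
    · exact Or.inr rfl
    · exact Or.inl hy
  · rw [Function.extend_apply' _ _ _ h, List.mem_singleton] at hx
    exact Or.inl (hx ▸ hy)

open Classical in
theorem count_flatMap_colCell {m : ℕ} {a x : ℓ} {cl : Fin m → ℓ} (hcl : Function.Injective cl)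
    {g : Fin m → RTile} {p : List ℓ} (hx : x ≠ a) :
    (p.flatMap (Function.extend cl (colCell a cl g) fun x => [x])).count x = p.count x := by
  induction p with
  | nil => rfl
  | cons y p ih =>
    rw [List.flatMap_cons, List.count_append, ih, ← List.singleton_append, List.count_append]
    congr 1
    by_cases h : ∃ j, cl j = y
    · obtain ⟨j, rfl⟩ := h
      rw [hcl.extend_apply]
      exact count_colStep hx
    · rw [Function.extend_apply' _ _ _ h]

/-- The lower rows insert their labels next to the label of the column, inside what the top row has
put there. The label `a` is not that of a column and is left alone. -/
theorem flatMap_colCell_colBlock {n m : ℕ} {rl : Fin n → ℓ} {a : ℓ} {cl : Fin m → ℓ}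
    (hcl : Function.Injective cl) (ha : ∀ j, cl j ≠ a) (g : Fin m → RTile)
    (f : Fin n → Fin m → RTile) (p : List ℓ) :
    (p.flatMap (Function.extend cl (colCell a cl g) fun x => [x])).flatMap
        (Function.extend cl (fun j => colBlock rl (cl j) fun i => f i j) fun x => [x]) =
      p.flatMap (Function.extend cl
        (fun j => (g j).colStep a (colBlock rl (cl j) fun i => f i j)) fun x => [x]) := by
  rw [List.flatMap_assoc]
  refine List.flatMap_congr fun x _ => ?_
  have ha' : Function.extend cl (fun j => colBlock rl (cl j) fun i => f i j) (fun x => [x]) a =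
      [a] := Function.extend_apply' _ _ _ fun ⟨j, hj⟩ => ha j hj
  by_cases h : ∃ j, cl j = x
  · obtain ⟨j, rfl⟩ := h
    rw [hcl.extend_apply, hcl.extend_apply, colCell]
    cases g j <;> simp [colStep, ha', hcl.extend_apply]
  · rw [Function.extend_apply' _ _ _ h, Function.extend_apply' _ _ _ h]
    simp [Function.extend_apply' _ _ _ h]

variable {C A : ℓ → R} {M D : ℓ → ℓ → R}

open Classical in
/-- Moving absorptions past emissions expands into a sum over all fillings of a grid. -/
theorem ArrowRelations.fill_expansion (H : ArrowRelations C A M D) {n m : ℕ} {rl : Fin n → ℓ}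
    {cl : Fin m → ℓ} (hrl : Function.Injective rl) (hcl : Function.Injective cl)
    (hrc : ∀ i j, cl j ≠ rl i) (v : Fin m → Bool) {u p : List ℓ}
    (hu : ∀ i, u.count (rl i) = 1) (hu' : ∀ j, v j → cl j ∉ u) (hp : ∀ i, rl i ∉ p)
    (hp' : ∀ j, v j → p.count (cl j) = 1) :
    mulC C u * mulA A (List.ofFn rl) * mulC C (selected v cl) * mulA A p =
      ∑ f : Fin n → Fin m → RTile, if Fits v f then (∏ i, rowSign (f i)) •
        (mulC C (u.flatMap (Function.extend rl (fun i => rowBlock (rl i) cl (f i)) fun x => [x]) ++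
            selected (fun j => bottomBit (v j) fun i => f i j) cl) *
          mulA A (p.flatMap (Function.extend cl (fun j => colBlock rl (cl j) fun i => f i j)
              fun x => [x]) ++
            selected (fun i => rightBit true (f i)) rl)) else 0 := by
  induction n generalizing v u p with
  | zero =>
    have hv : Fits v (default : Fin 0 → Fin m → RTile) := trivial
    rw [Fintype.sum_unique, if_pos hv]
    have h1 : u.flatMap (Function.extend rl (fun i => rowBlock (rl i) cl
        ((default : Fin 0 → Fin m → RTile) i)) fun x => [x]) = u :=
      flatMap_extend_of_notMem fun x _ j => j.elim0
    have h2 : p.flatMap (Function.extend cl (fun j => colBlock rl (cl j) fun i =>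
        (default : Fin 0 → Fin m → RTile) i j) fun x => [x]) = p := by
      rw [List.flatMap_congr (g := fun x => [x]) fun x hx => ?_]
      · simp
      · by_cases h : ∃ j, cl j = x
        · obtain ⟨j, rfl⟩ := h
          rw [hcl.extend_apply]
          rfl
        · exact Function.extend_apply' _ _ _ h
    have h3 : ∀ w, selected w rl = [] := fun w => by simp [selected]
    rw [h1, h2, h3, List.append_nil, mulC_append]
    simp only [Finset.univ_eq_empty, Finset.prod_empty, one_smul, bottomBit]
    simp [mulA, mul_assoc]
  | succ n ih =>
    have hrl' : Function.Injective fun i : Fin n => rl i.succ := hrl.comp (Fin.succ_injective n)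
    have hne : ∀ i : Fin n, rl i.succ ≠ rl 0 := fun i h => Fin.succ_ne_zero i (hrl h)
    obtain ⟨u₁, u₂, rfl, hu1, hu2⟩ := count_one_split (hu 0)
    -- As `mulA` reverses the order, the absorption of the top row is the one next to the emissions
    -- and moves first; those of the other rows make up `Y`.
    have hY : ∀ j, Commute (D (rl 0) (cl j)) (mulA A (List.ofFn fun i : Fin n => rl i.succ)) := by
      refine fun j => commute_mulA fun x hx => ?_
      obtain ⟨i, rfl⟩ := (List.mem_ofFn' _ _).1 hx
      exact H.commute_D_A (hne i) (hrc _ _).symm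
    have h0 := H.row_expansion hcl (hrc 0) v (u₁ := u₁) hu2
      (fun j hj h => hu' j hj (by simp [h])) (hp 0) hp' hY
    rw [List.ofFn_succ, mulA_cons, ← mul_assoc, h0, sum_fin_succ]
    refine Finset.sum_congr rfl fun g _ => ?_
    have hfits : ∀ f : Fin n → Fin m → RTile,
        Fits v (Fin.cons g f : Fin (n + 1) → Fin m → RTile) ↔
          RowFits true v g ∧ Fits (fun j => (g j).bottom) f := fun f => Iff.rfl
    by_cases hg : RowFits true v g
    swap
    · simp [hfits, hg]
    rw [if_pos hg]
    -- An emission that remains after the top row was there before it, so the conditions on the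
    -- marked columns pass on to the other rows.
    have hv : ∀ j, (g j).bottom = true → v j = true := by
      intro j
      rw [← hg.top_eq j]
      cases g j <;> decide
    rw [ih hrl' (fun i j => hrc _ _), Finset.smul_sum]
    · refine Finset.sum_congr rfl fun f _ => ?_
      simp only [hfits, hg, true_and]
      by_cases hf : Fits (fun j => (g j).bottom) f
      swap
      · simp [hf]
      rw [if_pos hf, if_pos hf, smul_smul]
      have e1 : (∏ i, rowSign ((Fin.cons g f : Fin (n + 1) → Fin m → RTile) i)) =
          rowSign g * ∏ i, rowSign (f i) := by
        rw [Fin.prod_univ_succ]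
        rfl
      have e2 : (u₁ ++ rl 0 :: u₂).flatMap (Function.extend rl (fun i => rowBlock (rl i) cl
            ((Fin.cons g f : Fin (n + 1) → Fin m → RTile) i)) fun x => [x]) =
          (u₁ ++ rowBlock (rl 0) cl g ++ u₂).flatMap (Function.extend (fun i => rl i.succ)
            (fun i => rowBlock (rl i.succ) cl (f i)) fun x => [x]) := by
        simp only [List.flatMap_append, List.flatMap_cons, List.append_assoc]
        have hb : (rowBlock (rl 0) cl g).flatMap (Function.extend (fun i => rl i.succ)
            (fun i => rowBlock (rl i.succ) cl (f i)) fun x => [x]) = rowBlock (rl 0) cl g := by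
          refine flatMap_extend_of_notMem fun x hx i h => ?_
          obtain rfl | ⟨j, -, rfl⟩ := mem_rowBlock.1 hx
          · exact hne i h
          · exact hrc _ _ h.symm
        rw [hb, hrl.extend_apply]
        congr 1
        · refine List.flatMap_congr fun x hx => ?_
          exact extend_succ hrl _ _ fun h => hu1 (h ▸ hx)
        · congr 1
          refine List.flatMap_congr fun x hx => ?_
          exact extend_succ hrl _ _ fun h => hu2 (h ▸ hx)
      -- If the absorption of the top row survives, it stands to the left of `mulA A p`, that is at
      -- the end of the list, and so ahead of the surviving labels of the lower rows.
      have e3 : (p.flatMap (Function.extend cl (colCell (rl 0) cl g) fun x => [x]) ++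
            if rightBit true g then [rl 0] else []).flatMap
            (Function.extend cl (fun j => colBlock (fun i : Fin n => rl i.succ) (cl j) fun i => f i j)
              fun x => [x]) ++ selected (fun i => rightBit true (f i)) (fun i => rl i.succ) =
          p.flatMap (Function.extend cl (fun j => colBlock rl (cl j)
            fun i => (Fin.cons g f : Fin (n + 1) → Fin m → RTile) i j) fun x => [x]) ++
            selected (fun i => rightBit true
              ((Fin.cons g f : Fin (n + 1) → Fin m → RTile) i)) rl := by
        rw [List.flatMap_append, flatMap_colCell_colBlock hcl (hrc 0), selected_succ,
          List.append_assoc]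
        have ha : Function.extend cl (fun j => colBlock (fun i : Fin n => rl i.succ) (cl j)
            fun i => f i j) (fun x => [x]) (rl 0) = [rl 0] :=
          Function.extend_apply' _ _ _ fun ⟨j, hj⟩ => hrc _ _ hj
        congr 2
        cases h : rightBit true g <;> simp [ha, h]
      rw [e1, e2, ← e3]
      rfl
    · intro i
      have : rl i.succ ∉ rowBlock (rl 0) cl g := fun hx => by
        obtain h | ⟨j, -, h⟩ := mem_rowBlock.1 hx
        · exact hne i h
        · exact hrc _ _ h.symm
      have h := hu i.succ
      rw [List.count_append, List.count_cons_of_ne (hne i).symm] at h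
      rw [List.count_append, List.count_append, List.count_eq_zero.2 this, add_zero, h]
    · intro j hj hx
      rw [List.append_assoc, List.mem_append, List.mem_append] at hx
      have h := hu' j (hv j hj)
      obtain hx | hx | hx := hx
      · exact h (by simp [hx])
      · obtain h | ⟨j', h', h⟩ := mem_rowBlock.1 hx
        · exact hrc _ _ h
        · obtain rfl := hcl h
          obtain h' | h' := h' <;> simp [h', RTile.bottom] at hj
      · exact h (by simp [hx])
    · intro i hx
      rw [List.mem_append] at hx
      obtain hx | hx := hx
      · obtain h | h := mem_flatMap_colCell hcl hx
        · exact hp _ h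
        · exact hne i h
      · split_ifs at hx <;> simp [hne i] at hx
    · intro j hj
      rw [List.count_append, count_flatMap_colCell hcl (hrc _ _), hp' j (hv j hj)]
      split_ifs <;> simp [(hrc 0 j).symm]

end Filling

/-! ## Looms as fillings of the grid -/

/-! ### Labels of the strings inside a row or a column. -/

section Labels

variable {ℓ : Type*}

/-- The labels of the strings at the left edge of each column of a row. -/
def rowLabels : ∀ {m : ℕ}, ℓ → (Fin m → ℓ) → (Fin m → RTile) → ℕ → List ℓ
  | _, a, cl, g, 0 => rowBlock a cl g
  | 0, a, _, _, _ + 1 => [a]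
  | _ + 1, a, cl, g, j + 1 => rowLabels a (fun j => cl j.succ) (fun j => g j.succ) j

/-- The labels of the strings at the top edge of each row of a column. -/
def colLabels : ∀ {n : ℕ}, (Fin n → ℓ) → ℓ → (Fin n → RTile) → ℕ → List ℓ
  | _, rl, c, g, 0 => colBlock rl c g
  | 0, _, c, _, _ + 1 => [c]
  | _ + 1, rl, c, g, i + 1 => colLabels (fun i => rl i.succ) c (fun i => g i.succ) i

theorem rowLabels_zero {m : ℕ} (a : ℓ) (cl : Fin m → ℓ) (g : Fin m → RTile) :
    rowLabels a cl g 0 = rowBlock a cl g := by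
  cases m <;> rfl

theorem colLabels_zero {n : ℕ} (rl : Fin n → ℓ) (c : ℓ) (g : Fin n → RTile) :
    colLabels rl c g 0 = colBlock rl c g := by
  cases n <;> rfl

theorem rowLabels_self {m : ℕ} (a : ℓ) (cl : Fin m → ℓ) (g : Fin m → RTile) :
    rowLabels a cl g m = [a] := by
  induction m with
  | zero => rfl
  | succ m ih => exact ih _ _

theorem colLabels_self {n : ℕ} (rl : Fin n → ℓ) (c : ℓ) (g : Fin n → RTile) :
    colLabels rl c g n = [c] := by
  induction n with
  | zero => rfl
  | succ n ih => exact ih _ _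

theorem rowLabels_eq {m : ℕ} (a : ℓ) (cl : Fin m → ℓ) (g : Fin m → RTile) (j : Fin m) :
    rowLabels a cl g j = (g j).rowStep (cl j) (rowLabels a cl g (j + 1)) := by
  induction m with
  | zero => exact j.elim0
  | succ m ih =>
    refine Fin.cases ?_ (fun j => ih _ _ j) j
    change rowBlock a cl g = (g 0).rowStep _ (rowLabels a _ _ 0)
    rw [rowLabels_zero]
    rfl

theorem colLabels_eq {n : ℕ} (rl : Fin n → ℓ) (c : ℓ) (g : Fin n → RTile) (i : Fin n) :
    colLabels rl c g i = (g i).colStep (rl i) (colLabels rl c g (i + 1)) := by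
  induction n with
  | zero => exact i.elim0
  | succ n ih =>
    refine Fin.cases ?_ (fun i => ih _ _ i) i
    change colBlock rl c g = (g 0).colStep _ (colLabels _ c _ 0)
    rw [colLabels_zero]
    rfl

theorem mem_colBlock {n : ℕ} {c x : ℓ} {rl : Fin n → ℓ} {g : Fin n → RTile} :
    x ∈ colBlock rl c g ↔ x = c ∨ ∃ i, (g i = br ∨ g i = brX) ∧ x = rl i := by
  induction n with
  | zero => simp [colBlock]
  | succ n ih =>
    rw [colBlock, Fin.exists_fin_succ]
    cases h : g 0 <;> simp [colStep, ih] <;> grind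

/-- Induction from the last position of a row down to the first. -/
theorem fin_downward {m : ℕ} {P : ℕ → Prop} (hm : P m) (h : ∀ j : Fin m, P (j + 1) → P j) {j : ℕ}
    (hj : j ≤ m) : P j :=
  Nat.decreasingInduction (motive := fun j _ => P j) (fun j hj => h ⟨j, hj⟩) hm hj

theorem mem_rowLabels {m : ℕ} (a : ℓ) (cl : Fin m → ℓ) (g : Fin m → RTile) {j : ℕ} (hj : j ≤ m) :
    a ∈ rowLabels a cl g j := by
  refine fin_downward (P := fun j => a ∈ rowLabels a cl g j) (by simp [rowLabels_self])
    (fun j hj => ?_) hj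
  rw [rowLabels_eq]
  cases g j <;> simp [rowStep, hj]

theorem mem_colLabels {n : ℕ} (rl : Fin n → ℓ) (c : ℓ) (g : Fin n → RTile) {i : ℕ} (hi : i ≤ n) :
    c ∈ colLabels rl c g i := by
  refine fin_downward (P := fun i => c ∈ colLabels rl c g i) (by simp [colLabels_self])
    (fun i hi => ?_) hi
  rw [colLabels_eq]
  cases g i <;> simp [colStep, hi]

theorem length_rowStep_le (t : RTile) (c : ℓ) (l : List ℓ) :
    (t.rowStep c l).length ≤ l.length + 1 := by
  cases t <;> simp [rowStep]

theorem length_colStep_le (t : RTile) (a : ℓ) (l : List ℓ) :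
    (t.colStep a l).length ≤ l.length + 1 := by
  cases t <;> simp [colStep]

/-- This bound, with its analogue for columns, makes the numbers of parallel strings fit into the
parameters of the tiles in `fill`. -/
theorem length_rowLabels_le {m : ℕ} (a : ℓ) (cl : Fin m → ℓ) (g : Fin m → RTile) {j : ℕ}
    (hj : j ≤ m) : (rowLabels a cl g j).length + j ≤ m + 1 := by
  refine fin_downward (P := fun j => (rowLabels a cl g j).length + j ≤ m + 1)
    (by simp [rowLabels_self, add_comm]) (fun j hj => ?_) hj
  rw [rowLabels_eq]
  have := length_rowStep_le (g j) (cl j) (rowLabels a cl g (j + 1))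
  omega

theorem length_colLabels_le {n : ℕ} (rl : Fin n → ℓ) (c : ℓ) (g : Fin n → RTile) {i : ℕ}
    (hi : i ≤ n) : (colLabels rl c g i).length + i ≤ n + 1 := by
  refine fin_downward (P := fun i => (colLabels rl c g i).length + i ≤ n + 1)
    (by simp [colLabels_self, add_comm]) (fun i hi => ?_) hi
  rw [colLabels_eq]
  have := length_colStep_le (g i) (rl i) (colLabels rl c g (i + 1))
  omega

end Labels

/-- The number of strings leaving a tile to the top that enter it from the left above or below other
strings. -/
def RTile.cobrNum (t : RTile) : ℕ := if t = cobr ∨ t = cobrX then 1 else 0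

/-- The number of strings turning to the top at a tile next to vertical strings. -/
def RTile.brNum (t : RTile) : ℕ := if t = br ∨ t = brX then 1 else 0

/-- Going up a column, strings appear only at the bottom border or at a tile of cobracket type.
Dually, a row stops being occupied only at a tile of bracket type. Telescoping turns this into
counts of such tiles. -/
theorem RTile.top_toNat (t : RTile) : t.top.toNat = t.bottom.toNat + t.cobrNum := by
  cases t <;> rfl

theorem RTile.left_toNat (t : RTile) : t.left.toNat = t.right.toNat + t.brNum := by
  cases t <;> rfl

theorem telescope {n : ℕ} {x : ℕ → ℕ} {c : Fin n → ℕ} (h : ∀ i : Fin n, x i = x (i + 1) + c i) :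
    x 0 = x n + ∑ i, c i := by
  induction n with
  | zero => simp
  | succ n ih =>
    rw [ih (c := fun i => c i.castSucc) fun i => h i.castSucc, Fin.sum_univ_castSucc]
    have := h (Fin.last n)
    simp only [Fin.val_last] at this
    omega

theorem length_rowLabels_eq {ℓ : Type*} {m : ℕ} (a : ℓ) (cl : Fin m → ℓ) (g : Fin m → RTile)
    (j : Fin m) :
    (rowLabels a cl g j).length = (rowLabels a cl g (j + 1)).length + (g j).cobrNum := by
  rw [rowLabels_eq]
  cases g j <;> simp [rowStep, cobrNum]

theorem length_colLabels_eq {ℓ : Type*} {n : ℕ} (rl : Fin n → ℓ) (c : ℓ) (g : Fin n → RTile)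
    (i : Fin n) :
    (colLabels rl c g i).length = (colLabels rl c g (i + 1)).length + (g i).brNum := by
  rw [colLabels_eq]
  cases g i <;> simp [colStep, brNum]

theorem length_rowLabels_zero {ℓ : Type*} {m : ℕ} (a : ℓ) (cl : Fin m → ℓ) (g : Fin m → RTile) :
    (rowLabels a cl g 0).length = 1 + ∑ j, (g j).cobrNum := by
  simpa [rowLabels_self] using telescope (x := fun j => (rowLabels a cl g j).length)
    (length_rowLabels_eq a cl g)

theorem length_colLabels_zero {ℓ : Type*} {n : ℕ} (rl : Fin n → ℓ) (c : ℓ) (g : Fin n → RTile) :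
    (colLabels rl c g 0).length = 1 + ∑ i, (g i).brNum := by
  simpa [colLabels_self] using telescope (x := fun i => (colLabels rl c g i).length)
    (length_colLabels_eq rl c g)

/-- The functions `H` and `V` tell on which vertical and horizontal edges of the grid the filling `f`
has strings. -/
structure Occupies {n m : ℕ} (f : Fin n → Fin m → RTile) (H : Fin n → ℕ → Bool)
    (V : ℕ → Fin m → Bool) : Prop where
  left : ∀ i (j : Fin m), (f i j).left = H i j
  right : ∀ i (j : Fin m), (f i j).right = H i (j + 1)
  top : ∀ (i : Fin n) j, (f i j).top = V i j
  bottom : ∀ (i : Fin n) j, (f i j).bottom = V (i + 1) j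

theorem rowFits_iff {m : ℕ} {h : Bool} {v : Fin m → Bool} {g : Fin m → RTile} :
    RowFits h v g ↔ ∃ H : ℕ → Bool, H 0 = h ∧
      ∀ j : Fin m, (g j).left = H j ∧ (g j).right = H (j + 1) ∧ (g j).top = v j := by
  induction m generalizing h with
  | zero => exact ⟨fun _ => ⟨fun _ => h, rfl, fun j => j.elim0⟩, fun _ => trivial⟩
  | succ m ih =>
    rw [RowFits, ih]
    constructor
    · rintro ⟨h1, h2, H, hH, h3⟩
      refine ⟨fun j => Nat.casesOn j h H, rfl, Fin.cases ⟨h1, hH.symm, h2⟩ h3⟩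
    · rintro ⟨H, rfl, h3⟩
      exact ⟨(h3 0).1, (h3 0).2.2, fun j => H (j + 1), (h3 0).2.1.symm, fun j => h3 j.succ⟩

theorem rightBit_eq {m : ℕ} {g : Fin m → RTile} {H : ℕ → Bool}
    (h : ∀ j : Fin m, (g j).right = H (j + 1)) : rightBit (H 0) g = H m := by
  induction m generalizing H with
  | zero => rfl
  | succ m ih =>
    rw [rightBit, h 0]
    exact ih (H := fun j => H (j + 1)) fun j => h j.succ

theorem bottomBit_eq {n : ℕ} {g : Fin n → RTile} {V : ℕ → Bool}
    (h : ∀ i : Fin n, (g i).bottom = V (i + 1)) : bottomBit (V 0) g = V n := by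
  induction n generalizing V with
  | zero => rfl
  | succ n ih =>
    rw [bottomBit, h 0]
    exact ih (V := fun i => V (i + 1)) fun i => h i.succ

/-- Replaces the row-by-row recursion by the matching of tiles along common edges, which is how
looms are defined and which treats rows and columns alike. -/
theorem fits_iff {n m : ℕ} {v : Fin m → Bool} {f : Fin n → Fin m → RTile} :
    Fits v f ↔ ∃ H V, Occupies f H V ∧ (∀ i, H i 0 = true) ∧ V 0 = v := by
  induction n generalizing v with
  | zero =>
    exact ⟨fun _ => ⟨fun i => i.elim0, fun _ => v, ⟨fun i => i.elim0, fun i => i.elim0,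
      fun i => i.elim0, fun i => i.elim0⟩, fun i => i.elim0, rfl⟩, fun _ => trivial⟩
  | succ n ih =>
    rw [Fits, ih, rowFits_iff]
    constructor
    · rintro ⟨⟨H₀, h0, h1⟩, H, V, hO, hH, hV⟩
      refine ⟨Fin.cons H₀ H, fun i => Nat.casesOn i v V, ⟨?_, ?_, ?_, ?_⟩, ?_, rfl⟩
      · exact Fin.cases (fun j => (h1 j).1) hO.left
      · exact Fin.cases (fun j => (h1 j).2.1) hO.right
      · exact Fin.cases (fun j => (h1 j).2.2) hO.top
      · exact Fin.cases (fun j => (congrFun hV j).symm) hO.bottom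
      · exact Fin.cases h0 hH
    · rintro ⟨H, V, hO, hH, rfl⟩
      exact ⟨⟨H 0, hH 0, fun j => ⟨hO.left 0 j, hO.right 0 j, hO.top 0 j⟩⟩, fun i => H i.succ,
        fun i => V (i + 1), ⟨fun i => hO.left i.succ, fun i => hO.right i.succ,
          fun i => hO.top i.succ, fun i => hO.bottom i.succ⟩, fun i => hH _,
        funext fun j => (hO.bottom 0 j).symm⟩

/-! ### A loom is determined by the shapes of its tiles. -/

section Shapes

variable {n m : ℕ}

/-- A tile without its numbers of parallel strings. -/
def Tile.shape : Tile n m → RTile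
  | .cross _ _ => .cross
  | .bracket _ => .br
  | .bracketX _ => .brX
  | .cobracket _ => .cobr
  | .cobracketX _ => .cobrX
  | .horizontal _ => .hor
  | .vertical _ => .ver
  | .empty => .empty

theorem Tile.shape_left (t : Tile n m) : t.shape.left = decide (0 < t.left) := by
  cases t <;> simp [shape, Tile.left, RTile.left]

theorem Tile.shape_right (t : Tile n m) : t.shape.right = decide (0 < t.right) := by
  cases t <;> simp [shape, Tile.right, RTile.right]

theorem Tile.shape_top (t : Tile n m) : t.shape.top = decide (0 < t.top) := by
  cases t <;> simp [shape, Tile.top, RTile.top]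

theorem Tile.shape_bottom (t : Tile n m) : t.shape.bottom = decide (0 < t.bottom) := by
  cases t <;> simp [shape, Tile.bottom, RTile.bottom]

/-- The maximum with `1` reflects that the list of labels of a row always contains the label of the
row itself, even beyond a bracket tile, where no string is left. -/
theorem Tile.max_left (t : Tile n m) : max 1 t.left = max 1 t.right + t.shape.cobrNum := by
  cases t <;> simp [shape, Tile.left, Tile.right, cobrNum]

theorem Tile.max_top (t : Tile n m) : max 1 t.top = max 1 t.bottom + t.shape.brNum := by
  cases t <;> simp [shape, Tile.top, Tile.bottom, brNum]

/-- The shapes of the tiles. -/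
def shapes (L : Tiling n m) : Fin n → Fin m → RTile := fun i j => (L i j).shape

/-- The number of strings on the left edge of column `j` of a row, or on its right border. -/
def horWeight (L : Tiling n m) (i : Fin n) (j : ℕ) : ℕ :=
  if h : j < m then (L i ⟨j, h⟩).left else rightWeight L i

/-- The number of strings on the top edge of row `i` of a column, or on its bottom border. -/
def verWeight (L : Tiling n m) (i : ℕ) (j : Fin m) : ℕ :=
  if h : i < n then (L ⟨i, h⟩ j).top else bottomWeight L j

variable {L : Tiling n m}

theorem left_eq (i : Fin n) (j : Fin m) : (L i j).left = horWeight L i j := by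
  simp [horWeight]

theorem top_eq (i : Fin n) (j : Fin m) : (L i j).top = verWeight L i j := by
  simp [verWeight]

theorem horWeight_self (i : Fin n) : horWeight L i m = rightWeight L i := by
  simp [horWeight]

theorem verWeight_self (j : Fin m) : verWeight L n j = bottomWeight L j := by
  simp [verWeight]

theorem horWeight_zero (i : Fin n) : horWeight L i 0 = leftWeight L i := by
  unfold horWeight leftWeight rightWeight
  split_ifs <;> rfl

theorem verWeight_zero (j : Fin m) : verWeight L 0 j = topWeight L j := by
  unfold verWeight topWeight bottomWeight
  split_ifs <;> rfl

theorem IsLoom.right_eq (hL : IsLoom L) (i : Fin n) (j : Fin m) :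
    (L i j).right = horWeight L i (j + 1) := by
  unfold horWeight
  split_ifs with h
  · exact hL.horizontal_match i j h
  · have hj : j = ⟨m - 1, Nat.sub_one_lt_of_lt j.2⟩ := Fin.ext (by have := j.2; simp only; omega)
    rw [rightWeight, dif_pos j.pos, ← hj]

theorem IsLoom.bottom_eq (hL : IsLoom L) (i : Fin n) (j : Fin m) :
    (L i j).bottom = verWeight L (i + 1) j := by
  unfold verWeight
  split_ifs with h
  · exact hL.vertical_match i j h
  · have hi : i = ⟨n - 1, Nat.sub_one_lt_of_lt i.2⟩ := Fin.ext (by have := i.2; simp only; omega)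
    rw [bottomWeight, dif_pos i.pos, ← hi]

theorem IsLoom.horWeight_zero_pos (hL : IsLoom L) (i : Fin n) : 0 < horWeight L i 0 := by
  rw [horWeight_zero, leftWeight]
  split_ifs with h
  · obtain ⟨h1, h2⟩ := hL.first_column h i
    cases ht : L i ⟨0, h⟩ <;> simp_all [Tile.left]
  · exact one_pos

theorem IsLoom.verWeight_zero_pos (hL : IsLoom L) (j : Fin m) : 0 < verWeight L 0 j := by
  rw [verWeight_zero, topWeight]
  split_ifs with h
  · obtain ⟨h1, h2⟩ := hL.first_row h j
    cases ht : L ⟨0, h⟩ j <;> simp_all [Tile.top]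
  · exact one_pos

theorem IsLoom.occupies (hL : IsLoom L) : Occupies (shapes L)
    (fun i j => decide (0 < horWeight L i j)) (fun i j => decide (0 < verWeight L i j)) where
  left i j := by rw [shapes, Tile.shape_left, left_eq]
  right i j := by rw [shapes, Tile.shape_right, hL.right_eq]
  top i j := by rw [shapes, Tile.shape_top, top_eq]
  bottom i j := by rw [shapes, Tile.shape_bottom, hL.bottom_eq]

theorem IsLoom.fits (hL : IsLoom L) : Fits (fun _ => true) (shapes L) :=
  fits_iff.2 ⟨_, _, hL.occupies, fun i => decide_eq_true (hL.horWeight_zero_pos i),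
    funext fun j => decide_eq_true (hL.verWeight_zero_pos j)⟩

theorem Occupies.sum_cobrNum {f : Fin n → Fin m → RTile} {H : Fin n → ℕ → Bool}
    {V : ℕ → Fin m → Bool} (h : Occupies f H V) (j : Fin m) :
    (V 0 j).toNat = (V n j).toNat + ∑ i, (f i j).cobrNum :=
  telescope (x := fun i => (V i j).toNat) fun i => by
    rw [← h.top, ← h.bottom, top_toNat]

theorem Occupies.sum_brNum {f : Fin n → Fin m → RTile} {H : Fin n → ℕ → Bool}
    {V : ℕ → Fin m → Bool} (h : Occupies f H V) (i : Fin n) :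
    (H i 0).toNat = (H i m).toNat + ∑ j, (f i j).brNum :=
  telescope (x := fun j => (H i j).toNat) fun j => by
    rw [← h.left, ← h.right, left_toNat]

/-- A count of ingoing strings. Row `i` has `1` string on the left, plus one for each cobracket-type
tile, plus the excess over `1` on its right border. Column `j` either has strings on its bottom
border or contains exactly one cobracket-type tile. Adding up, the ingoing strings number `n + m`
plus all the excesses on the right and bottom borders, so the condition on their number makes every
excess zero. -/
theorem IsLoom.border_le (hL : IsLoom L) :
    (∀ i, horWeight L i m ≤ 1) ∧ ∀ j, verWeight L n j ≤ 1 := by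
  have h1 : ∀ i, leftWeight L i =
      1 + (max 1 (horWeight L i m) - 1) + ∑ j, (shapes L i j).cobrNum := fun i => by
    have h := telescope (x := fun j => max 1 (horWeight L i j)) fun j => by
      rw [← left_eq, ← hL.right_eq]
      exact Tile.max_left _
    have h0 := hL.horWeight_zero_pos i
    rw [horWeight_zero] at h h0
    change max 1 _ = _ + ∑ j, (shapes L i j).cobrNum at h
    omega
  have h2 : ∀ j, bottomWeight L j + ∑ i, (shapes L i j).cobrNum =
      1 + (verWeight L n j - 1) := fun j => by
    have h := hL.occupies.sum_cobrNum j
    have h0 := hL.verWeight_zero_pos j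
    rw [← verWeight_self]
    by_cases h3 : 0 < verWeight L n j
    · simp only [decide_eq_true h0, decide_eq_true h3, Bool.toNat_true] at h
      omega
    · simp only [decide_eq_true h0, decide_eq_false h3, Bool.toNat_true, Bool.toNat_false] at h
      omega
  have h3 : ∑ i, (max 1 (horWeight L i m) - 1) + ∑ j, (verWeight L n j - 1) = 0 := by
    have h := hL.ingoing
    have h4 := Finset.sum_congr rfl fun j (_ : j ∈ Finset.univ) => h2 j
    simp only [h1, Finset.sum_add_distrib, Finset.sum_const, Finset.card_univ, Fintype.card_fin,
      smul_eq_mul, mul_one] at h h4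
    rw [Finset.sum_comm] at h4
    omega
  rw [Nat.add_eq_zero_iff, Finset.sum_eq_zero_iff, Finset.sum_eq_zero_iff] at h3
  refine ⟨fun i => ?_, fun j => ?_⟩
  · have := h3.1 i (Finset.mem_univ i)
    omega
  · have := h3.2 j (Finset.mem_univ j)
    omega

variable {ℓ : Type*}

theorem IsLoom.length_rowLabels (hL : IsLoom L) (a : ℓ) (cl : Fin m → ℓ) (i : Fin n) {j : ℕ}
    (hj : j ≤ m) : (rowLabels a cl (shapes L i) j).length = max 1 (horWeight L i j) := by
  refine fin_downward (P := fun j => (rowLabels a cl (shapes L i) j).length =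
    max 1 (horWeight L i j)) ?_ (fun j hj => ?_) hj
  · rw [rowLabels_self, max_eq_left (hL.border_le.1 i), List.length_singleton]
  · rw [← hL.right_eq] at hj
    rw [← left_eq, Tile.max_left, ← hj, length_rowLabels_eq]
    rfl

theorem IsLoom.length_colLabels (hL : IsLoom L) (rl : Fin n → ℓ) (c : ℓ) (j : Fin m) {i : ℕ}
    (hi : i ≤ n) : (colLabels rl c (fun i => shapes L i j) i).length =
      max 1 (verWeight L i j) := by
  refine fin_downward (P := fun i => (colLabels rl c (fun i => shapes L i j) i).length =
    max 1 (verWeight L i j)) ?_ (fun i hi => ?_) hi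
  · rw [colLabels_self, max_eq_left (hL.border_le.2 j), List.length_singleton]
  · rw [← hL.bottom_eq] at hi
    rw [← top_eq, Tile.max_top, ← hi, length_colLabels_eq]
    rfl

/-- The tile of a given shape with given numbers of additional parallel strings. -/
def RTile.toTile (t : RTile) (k : Fin m) (l : Fin n) : Tile n m :=
  match t with
  | .cross => .cross k l
  | .br => .bracket l
  | .brX => .bracketX l
  | .cobr => .cobracket k
  | .cobrX => .cobracketX k
  | .hor => .horizontal k
  | .ver => .vertical l
  | .empty => .empty

theorem RTile.shape_toTile (t : RTile) (k : Fin m) (l : Fin n) : (t.toTile k l).shape = t := by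
  cases t <;> rfl

theorem Tile.toTile_shape (t : Tile n m) {k : Fin m} {l : Fin n}
    (hk : (k : ℕ) + 1 = max 1 t.right) (hl : (l : ℕ) + 1 = max 1 t.bottom) :
    t.shape.toTile k l = t := by
  cases t <;> simp [Tile.right, Tile.bottom] at hk hl <;>
    simp [shape, RTile.toTile, Fin.ext_iff, hk, hl]

/-- The tiling with given shapes, each string having its own label. -/
def fill (f : Fin n → Fin m → RTile) : Tiling n m := fun i j =>
  (f i j).toTile
    ⟨(rowLabels () (fun _ => ()) (f i) (j + 1)).length - 1, by
      have := length_rowLabels_le () (fun _ => ()) (f i) (j := j + 1) j.2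
      have := j.2
      omega⟩
    ⟨(colLabels (fun _ => ()) () (fun i => f i j) (i + 1)).length - 1, by
      have := length_colLabels_le (fun _ => ()) () (fun i => f i j) (i := i + 1) i.2
      have := i.2
      omega⟩

theorem shapes_fill (f : Fin n → Fin m → RTile) : shapes (fill f) = f :=
  funext fun _ => funext fun _ => shape_toTile _ _ _

/-- Starting from the right and bottom borders, where there is at most one string per row or column,
the shapes dictate how many parallel strings there are on each edge; this is the number of labels.
-/
theorem IsLoom.fill_shapes (hL : IsLoom L) : fill (shapes L) = L := by
  funext i j
  refine Tile.toTile_shape _ ?_ ?_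
  · dsimp only
    rw [hL.length_rowLabels _ _ _ (Nat.add_one_le_iff.2 j.2), hL.right_eq]
    omega
  · dsimp only
    rw [hL.length_colLabels _ _ _ (Nat.add_one_le_iff.2 i.2), hL.bottom_eq]
    omega

end Shapes

/-! ### The loom of a filling. -/

section Filling

variable {n m : ℕ} {f : Fin n → Fin m → RTile} {H : Fin n → ℕ → Bool} {V : ℕ → Fin m → Bool}
  {ℓ : Type*}

theorem RTile.toTile_right (t : RTile) (k : Fin m) (l : Fin n) :
    (t.toTile k l).right = if t.right then (k : ℕ) + 1 else 0 := by
  cases t <;> rfl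

theorem RTile.toTile_bottom (t : RTile) (k : Fin m) (l : Fin n) :
    (t.toTile k l).bottom = if t.bottom then (l : ℕ) + 1 else 0 := by
  cases t <;> rfl

theorem RTile.toTile_left (t : RTile) {k : Fin m} (l : Fin n) (h : t.right = false → (k : ℕ) = 0) :
    (t.toTile k l).left = if t.left then k + 1 + t.cobrNum else 0 := by
  cases t <;> simp_all [RTile.toTile, Tile.left, RTile.left, RTile.right, cobrNum]

theorem RTile.toTile_top (t : RTile) (k : Fin m) {l : Fin n} (h : t.bottom = false → (l : ℕ) = 0) :
    (t.toTile k l).top = if t.top then l + 1 + t.brNum else 0 := by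
  cases t <;> simp_all [RTile.toTile, Tile.top, RTile.top, RTile.bottom, brNum]

/-- To the right of an unoccupied edge all tiles of the row are vertical or empty, so no further
label joins that of the row. -/
theorem Occupies.length_rowLabels (h : Occupies f H V) (a : ℓ) (cl : Fin m → ℓ) (i : Fin n) {j : ℕ}
    (hj : j ≤ m) : H i j = false → (rowLabels a cl (f i) j).length = 1 := by
  refine fin_downward (P := fun j => H i j = false → (rowLabels a cl (f i) j).length = 1)
    (fun _ => by rw [rowLabels_self, List.length_singleton]) (fun j ih hH => ?_) hj
  rw [← h.right] at ih
  rw [← h.left] at hH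
  rw [length_rowLabels_eq]
  cases ht : f i j <;> simp_all [RTile.left, RTile.right, cobrNum]

theorem Occupies.length_colLabels (h : Occupies f H V) (rl : Fin n → ℓ) (c : ℓ) (j : Fin m) {i : ℕ}
    (hi : i ≤ n) : V i j = false → (colLabels rl c (fun i => f i j) i).length = 1 := by
  refine fin_downward (P := fun i => V i j = false →
    (colLabels rl c (fun i => f i j) i).length = 1)
    (fun _ => by rw [colLabels_self, List.length_singleton]) (fun i ih hV => ?_) hi
  rw [← h.bottom] at ih
  rw [← h.top] at hV
  rw [length_colLabels_eq]
  cases ht : f i j <;> simp_all [RTile.top, RTile.bottom, brNum]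

theorem length_rowLabels_pos (a : ℓ) (cl : Fin m → ℓ) (g : Fin m → RTile) (j : Fin m) :
    0 < (rowLabels a cl g (j + 1)).length :=
  List.length_pos_of_mem (mem_rowLabels a cl g (Nat.add_one_le_iff.2 j.2))

theorem length_colLabels_pos (rl : Fin n → ℓ) (c : ℓ) (g : Fin n → RTile) (i : Fin n) :
    0 < (colLabels rl c g (i + 1)).length :=
  List.length_pos_of_mem (mem_colLabels rl c g (Nat.add_one_le_iff.2 i.2))

theorem Occupies.fill_right (h : Occupies f H V) (i : Fin n) (j : Fin m) : (fill f i j).right =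
    if H i (j + 1) then (rowLabels () (fun _ => ()) (f i) (j + 1)).length else 0 := by
  rw [fill, toTile_right, h.right]
  have := length_rowLabels_pos () (fun _ => ()) (f i) j
  split_ifs
  · dsimp only
    omega
  · rfl

theorem Occupies.fill_bottom (h : Occupies f H V) (i : Fin n) (j : Fin m) : (fill f i j).bottom =
    if V (i + 1) j then (colLabels (fun _ => ()) () (fun i => f i j) (i + 1)).length else 0 := by
  rw [fill, toTile_bottom, h.bottom]
  have := length_colLabels_pos (fun _ => ()) () (fun i => f i j) i
  split_ifs
  · dsimp only
    omega
  · rfl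

theorem Occupies.fill_left (h : Occupies f H V) (i : Fin n) (j : Fin m) : (fill f i j).left =
    if H i j then (rowLabels () (fun _ => ()) (f i) j).length else 0 := by
  have := length_rowLabels_pos () (fun _ => ()) (f i) j
  rw [fill, toTile_left, h.left, length_rowLabels_eq]
  · dsimp only
    split_ifs <;> omega
  · intro hr
    rw [h.right] at hr
    simp [h.length_rowLabels _ _ _ (Nat.add_one_le_iff.2 j.2) hr]

theorem Occupies.fill_top (h : Occupies f H V) (i : Fin n) (j : Fin m) : (fill f i j).top =
    if V i j then (colLabels (fun _ => ()) () (fun i => f i j) i).length else 0 := by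
  have := length_colLabels_pos (fun _ => ()) () (fun i => f i j) i
  rw [fill, toTile_top, h.top, length_colLabels_eq _ _ _ i]
  · dsimp only
    split_ifs <;> omega
  · intro hr
    rw [h.bottom] at hr
    simp [h.length_colLabels _ _ _ (Nat.add_one_le_iff.2 i.2) hr]

theorem Occupies.leftWeight_fill (h : Occupies f H V) {i : Fin n} (hH : H i 0 = true) :
    leftWeight (fill f) i = 1 + ∑ j, (f i j).cobrNum := by
  rw [← length_rowLabels_zero () fun _ => (), leftWeight]
  split_ifs with hm
  · rw [h.fill_left, if_pos hH]
  · obtain rfl : m = 0 := by omega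
    rw [rowLabels_self, List.length_singleton]

theorem Occupies.topWeight_fill (h : Occupies f H V) {j : Fin m} (hV : V 0 j = true) :
    topWeight (fill f) j = 1 + ∑ i, (f i j).brNum := by
  rw [← length_colLabels_zero (fun _ => ()) (), topWeight]
  split_ifs with hn
  · rw [h.fill_top, if_pos hV]
  · obtain rfl : n = 0 := by omega
    rw [colLabels_self, List.length_singleton]

theorem Occupies.rightWeight_fill (h : Occupies f H V) {i : Fin n} (hH : H i 0 = true) :
    rightWeight (fill f) i = (H i m).toNat := by
  rw [rightWeight]
  split_ifs with hm
  · have : m - 1 + 1 = m := by omega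
    rw [h.fill_right]
    simp only [this, rowLabels_self]
    cases H i m <;> rfl
  · obtain rfl : m = 0 := by omega
    rw [hH]
    rfl

theorem Occupies.bottomWeight_fill (h : Occupies f H V) {j : Fin m} (hV : V 0 j = true) :
    bottomWeight (fill f) j = (V n j).toNat := by
  rw [bottomWeight]
  split_ifs with hn
  · have : n - 1 + 1 = n := by omega
    rw [h.fill_bottom]
    simp only [this, colLabels_self]
    cases V n j <;> rfl
  · obtain rfl : n = 0 := by omega
    rw [hV]
    rfl

/-- For the counts: each column has either one string on the bottom border or exactly one
cobracket-type tile, which adds one string to the left border of its row. The outgoing strings are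
counted in the same way with bracket-type tiles. -/
theorem Occupies.isLoom_fill (h : Occupies f H V) (hH : ∀ i, H i 0 = true)
    (hV : ∀ j, V 0 j = true) : IsLoom (fill f) where
  vertical_match i j hi := by rw [h.fill_bottom, h.fill_top]
  horizontal_match i j hj := by rw [h.fill_right, h.fill_left]
  ingoing := by
    have h1 : ∀ j, bottomWeight (fill f) j + ∑ i, (f i j).cobrNum = 1 := fun j => by
      rw [h.bottomWeight_fill (hV j), ← h.sum_cobrNum, hV]
      rfl
    have h2 := Finset.sum_congr rfl fun j (_ : j ∈ Finset.univ) => h1 j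
    simp only [h.leftWeight_fill (hH _), Finset.sum_add_distrib, Finset.sum_const,
      Finset.card_univ, Fintype.card_fin, smul_eq_mul, mul_one] at h2 ⊢
    rw [Finset.sum_comm] at h2
    omega
  outgoing := by
    have h1 : ∀ i, rightWeight (fill f) i + ∑ j, (f i j).brNum = 1 := fun i => by
      rw [h.rightWeight_fill (hH i), ← h.sum_brNum, hH]
      rfl
    have h2 := Finset.sum_congr rfl fun i (_ : i ∈ Finset.univ) => h1 i
    simp only [h.topWeight_fill (hV _), Finset.sum_add_distrib, Finset.sum_const,
      Finset.card_univ, Fintype.card_fin, smul_eq_mul, mul_one] at h2 ⊢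
    rw [Finset.sum_comm] at h2
    omega
  first_row hn j := by
    have h1 : (f ⟨0, hn⟩ j).top = true := (h.top _ _).trans (hV j)
    rw [← congrFun (congrFun (shapes_fill f) ⟨0, hn⟩) j, shapes] at h1
    refine ⟨fun k hk => ?_, fun hk => ?_⟩ <;> rw [hk] at h1 <;> cases h1
  first_column hm i := by
    have h1 : (f i ⟨0, hm⟩).left = true := (h.left _ _).trans (hH i)
    rw [← congrFun (congrFun (shapes_fill f) i) ⟨0, hm⟩, shapes] at h1
    refine ⟨fun k hk => ?_, fun hk => ?_⟩ <;> rw [hk] at h1 <;> cases h1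

theorem isLoom_fill (h : Fits (fun _ => true) f) : IsLoom (fill f) := by
  obtain ⟨H, V, hO, hH, hV⟩ := fits_iff.1 h
  exact hO.isLoom_fill hH (congrFun hV)

/-- Looms are the fillings of the grid by shapes of tiles that fit together. -/
def loomEquiv (n m : ℕ) :
    Loom n m ≃ {f : Fin n → Fin m → RTile // Fits (fun _ => true) f} where
  toFun L := ⟨shapes L.tiling, L.isLoom.fits⟩
  invFun f := ⟨fill f.1, isLoom_fill f.2⟩
  left_inv L := Loom.ext L.isLoom.fill_shapes
  right_inv f := Subtype.ext (shapes_fill f.1)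

theorem prod_rowSign_shapes (L : Loom n m) :
    ∏ i, rowSign (shapes L.tiling i) = (-1) ^ crossCount L := by
  classical
  have h : ∀ t : Tile n m, t.shape.sign =
      if (∃ k, t = Tile.cobracketX k) ∨ ∃ l, t = Tile.bracketX l then -1 else 1 := by
    intro t
    cases t <;> simp [Tile.shape, RTile.sign]
  simp only [rowSign, shapes, h, crossCount]
  rw [← Fintype.prod_prod_type', Finset.prod_ite]
  simp

end Filling

/-! ### Strings keep their labels. -/

section Trace

variable {n m : ℕ} {L : Tiling n m}

/-- The label of the string through a point: a row for the strings emitted by the coaction on the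
left of the loom, a column for the others. -/
def label (L : Tiling n m) : Point → Option (Fin n ⊕ Fin m)
  | .hor i j p =>
    if h : i < n then (rowLabels (Sum.inl ⟨i, h⟩) Sum.inr (shapes L ⟨i, h⟩) j)[p]? else none
  | .ver i j q =>
    if h : j < m then
      (colLabels Sum.inl (Sum.inr ⟨j, h⟩) (fun i => shapes L i ⟨j, h⟩) i)[q]? else none

theorem eq_singleton_of_mem {α : Type*} {a : α} {l : List α} (h : l.length = 1) (ha : a ∈ l) :
    l = [a] := by
  obtain ⟨b, rfl⟩ := List.length_eq_one_iff.1 h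
  rw [List.mem_singleton.1 ha]

/-- A check for each tile that labels move as strings do. At the turns, the counts identify the
string: right of a bracket tile no string remains, so the label list of the row is just the label of
the row; below a cobracket tile no string enters, so that of the column is just the label of the
column. -/
theorem IsLoom.label_step (hL : IsLoom L) {x : Point} (hx : OnString L x) (he : ¬ IsEnd m x) :
    label L (step L x) = label L x := by
  match x, hx, he with
  | .hor i j p, hx, he =>
    obtain ⟨hi, hp⟩ := hx
    have hj : j < m := not_le.1 he
    simp only [hj, dif_pos] at hp
    have hs : step L (.hor i j p) = fromLeft (L ⟨i, hi⟩ ⟨j, hj⟩) i j p := dif_pos ⟨hi, hj⟩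
    have hrow := rowLabels_eq (Sum.inl (⟨i, hi⟩ : Fin n)) Sum.inr (shapes L ⟨i, hi⟩) ⟨j, hj⟩
    have hcol := colLabels_eq (Sum.inl (α := Fin n)) (Sum.inr (⟨j, hj⟩ : Fin m)) (fun i => shapes L i ⟨j, hj⟩) ⟨i, hi⟩
    have hrl := hL.length_rowLabels (Sum.inl (⟨i, hi⟩ : Fin n)) Sum.inr ⟨i, hi⟩ (j := j + 1) hj
    have hcc := hL.length_colLabels Sum.inl (Sum.inr (⟨j, hj⟩ : Fin m)) ⟨j, hj⟩ (i := i + 1) hi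
    have hrm := mem_rowLabels (Sum.inl (⟨i, hi⟩ : Fin n)) Sum.inr (shapes L ⟨i, hi⟩) (j := j + 1) hj
    have hcm := mem_colLabels Sum.inl (Sum.inr (⟨j, hj⟩ : Fin m)) (fun i => shapes L i ⟨j, hj⟩)
      (i := i + 1) hi
    have h1 := hL.right_eq ⟨i, hi⟩ ⟨j, hj⟩
    have h2 := hL.bottom_eq ⟨i, hi⟩ ⟨j, hj⟩
    dsimp only at h1 h2 hrow hcol
    rw [← h1] at hrl
    rw [← h2] at hcc
    have hl : ∀ p, label L (.hor i (j + 1) p) =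
        (rowLabels (Sum.inl (⟨i, hi⟩ : Fin n)) Sum.inr (shapes L ⟨i, hi⟩) (j + 1))[p]? := fun p =>
      dif_pos hi
    have hl' : ∀ q, label L (.ver i j q) =
        (colLabels Sum.inl (Sum.inr (⟨j, hj⟩ : Fin m)) (fun i => shapes L i ⟨j, hj⟩) i)[q]? := fun q =>
      dif_pos hj
    have hl0 : label L (.hor i j p) =
        (rowLabels (Sum.inl (⟨i, hi⟩ : Fin n)) Sum.inr (shapes L ⟨i, hi⟩) j)[p]? := dif_pos hi
    rw [hs, hl0, hrow]
    simp only [hcol] at hl'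
    clear hrow hcol h1 h2 hs hl0
    generalize rowLabels (Sum.inl (⟨i, hi⟩ : Fin n)) Sum.inr (shapes L ⟨i, hi⟩) (j + 1) = r at *
    generalize colLabels Sum.inl (Sum.inr (⟨j, hj⟩ : Fin m)) (fun i => shapes L i ⟨j, hj⟩) (i + 1) = c at *
    simp only [shapes] at hl' ⊢
    generalize L ⟨i, hi⟩ ⟨j, hj⟩ = t at *
    cases t <;> simp only [Tile.left, Tile.right, Tile.bottom, Tile.shape, fromLeft, rowStep,
      colStep] at *
    case cross => exact hl p
    case bracket =>
      obtain rfl : p = 0 := by omega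
      rw [hl', eq_singleton_of_mem (by simpa using hrl) hrm]
      rfl
    case bracketX =>
      obtain rfl : p = 0 := by omega
      rw [hl', eq_singleton_of_mem (by simpa using hrl) hrm, List.getElem?_append_right (by omega)]
      simp [hcc]
    case cobracket =>
      cases p with
      | zero =>
        rw [if_pos rfl, hl', eq_singleton_of_mem (by simpa using hcc) hcm]
        rfl
      | succ p => simp [hl]
    case cobracketX k =>
      split_ifs with h
      · subst h
        rw [hl', eq_singleton_of_mem (by simpa using hcc) hcm,
          List.getElem?_append_right (by omega)]
        simp [hrl]
      · rw [hl, List.getElem?_append_left (by omega)]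
    case horizontal => exact hl p
    case vertical => omega
    case empty => omega
  | .ver 0 j q, hx, he => exact absurd rfl he
  | .ver (i + 1) j q, hx, he =>
    have hi : i < n := by
      obtain ⟨_, h⟩ := hx
      split_ifs at h <;> omega
    have hj : j < m := hx.1
    have hq := lt_bottom hL hi hj hx
    have hs : step L (.ver (i + 1) j q) = fromBottom (L ⟨i, hi⟩ ⟨j, hj⟩) i j q := dif_pos ⟨hi, hj⟩
    have hcol := colLabels_eq (Sum.inl (α := Fin n)) (Sum.inr (⟨j, hj⟩ : Fin m)) (fun i => shapes L i ⟨j, hj⟩) ⟨i, hi⟩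
    have hcc := hL.length_colLabels Sum.inl (Sum.inr (⟨j, hj⟩ : Fin m)) ⟨j, hj⟩ (i := i + 1) hi
    have h2 := hL.bottom_eq ⟨i, hi⟩ ⟨j, hj⟩
    dsimp only at h2 hcol
    rw [← h2] at hcc
    have hl' : ∀ q, label L (.ver i j q) =
        (colLabels Sum.inl (Sum.inr (⟨j, hj⟩ : Fin m)) (fun i => shapes L i ⟨j, hj⟩) i)[q]? := fun q =>
      dif_pos hj
    have hl0 : label L (.ver (i + 1) j q) =
        (colLabels Sum.inl (Sum.inr (⟨j, hj⟩ : Fin m)) (fun i => shapes L i ⟨j, hj⟩) (i + 1))[q]? :=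
      dif_pos hj
    rw [hs, hl0]
    simp only [hcol] at hl'
    clear hcol h2 hs hl0
    generalize colLabels Sum.inl (Sum.inr (⟨j, hj⟩ : Fin m)) (fun i => shapes L i ⟨j, hj⟩) (i + 1) = c at *
    simp only [shapes] at hl'
    generalize L ⟨i, hi⟩ ⟨j, hj⟩ = t at *
    cases t <;> simp only [Tile.bottom, Tile.shape, fromBottom, colStep] at *
    case cross => exact hl' q
    case bracket => simp [hl']
    case bracketX => rw [hl', List.getElem?_append_left (by omega)]
    case vertical => exact hl' q
    all_goals omega

theorem IsLoom.label_trace (hL : IsLoom L) {x : Point} (hx : OnString L x) :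
    label L (trace L x) = label L x := by
  have h : ∀ t, OnString L ((step L)^[t] x) ∧ label L ((step L)^[t] x) = label L x := by
    intro t
    induction t with
    | zero => exact ⟨hx, rfl⟩
    | succ t ih =>
      rw [Function.iterate_succ_apply']
      by_cases he : IsEnd m ((step L)^[t] x)
      · rwa [step_of_isEnd L he]
      · exact ⟨(step_spec hL ih.1 he).1, (hL.label_step ih.1 he).trans ih.2⟩
  exact (h _).2

/-- The labels of the ingoing strings of a filling. -/
noncomputable def inLabels (σ : Equiv.Perm (Fin n)) (f : Fin n → Fin m → RTile) : List (Fin n ⊕ Fin m) :=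
  (List.ofFn fun i => (Sum.inl (σ i) : Fin n ⊕ Fin m)).flatMap
      (Function.extend Sum.inl (fun i => rowBlock (Sum.inl i) Sum.inr (f i)) fun x => [x]) ++
    selected (fun j => bottomBit true fun i => f i j) Sum.inr

/-- The labels of the outgoing strings of a filling. -/
noncomputable def outLabels (f : Fin n → Fin m → RTile) (τ : Equiv.Perm (Fin m)) : List (Fin n ⊕ Fin m) :=
  (List.ofFn fun j => (Sum.inr (τ.symm j) : Fin n ⊕ Fin m)).flatMap
      (Function.extend Sum.inr (fun j => colBlock Sum.inl (Sum.inr j) fun i => f i j) fun x => [x]) ++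
    selected (fun i => rightBit true (f i)) Sum.inl

theorem map_range_getElem? {α : Type*} (l : List α) :
    (List.range l.length).map (fun i => l[i]?) = l.map some := by
  refine List.ext_getElem (by simp) fun i h1 h2 => ?_
  simp

theorem IsLoom.bottomBit_eq (hL : IsLoom L) (j : Fin m) :
    bottomBit true (fun i => shapes L i j) = decide (0 < verWeight L n j) := by
  rw [← decide_eq_true (hL.verWeight_zero_pos j)]
  exact DrinfeldYetter.bottomBit_eq (V := fun i => decide (0 < verWeight L i j))
    fun i => hL.occupies.bottom i j

theorem IsLoom.rightBit_eq (hL : IsLoom L) (i : Fin n) :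
    rightBit true (shapes L i) = decide (0 < horWeight L i m) := by
  rw [← decide_eq_true (hL.horWeight_zero_pos i)]
  exact DrinfeldYetter.rightBit_eq (H := fun j => decide (0 < horWeight L i j))
    fun j => hL.occupies.right i j

theorem IsLoom.map_label_ingoing (hL : IsLoom L) (σ : Equiv.Perm (Fin n)) :
    (DrinfeldYetter.ingoing σ L).map (label L) = (inLabels σ (shapes L)).map some := by
  rw [DrinfeldYetter.ingoing, inLabels, List.map_append, List.map_append, selected, List.map_flatMap,
    List.map_flatMap, List.map_flatMap, List.map_flatMap, List.ofFn_eq_map, List.flatMap_map]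
  congr 1
  · refine List.flatMap_congr fun i _ => ?_
    have h := hL.length_rowLabels (Sum.inl (σ i)) Sum.inr (σ i) (Nat.zero_le m)
    rw [max_eq_right (hL.horWeight_zero_pos _), horWeight_zero, rowLabels_zero] at h
    rw [Sum.inl_injective.extend_apply, ← map_range_getElem?, h, List.map_map]
    refine List.map_congr_left fun p _ => ?_
    simp [label, rowLabels_zero]
  · refine List.flatMap_congr fun j _ => ?_
    have h := hL.border_le.2 j
    rw [hL.bottomBit_eq, ← verWeight_self, List.map_map]
    obtain h | h : verWeight L n j = 0 ∨ verWeight L n j = 1 := by omega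
    · simp [h]
    · simp [h, label, colLabels_self]

theorem IsLoom.map_label_outgoing (hL : IsLoom L) (τ : Equiv.Perm (Fin m)) :
    (DrinfeldYetter.outgoing L τ).map (label L) = (outLabels (shapes L) τ).map some := by
  rw [DrinfeldYetter.outgoing, outLabels, List.map_append, List.map_append, selected, List.map_flatMap,
    List.map_flatMap, List.map_flatMap, List.map_flatMap, List.ofFn_eq_map, List.flatMap_map]
  congr 1
  · refine List.flatMap_congr fun j _ => ?_
    have h := hL.length_colLabels Sum.inl (Sum.inr (τ.symm j)) (τ.symm j) (Nat.zero_le n)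
    rw [max_eq_right (hL.verWeight_zero_pos _), verWeight_zero, colLabels_zero] at h
    rw [Sum.inr_injective.extend_apply, ← map_range_getElem?, h, List.map_map]
    refine List.map_congr_left fun p _ => ?_
    simp [label, colLabels_zero]
  · refine List.flatMap_congr fun i _ => ?_
    have h := hL.border_le.1 i
    rw [hL.rightBit_eq, ← horWeight_self, List.map_map]
    obtain h | h : horWeight L i m = 0 ∨ horWeight L i m = 1 := by omega
    · simp [h]
    · simp [h, label, rowLabels_self]

theorem mem_selected {ℓ : Type*} {v : Fin m → Bool} {cl : Fin m → ℓ} {j : Fin m} (h : v j = true) :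
    cl j ∈ selected v cl :=
  List.mem_flatMap.2 ⟨j, List.mem_finRange j, by simp [h]⟩

theorem exists_eq_one {n : ℕ} {c : Fin n → ℕ} (h : ∑ i, c i = 1) : ∃ i, c i ≠ 0 := by
  by_contra! h'
  simp [h'] at h

/-- The label of a row lies in its own block. The label of a column either enters from the bottom or
belongs to the block of the row where the column has its cobracket-type tile. -/
theorem IsLoom.mem_inLabels (hL : IsLoom L) (σ : Equiv.Perm (Fin n)) (x : Fin n ⊕ Fin m) :
    x ∈ inLabels σ (shapes L) := by
  rw [inLabels, List.mem_append, List.mem_flatMap, List.ofFn_eq_map]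
  have h : ∀ i, (∃ y ∈ (List.finRange n).map fun i => (Sum.inl (σ i) : Fin n ⊕ Fin m),
      x ∈ Function.extend Sum.inl (fun i => rowBlock (Sum.inl i) Sum.inr (shapes L i))
        (fun x => [x]) y) ∨ x ∉ rowBlock (Sum.inl i) Sum.inr (shapes L i) := fun i => by
    by_cases hx : x ∈ rowBlock (Sum.inl i) Sum.inr (shapes L i)
    · refine Or.inl ⟨Sum.inl i, ?_, by rwa [Sum.inl_injective.extend_apply]⟩
      exact List.mem_map.2 ⟨σ.symm i, List.mem_finRange _, by simp⟩
    · exact Or.inr hx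
  cases x with
  | inl i => exact Or.inl ((h i).resolve_right (not_not.2 (mem_rowBlock.2 (Or.inl rfl))))
  | inr j =>
    cases hb : bottomBit true fun i => shapes L i j with
    | true => exact Or.inr (mem_selected hb)
    | false =>
      have h1 := hL.occupies.sum_cobrNum j
      rw [← hL.bottomBit_eq, hb, decide_eq_true (hL.verWeight_zero_pos j)] at h1
      obtain ⟨i, hi⟩ := exists_eq_one (c := fun i => (shapes L i j).cobrNum)
        (by simpa using h1.symm)
      refine Or.inl ((h i).resolve_right (not_not.2 (mem_rowBlock.2 (Or.inr ⟨j, ?_, rfl⟩))))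
      by_contra hc
      exact hi (if_neg hc)

theorem IsLoom.mem_outLabels (hL : IsLoom L) (τ : Equiv.Perm (Fin m)) (x : Fin n ⊕ Fin m) :
    x ∈ outLabels (shapes L) τ := by
  rw [outLabels, List.mem_append, List.mem_flatMap, List.ofFn_eq_map]
  have h : ∀ j, (∃ y ∈ (List.finRange m).map fun j => (Sum.inr (τ.symm j) : Fin n ⊕ Fin m),
      x ∈ Function.extend Sum.inr (fun j => colBlock Sum.inl (Sum.inr j) fun i => shapes L i j)
        (fun x => [x]) y) ∨ x ∉ colBlock Sum.inl (Sum.inr j) fun i => shapes L i j := fun j => by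
    by_cases hx : x ∈ colBlock Sum.inl (Sum.inr j) fun i => shapes L i j
    · refine Or.inl ⟨Sum.inr j, ?_, by rwa [Sum.inr_injective.extend_apply]⟩
      exact List.mem_map.2 ⟨τ j, List.mem_finRange _, by simp⟩
    · exact Or.inr hx
  cases x with
  | inr j => exact Or.inl ((h j).resolve_right (not_not.2 (mem_colBlock.2 (Or.inl rfl))))
  | inl i =>
    cases hb : rightBit true (shapes L i) with
    | true => exact Or.inr (mem_selected hb)
    | false =>
      have h1 := hL.occupies.sum_brNum i
      rw [← hL.rightBit_eq, hb, decide_eq_true (hL.horWeight_zero_pos i)] at h1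
      obtain ⟨j, hj⟩ := exists_eq_one (c := fun j => (shapes L i j).brNum)
        (by simpa using h1.symm)
      refine Or.inl ((h j).resolve_right (not_not.2 (mem_colBlock.2 (Or.inr ⟨i, ?_, rfl⟩))))
      by_contra hc
      exact hj (if_neg hc)

theorem IsLoom.length_inLabels (hL : IsLoom L) (σ : Equiv.Perm (Fin n)) :
    (inLabels σ (shapes L)).length = n + m := by
  rw [← length_ingoing hL σ, ← List.length_map (label L), hL.map_label_ingoing, List.length_map]

theorem IsLoom.length_outLabels (hL : IsLoom L) (τ : Equiv.Perm (Fin m)) :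
    (outLabels (shapes L) τ).length = n + m := by
  rw [← length_outgoing hL τ, ← List.length_map (label L), hL.map_label_outgoing, List.length_map]

/-- A list that contains all labels and has the right length contains each of them once; this
replaces a direct verification of distinctness. -/
theorem perm_univ_toList {α : Type*} [Fintype α] {l : List α} (h : ∀ x, x ∈ l)
    (hl : l.length = Fintype.card α) : (Finset.univ : Finset α).toList.Perm l :=
  (List.subperm_of_subset (Finset.nodup_toList _) fun x _ => h x).perm_of_length_le
    (by rw [hl, Finset.length_toList, Finset.card_univ])

theorem IsLoom.perm_inLabels (hL : IsLoom L) (σ : Equiv.Perm (Fin n)) :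
    (Finset.univ : Finset (Fin n ⊕ Fin m)).toList.Perm (inLabels σ (shapes L)) :=
  perm_univ_toList (hL.mem_inLabels σ) (by simp [hL.length_inLabels])

theorem IsLoom.perm_outLabels (hL : IsLoom L) (τ : Equiv.Perm (Fin m)) :
    (Finset.univ : Finset (Fin n ⊕ Fin m)).toList.Perm (outLabels (shapes L) τ) :=
  perm_univ_toList (hL.mem_outLabels τ) (by simp [hL.length_outLabels])

/-- An ingoing string and its end have the same label, so the permutation of the loom matches equal
labels in the two lists. This is precisely the condition under which `r_eq` applies. -/
theorem getElem?_outLabels_gluedPerm (σ : Equiv.Perm (Fin n)) (L : Loom n m)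
    (τ : Equiv.Perm (Fin m)) (a : Fin (n + m)) :
    (outLabels (shapes L.tiling) τ)[(gluedPerm σ L τ a : ℕ)]? =
      (inLabels σ (shapes L.tiling))[(a : ℕ)]? := by
  have hL := L.isLoom
  have ha : (a : ℕ) < (ingoing σ L.tiling).length := by
    rw [length_ingoing hL]
    exact a.2
  have hmem : (ingoing σ L.tiling)[(a : ℕ)] ∈ ingoing σ L.tiling := List.getElem_mem _
  have hout := trace_mem_outgoing hL σ τ hmem
  have h1 : (outgoing L.tiling τ)[(gluedPerm σ L τ a : ℕ)]? =
      some (trace L.tiling (ingoing σ L.tiling)[(a : ℕ)]) := List.getElem?_idxOf hout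
  have h2 := congrArg (fun l => l[(gluedPerm σ L τ a : ℕ)]?) (hL.map_label_outgoing τ)
  have h3 := congrArg (fun l => l[(a : ℕ)]?) (hL.map_label_ingoing σ)
  simp only [List.getElem?_map, h1, Option.map_some, List.getElem?_eq_getElem ha] at h2 h3
  rw [hL.label_trace (mem_ingoing hmem).1, h3] at h2
  exact (Option.map_injective (Option.some_injective _) h2).symm

end Trace

/-! ### The product formula. -/

section Product

variable (K : Type*) [Field K] {n m : ℕ}

theorem StrandCalculus.mulC_mul_mulA_unitFamily {𝒞 : Type*} [Category 𝒞] [Preadditive 𝒞] {ℓ : Type*}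
    (X : StrandCalculus 𝒞 ℓ) {e p : List ℓ} (he : e.Nodup) (h : e.Perm p) :
    ((mulC X.opC e * mulA X.opA p) X.unitFamily).1 [] = X.coactL e ≫ X.pm e p ≫ X.actL p :=
  (prodC_mul_prodA_apply X.unitFamily he h).trans (Category.comp_id _)

/-- The value at the module of the image of the unit family. -/
def evalUnit {𝒞 : Type*} [Category 𝒞] [Preadditive 𝒞] {ℓ : Type*} (X : StrandCalculus 𝒞 ℓ) :
    AddMonoid.End X.families →+ (X.V ⟶ X.V) where
  toFun T := (T X.unitFamily).1 []
  map_zero' := rfl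
  map_add' _ _ := rfl

/-- The strands of the left factor are named by their positions at the actions, which face the grid;
those of the right factor, in `r_right`, by their positions at the coactions. Thus `σ` and `τ`
appear only on the outer sides. -/
theorem r_left (σ : Equiv.Perm (Fin n)) {ℓ : Type} {rl : Fin n → ℓ} (h : Function.Injective rl) :
    r K σ = (strandCalculus K ℓ).coactL (List.ofFn fun i => rl (σ i)) ≫
      (strandCalculus K ℓ).pm (List.ofFn fun i => rl (σ i)) (List.ofFn rl) ≫
        (strandCalculus K ℓ).actL (List.ofFn rl) :=
  r_eq K σ (List.length_ofFn) (List.length_ofFn) (List.nodup_ofFn.2 h) fun i => by simp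

theorem r_right (τ : Equiv.Perm (Fin n)) {ℓ : Type} {cl : Fin n → ℓ} (h : Function.Injective cl) :
    r K τ = (strandCalculus K ℓ).coactL (List.ofFn cl) ≫
      (strandCalculus K ℓ).pm (List.ofFn cl) (List.ofFn fun i => cl (τ.symm i)) ≫
        (strandCalculus K ℓ).actL (List.ofFn fun i => cl (τ.symm i)) :=
  r_eq K τ (List.length_ofFn) (List.length_ofFn)
    (List.nodup_ofFn.2 (h.comp τ.symm.injective)) fun i => by simp

theorem r_gluedPerm (σ : Equiv.Perm (Fin n)) (L : Loom n m) (τ : Equiv.Perm (Fin m)) :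
    r K (gluedPerm σ L τ) =
      evalUnit (strandCalculus K (Fin n ⊕ Fin m))
        (mulC (strandCalculus K (Fin n ⊕ Fin m)).opC (inLabels σ (shapes L.tiling)) *
          mulA (strandCalculus K (Fin n ⊕ Fin m)).opA (outLabels (shapes L.tiling) τ)) := by
  have hE := L.isLoom.perm_inLabels σ
  have hP := L.isLoom.perm_outLabels τ
  refine (r_eq K (gluedPerm σ L τ) (L.isLoom.length_inLabels σ) (L.isLoom.length_outLabels τ)
    (hP.nodup_iff.1 (Finset.nodup_toList _))
    (getElem?_outLabels_gluedPerm σ L τ)).trans ?_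
  exact ((strandCalculus K _).mulC_mul_mulA_unitFamily (hE.nodup_iff.1 (Finset.nodup_toList _))
    (hE.symm.trans hP)).symm

theorem ofFn_comp_perm {α : Type*} {n : ℕ} (e : Equiv.Perm (Fin n)) (f : Fin n → α) :
    (List.ofFn fun i => f (e i)).Perm (List.ofFn f) :=
  Equiv.Perm.ofFn_comp_perm e f

/-- The operators of the right factor turn the unit family into a family whose value at the empty
list is that factor; the operators of the left factor are then evaluated on it. Disjoint labels make
both factors live in one ring. -/
theorem r_comp_r (σ : Equiv.Perm (Fin n)) (τ : Equiv.Perm (Fin m)) :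
    r K σ ≫ r K τ = evalUnit (strandCalculus K (Fin n ⊕ Fin m))
      (mulC (strandCalculus K (Fin n ⊕ Fin m)).opC (List.ofFn fun i => Sum.inl (σ i)) *
        mulA (strandCalculus K (Fin n ⊕ Fin m)).opA (List.ofFn Sum.inl) *
        mulC (strandCalculus K (Fin n ⊕ Fin m)).opC (selected (fun _ => true) Sum.inr) *
        mulA (strandCalculus K (Fin n ⊕ Fin m)).opA (List.ofFn fun j => Sum.inr (τ.symm j))) := by
  set X := strandCalculus K (Fin n ⊕ Fin m)
  have h1 := StrandCalculus.prodC_mul_prodA_apply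
    ((mulC X.opC (List.ofFn (Sum.inr : Fin m → Fin n ⊕ Fin m)) *
      mulA X.opA (List.ofFn fun j => Sum.inr (τ.symm j))) X.unitFamily)
    (List.nodup_ofFn.2 (Sum.inl_injective.comp σ.injective))
    (ofFn_comp_perm σ (Sum.inl : Fin n → Fin n ⊕ Fin m))
  have h2 := X.mulC_mul_mulA_unitFamily (List.nodup_ofFn.2 (Sum.inr_injective (α := Fin n)))
    (ofFn_comp_perm τ.symm (Sum.inr : Fin m → Fin n ⊕ Fin m)).symm
  rw [selected_true, mul_assoc (_ * _)]
  refine Eq.trans ?_ h1.symm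
  refine Eq.trans ?_ (congrArg (_ ≫ ·) h2.symm)
  exact congrArg₂ (· ≫ ·) (r_left K σ Sum.inl_injective) (r_right K τ Sum.inr_injective)

open Classical in
theorem count_ofFn_comp {ℓ : Type*} {f : Fin n → ℓ} (hf : Function.Injective f)
    (e : Equiv.Perm (Fin n)) (i : Fin n) : (List.ofFn fun i => f (e i)).count (f i) = 1 :=
  List.count_eq_one_of_mem (List.nodup_ofFn.2 (hf.comp e.injective))
    ((List.mem_ofFn' _ _).2 ⟨e.symm i, by simp⟩)

/-- Moving absorptions past emissions expands into a sum over looms. -/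
theorem ArrowRelations.loom_expansion {R : Type*} [Ring R] {C A : Fin n ⊕ Fin m → R}
    {M D : Fin n ⊕ Fin m → Fin n ⊕ Fin m → R} (H : ArrowRelations C A M D)
    (σ : Equiv.Perm (Fin n)) (τ : Equiv.Perm (Fin m)) :
    mulC C (List.ofFn fun i => Sum.inl (σ i)) * mulA A (List.ofFn Sum.inl) *
        mulC C (selected (fun _ => true) Sum.inr) *
        mulA A (List.ofFn fun j => Sum.inr (τ.symm j)) =
      ∑ L : Loom n m, ((-1 : ℤ) ^ crossCount L) •
        (mulC C (inLabels σ (shapes L.tiling)) * mulA A (outLabels (shapes L.tiling) τ)) := by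
  classical
  have h := H.fill_expansion (rl := Sum.inl) (cl := Sum.inr) Sum.inl_injective Sum.inr_injective
    (fun _ _ => Sum.inr_ne_inl) (fun _ => true) (u := List.ofFn fun i => Sum.inl (σ i))
    (p := List.ofFn fun j => Sum.inr (τ.symm j)) (count_ofFn_comp Sum.inl_injective σ)
    (fun j _ h => by simp [List.mem_ofFn'] at h) (fun i h => by simp [List.mem_ofFn'] at h)
    (fun j _ => count_ofFn_comp Sum.inr_injective τ.symm j)
  rw [h, ← Finset.sum_filter,
    Finset.sum_subtype (p := Fits fun _ => true) _ (fun f => by simp),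
    ← (loomEquiv n m).sum_comp]
  refine Finset.sum_congr rfl fun L _ => ?_
  rw [← prod_rowSign_shapes]
  rfl

/-- The families form only an additive group, so the signs in the expansion are integer multiples;
they become scalars of `K` only after evaluation. -/
theorem neg_one_pow_zsmul {M : Type*} [AddCommGroup M] [Module K M] (k : ℕ) (x : M) :
    ((-1 : ℤ) ^ k) • x = ((-1 : K) ^ k) • x := by
  rw [← Int.cast_smul_eq_zsmul K]
  simp

end Product

end DrinfeldYetter

theorem theorem4p4 (K : Type*) [Field K] [CharZero K] (n m : ℕ) (σ : Equiv.Perm (Fin n))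
    (τ : Equiv.Perm (Fin m)) :
    DrinfeldYetter.r K σ ≫ DrinfeldYetter.r K τ =
      ∑ L : DrinfeldYetter.Loom n m,
        (-1 : K) ^ DrinfeldYetter.crossCount L •
          DrinfeldYetter.r K (DrinfeldYetter.gluedPerm σ L τ) := by
  refine (DrinfeldYetter.r_comp_r K σ τ).trans ?_
  refine (congrArg _ ((DrinfeldYetter.StrandCalculus.arrowRelations _).loom_expansion σ τ)).trans ?_
  refine (map_sum _ _ _).trans (Finset.sum_congr rfl fun L _ => ?_)
  refine (map_zsmul _ _ _).trans ?_
  refine (DrinfeldYetter.neg_one_pow_zsmul K (M := DrinfeldYetter.V K ⟶ DrinfeldYetter.V K)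
    _ _).trans ?_
  exact congrArg _ (DrinfeldYetter.r_gluedPerm K σ L τ).symm
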